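/- Let $n\ge 2$, let $B_n\subset\mathbb C^n$ be the open unit ball, $\partial_j=\partial/\partial z_j$, $\bar\partial_j=\partial/\partial\bar z_j$ the Wirtinger operators, and call $f\in C^2(B_n)$ (complex-valued) M-harmonic if $$4(1-|z|^2)\sum_{j,k=1}^n(\delta_{jk}-z_j\bar z_k)\,\partial_j\bar\partial_k f=0\quad\text{on }B_n .$$ For $s>-1$ let $d\mu_s(z)=\frac{(s+1)_n}{\pi^n}(1-|z|^2)^s\,dz$ on $B_n$, where $(\nu)_k=\nu(\nu+1)\cdots(\nu+k-1)$ and $dz$ is Lebesgue measure, and let $\|f\|_s^2=\int_{B_n}|f|^2\,d\mu_s$. Let $\|\cdot\|_{\partial B_n}$ be the $L^2$-norm with respect to the normalized surface measure on the unit sphere. Put $$\mathcal N=\sum_{j}(z_j\partial_j+\bar z_j\bar\partial_j),\qquad X_0=\sum_{j}(z_j\partial_j-\bar z_j\bar\partial_j),$$ and let $X_1,\dots,X_{2n^2}$ be an enumeration of the operators $L_{jk}=\bar z_j\partial_k-\bar z_k\partial_j$ and $\bar L_{jk}=z_j\bar\partial_k-z_k\bar\partial_j$, $1\le j,k\le n$.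 For $p,q\ge0$ let $$S_{pq}(t)=\frac{(n)_p(n)_q}{(n)_{p+q}}\,{}_2F_1(p,q;p+q+n;t),$$ let $\widetilde{\mathcal H}^{pq}$ be the space of Euclidean-harmonic polynomials on $\mathbb C^n$ homogeneous of degree $p$ in $z$ and of degree $q$ in $\bar z$, and for $k\ge0$ let $$c_{pq,k}(s)=\int_0^1 t^{n-1}(1-t)^s\Big[\Big(2t\frac{d}{dt}\Big)^k\big(t^{\frac{p+q}2}S_{pq}(t)\big)\Big]^2dt\in[0,+\infty].$$ Every M-harmonic $f$ on $B_n$ has a unique decomposition $f=\sum_{p,q\ge0}f_{pq}$, $f_{pq}(z)=S_{pq}(|z|^2)\tilde f_{pq}(z)$ with $\tilde f_{pq}\in\widetilde{\mathcal H}^{pq}$, the series converging (unconditionally) uniformly on compact subsets of $B_n$; write $\|f_{pq}\|_{\partial B_n}:=\|\tilde f_{pq}\|_{\partial B_n}$. **Proposition 5.1.** For any $m\in\{0,1,\dots,n\}$, $s>-1$ and $f$ M-harmonic on $B_n$, the following assertions are equivalent: (a) $\displaystyle\sum_{l=0}^m\sum_{k=0}^l\ \sum_{j_1,\dots,j_{l-k}=0}^{2n^2}\|\mathcal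 N^kX_{j_1}\cdots X_{j_{l-k}}f\|_s^2<+\infty$; (b) $\displaystyle\sum_{l=0}^m\sum_{k=0}^l\ \sum_{p,q\ge0}(p+q)^{2(l-k)}\,c_{pq,k}(s)\,\|f_{pq}\|^2_{\partial B_n}<+\infty$ (with $0^0=1$ and $\infty\cdot0=0$); (c) $f\in W^m(B_n,d\mu_s)$, i.e. all weak derivatives $\partial^\alpha\bar\partial^\beta f$, $|\alpha|+|\beta|\le m$, exist and belong to $L^2(B_n,d\mu_s)$. Furthermore, the quantities in (a) and (b) are equivalent to the squared norm $\|f\|^2_{W^m(B_n,d\mu_s)}=\sum_{|\alpha|+|\beta|\le m}\|\partial^\alpha\bar\partial^\beta f\|_s^2$: each is bounded above and below by positive constant multiples of it, with constants depending only on $n$, $m$ and $s$. -/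

import Mathlib

open scoped ENNReal NNReal ContDiff ComplexConjugate
open MeasureTheory

noncomputable section

namespace MHarm

/-- The space `ℂⁿ` with its Euclidean norm. -/
abbrev Cn (n : ℕ) : Type := EuclideanSpace ℂ (Fin n)

/-- The open unit ball of `ℂⁿ`. -/
abbrev unitBall (n : ℕ) : Set (Cn n) := Metric.ball 0 1

/-! ### Differential operators -/

/-- The Wirtinger derivative `∂/∂z_j = (∂/∂x_j - i ∂/∂y_j) / 2`. -/
def dz {n : ℕ} (j : Fin n) (f : Cn n → ℂ) (z : Cn n) : ℂ :=
  (fderiv ℝ f z (EuclideanSpace.single j 1)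
    - Complex.I * fderiv ℝ f z (EuclideanSpace.single j Complex.I)) / 2

/-- The Wirtinger derivative `∂/∂z̄_j = (∂/∂x_j + i ∂/∂y_j) / 2`. -/
def dzbar {n : ℕ} (j : Fin n) (f : Cn n → ℂ) (z : Cn n) : ℂ :=
  (fderiv ℝ f z (EuclideanSpace.single j 1)
    + Complex.I * fderiv ℝ f z (EuclideanSpace.single j Complex.I)) / 2

/-- The invariant (hyperbolic) Laplacian
`4 (1 - |z|²) ∑_{j,k} (δ_{jk} - z_j z̄_k) ∂² / ∂z_j ∂z̄_k`. -/
def invLaplacian {n : ℕ} (f : Cn n → ℂ) (z : Cn n) : ℂ :=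
  4 * (1 - (‖z‖ : ℂ) ^ 2) *
    ∑ j, ∑ k, ((if j = k then 1 else 0) - z j * conj (z k)) * dz j (dzbar k f) z

/-- `f` is M-harmonic on the unit ball: twice continuously (real) differentiable there and
annihilated by the invariant Laplacian. Values of `f` outside the ball are irrelevant. -/
def IsMHarmonic {n : ℕ} (f : Cn n → ℂ) : Prop :=
  ContDiffOn ℝ 2 f (unitBall n) ∧ ∀ z ∈ unitBall n, invLaplacian f z = 0

/-- `L_{jk} = z̄_j ∂/∂z_k - z̄_k ∂/∂z_j`. -/
def opL {n : ℕ} (j k : Fin n) (f : Cn n → ℂ) (z : Cn n) : ℂ :=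
  conj (z j) * dz k f z - conj (z k) * dz j f z

/-- `L̄_{jk} = z_j ∂/∂z̄_k - z_k ∂/∂z̄_j`. -/
def opLbar {n : ℕ} (j k : Fin n) (f : Cn n → ℂ) (z : Cn n) : ℂ :=
  z j * dzbar k f z - z k * dzbar j f z

/-- The complex normal derivative `∑_j (z_j ∂/∂z_j - z̄_j ∂/∂z̄_j)`. -/
def opR {n : ℕ} (f : Cn n → ℂ) (z : Cn n) : ℂ :=
  ∑ j, (z j * dz j f z - conj (z j) * dzbar j f z)

/-- The real normal derivative `∑_j (z_j ∂/∂z_j + z̄_j ∂/∂z̄_j)`. -/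
def opN {n : ℕ} (f : Cn n → ℂ) (z : Cn n) : ℂ :=
  ∑ j, (z j * dz j f z + conj (z j) * dzbar j f z)

/-- Index set, with `2 n² + 1` elements, of the operators `X_0, X_1, …, X_{2n²}`. -/
abbrev XIndex (n : ℕ) : Type := Option ((Fin n × Fin n) ⊕ (Fin n × Fin n))

/-- The operators `X_0 = R` and `{X_1, …, X_{2n²}} = {L_{jk}} ∪ {L̄_{jk}}`. -/
def opX {n : ℕ} : XIndex n → (Cn n → ℂ) → (Cn n → ℂ)
  | none => opR
  | some (Sum.inl (j, k)) => opL j k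
  | some (Sum.inr (j, k)) => opLbar j k

/-- `X_{J 0} X_{J 1} … X_{J (r-1)} f`. -/
def iterX {n r : ℕ} (J : Fin r → XIndex n) (f : Cn n → ℂ) : Cn n → ℂ :=
  (List.ofFn J).foldr opX f

/-- The mixed derivative `∂^α ∂̄^β f`, where the multi-index `γ` encodes
`α_j = γ (inl j)` and `β_j = γ (inr j)`. -/
def mixedDeriv {n : ℕ} (γ : Fin n ⊕ Fin n → ℕ) (f : Cn n → ℂ) : Cn n → ℂ :=
  (List.finRange n).foldr
    (fun j g => (dz j)^[γ (Sum.inl j)] ((dzbar j)^[γ (Sum.inr j)] g)) f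

/-! ### Measures and norms -/

/-- The probability measure `(s+1)_n / πⁿ (1 - |z|²)^s dz` on the unit ball. -/
def mu (n : ℕ) (s : ℝ) : Measure (Cn n) :=
  (volume.restrict (unitBall n)).withDensity fun z =>
    ENNReal.ofReal ((ascPochhammer ℝ n).eval (s + 1) / Real.pi ^ n * (1 - ‖z‖ ^ 2) ^ s)

/-- `‖f‖_s² = ∫ |f|² dμ_s`, with values in `[0, ∞]`. -/
def sqNorm {n : ℕ} (s : ℝ) (f : Cn n → ℂ) : ℝ≥0∞ :=
  ∫⁻ z, ‖f z‖ₑ ^ 2 ∂(mu n s)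

/-- The normalized surface measure on the unit sphere. -/
def sigma (n : ℕ) : Measure (Metric.sphere (0 : Cn n) 1) :=
  ((volume : Measure (Cn n)).toSphere Set.univ)⁻¹ • (volume : Measure (Cn n)).toSphere

/-- The squared norm of `f` restricted to the unit sphere in `L²(dσ)`. -/
def sphereSqNorm {n : ℕ} (f : Cn n → ℂ) : ℝ≥0∞ :=
  ∫⁻ ζ, ‖f (ζ : Cn n)‖ₑ ^ 2 ∂(sigma n)

/-! ### Bigraded harmonics -/

/-- `F` is a (Euclidean) harmonic polynomial in `z, z̄` which is homogeneous of degree `p`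
in `z` and homogeneous of degree `q` in `z̄`. -/
def IsBigradedHarmonic {n : ℕ} (p q : ℕ) (F : Cn n → ℂ) : Prop :=
  (∃ P : MvPolynomial (Fin n ⊕ Fin n) ℂ,
    (∀ d ∈ P.support, ∑ j, d (Sum.inl j) = p ∧ ∑ j, d (Sum.inr j) = q) ∧
    ∀ z, F z = MvPolynomial.eval (Sum.elim (fun j => z j) (fun j => conj (z j))) P) ∧
  InnerProductSpace.HarmonicOnNhd F Set.univ

/-- `S_{pq}(t) = (n)_p (n)_q / (n)_{p+q} · ₂F₁(p, q; p+q+n; t)`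
(for `n ≥ 1` this is normalized by `S_{pq}(1) = 1`). -/
def S (n p q : ℕ) (t : ℝ) : ℝ :=
  (ascPochhammer ℝ p).eval (n : ℝ) * (ascPochhammer ℝ q).eval (n : ℝ)
      / (ascPochhammer ℝ (p + q)).eval (n : ℝ)
    * ordinaryHypergeometric (p : ℝ) (q : ℝ) ((p : ℝ) + q + n) t

/-- The family `F` consists of the boundary polynomials of the decomposition
`f = ∑_{p,q} f_{pq}`, `f_{pq}(z) = S_{pq}(|z|²) F_{pq}(z)`, of `f` into solid harmonics,
with convergence uniform on compact subsets of the ball. -/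
def IsPeterWeyl {n : ℕ} (f : Cn n → ℂ) (F : ℕ → ℕ → Cn n → ℂ) : Prop :=
  (∀ p q, IsBigradedHarmonic p q (F p q)) ∧
  HasSumLocallyUniformlyOn
    (fun (a : ℕ × ℕ) (z : Cn n) => (S n a.1 a.2 (‖z‖ ^ 2) : ℂ) * F a.1 a.2 z) f (unitBall n)

/-- The operator `2 t d/dt`. -/
def eulerOp (g : ℝ → ℝ) (t : ℝ) : ℝ := 2 * t * deriv g t

/-- `c_{pq,k}(s) = ∫_0^1 t^{n-1} (1-t)^s [(2t d/dt)^k (t^{(p+q)/2} S_{pq}(t))]² dt`,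
with values in `[0, ∞]`. -/
def coeff (n p q k : ℕ) (s : ℝ) : ℝ≥0∞ :=
  ∫⁻ t in Set.Ioo (0 : ℝ) 1, ENNReal.ofReal
    (t ^ (n - 1) * (1 - t) ^ s *
      (eulerOp^[k] (fun u => u ^ (((p : ℝ) + q) / 2) * S n p q u) t) ^ 2)

/-! ### The three quantities -/

/-- `∑_{l ≤ m} ∑_{k ≤ l} ∑_{j_1, …, j_{l-k}} ‖N^k X_{j_1} … X_{j_{l-k}} f‖_s²`. -/
def normalTangentialSum {n : ℕ} (m : ℕ) (s : ℝ) (f : Cn n → ℂ) : ℝ≥0∞ :=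
  ∑ l ∈ Finset.range (m + 1), ∑ k ∈ Finset.range (l + 1),
    ∑ J : Fin (l - k) → XIndex n, sqNorm s (opN^[k] (iterX J f))

/-- `∑_{l ≤ m} ∑_{k ≤ l} ∑_{p,q} (p+q)^{2(l-k)} c_{pq,k}(s) ‖f_{pq}‖²`. In `[0, ∞]` one has
`∞ * 0 = 0`, so an infinite coefficient forces the corresponding component to vanish. -/
def coeffSum {n : ℕ} (m : ℕ) (s : ℝ) (F : ℕ → ℕ → Cn n → ℂ) : ℝ≥0∞ :=
  ∑ l ∈ Finset.range (m + 1), ∑ k ∈ Finset.range (l + 1),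
    ∑' a : ℕ × ℕ, ((a.1 + a.2 : ℕ) : ℝ≥0∞) ^ (2 * (l - k)) * coeff n a.1 a.2 k s
      * sphereSqNorm (F a.1 a.2)

/-- `g` is the weak derivative `∂^α ∂̄^β f` on the unit ball, `γ = (α, β)`. -/
def IsWeakDeriv {n : ℕ} (γ : Fin n ⊕ Fin n → ℕ) (f g : Cn n → ℂ) : Prop :=
  LocallyIntegrableOn f (unitBall n) ∧ LocallyIntegrableOn g (unitBall n) ∧
  ∀ φ : Cn n → ℂ, ContDiff ℝ ∞ φ → HasCompactSupport φ → tsupport φ ⊆ unitBall n →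
    ∫ z in unitBall n, f z * mixedDeriv γ φ z
      = (-1) ^ (∑ i, γ i) * ∫ z in unitBall n, g z * φ z

/-- `f` belongs to the weighted Sobolev space `W^m(B_n, dμ_s)`: all its weak derivatives of
order at most `m` (including `f` itself) exist and belong to `L²(dμ_s)`. -/
def MemSobolev {n : ℕ} (m : ℕ) (s : ℝ) (f : Cn n → ℂ) : Prop :=
  ∀ γ : Fin n ⊕ Fin n → ℕ, ∑ i, γ i ≤ m → ∃ g, IsWeakDeriv γ f g ∧ MemLp g 2 (mu n s)

/-- The squared norm `∑_{|α|+|β| ≤ m} ‖∂^α ∂̄^β f‖_s²` in `W^m(B_n, dμ_s)`. A weak derivative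
is unique almost everywhere, so the infimum is over a single value; it is `∞` if
there is no weak derivative. -/
def sobolevSqNorm {n : ℕ} (m : ℕ) (s : ℝ) (f : Cn n → ℂ) : ℝ≥0∞ :=
  ∑ l ∈ Finset.range (m + 1), ∑ γ ∈ Finset.piAntidiag (Finset.univ : Finset (Fin n ⊕ Fin n)) l,
    ⨅ (g : Cn n → ℂ) (_ : IsWeakDeriv γ f g), sqNorm s g

end MHarm

end

/-! The operators `X` are linear vector fields tangent to every sphere centred at the origin. They
therefore annihilate functions of `|z|`, commute with dilations and with the Euler field `N`, and
map harmonic polynomials of bidegree `(p, q)` to harmonic polynomials with the same `p + q`. On the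
unit sphere `R` is symmetric and the adjoint of `L_{jk}` is `-L̄_{jk}`, and `∑ X* X` acts on
bidegree `(p, q)` as the scalar `(p - q)² + 2p(n - 1 + q) + 2q(n - 1 + p) = (p + q)² + 2(n - 1)(p +
q)`. This scalar depends only on `d = p + q`, so it can be iterated over words in the `X`, and it
lies between `d²` and `2n d²`.

On the sphere of radius `√t` the component `f_{pq}` is `g(t) F_{pq}(η)` with `g(t) = t^{(p+q)/2}
S_{pq}(t)`, and `N` acts there as `2t d/dt`. Polar coordinates and Parseval's identity on each
sphere turn `‖N^k X_J f‖_s²` into a constant times `∑ c_{pq,k}(s) ‖X_J F_{pq}‖²`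
(`IsCoeff.sqNorm_eq`). Summing over words `J` of a given length compares (a) with (b). No
asymptotics of the coefficients `c_{pq,k}` are needed.

For (a) and (c): `N` and the `X` have coefficients that are smooth up to the boundary, so (a) is
bounded by (c). Conversely, `|z|² ∂_j = ∑_k z_k L_{kj} + z̄_j (N + R)/2` and its conjugate analogue
recover every derivative where `|z| ≥ 1/2` (`exists_jet_le_ntsum`). All these fields vanish at the
origin, so on `|z| ≤ 1/2` an interior estimate is used instead: each derivative of `f` is bounded
there by `‖f‖_s` alone (`exists_norm_wds_le_sqrt_sqNorm`). It holds because derivatives of the solid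
harmonics on a small ball are geometrically small in `p + q` compared with their `L²` norm on a
larger sphere (`norm_iteratedFDeriv_solid_le`), while each such norm is bounded by one term of the
Parseval sum. Since `f` is smooth, its weak derivatives are the classical ones.

The decomposition itself is also proved. Pairing an M-harmonic `f` on the sphere of radius `√t` with
a bigraded harmonic gives a function of `t` that satisfies the radial equation of `g`
(`sphInt_ode`). A Wronskian argument shows that a solution bounded near `t = 0` together with its
derivative `2t d/dt` is a multiple of `g` (`radial_ode_unique`). The components thus determine `f`,
by density of polynomials on the sphere. The same equation without its degenerate factor yields the
mean value property of Euclidean harmonic functions, on which the supremum bounds for harmonic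
polynomials rest. -/

open scoped ENNReal NNReal ContDiff ComplexConjugate Topology
open MeasureTheory

noncomputable section

namespace MHarm

variable {n : ℕ}

/-! ### Wirtinger calculus -/

/-- `∂/∂z_j` for `inl j` and `∂/∂z̄_j` for `inr j`. -/
def wd (i : Fin n ⊕ Fin n) : (Cn n → ℂ) → Cn n → ℂ := Sum.elim dz dzbar i

/-- The coordinate function `z_j` for `inl j` and `z̄_j` for `inr j`. -/
def zc (i : Fin n ⊕ Fin n) (z : Cn n) : ℂ :=
  Sum.elim (fun j => z j) (fun j => conj (z j)) i

@[simp] lemma wd_inl (j : Fin n) : wd (Sum.inl j) = dz j := rfl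
@[simp] lemma wd_inr (j : Fin n) : wd (Sum.inr j) = dzbar j := rfl
@[simp] lemma zc_inl (j : Fin n) (z : Cn n) : zc (Sum.inl j) z = z j := rfl
@[simp] lemma zc_inr (j : Fin n) (z : Cn n) : zc (Sum.inr j) z = conj (z j) := rfl

/-- The sign distinguishing the two kinds of Wirtinger derivatives. -/
def wsign (i : Fin n ⊕ Fin n) : ℂ := Sum.elim (fun _ => -Complex.I) (fun _ => Complex.I) i

/-- The index of the coordinate. -/
def widx (i : Fin n ⊕ Fin n) : Fin n := Sum.elim id id i

/-- The functional on differentials which computes a Wirtinger derivative. -/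
def wl (i : Fin n ⊕ Fin n) : (Cn n →L[ℝ] ℂ) →L[ℝ] ℂ :=
  (1 / 2 : ℂ) • (ContinuousLinearMap.apply ℝ ℂ (EuclideanSpace.single (widx i) (1 : ℂ) : Cn n)
    + wsign i • ContinuousLinearMap.apply ℝ ℂ
      (EuclideanSpace.single (widx i) Complex.I : Cn n))

lemma wl_apply (i : Fin n ⊕ Fin n) (φ : Cn n →L[ℝ] ℂ) :
    wl i φ = (φ (EuclideanSpace.single (widx i) (1 : ℂ))
      + wsign i * φ (EuclideanSpace.single (widx i) Complex.I)) / 2 := by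
  simp [wl, ContinuousLinearMap.apply_apply]; ring

lemma wl_smul (i : Fin n ⊕ Fin n) (c : ℂ) (φ : Cn n →L[ℝ] ℂ) : wl i (c • φ) = c * wl i φ := by
  simp [wl_apply]; ring

lemma wd_eq (i : Fin n ⊕ Fin n) (f : Cn n → ℂ) (z : Cn n) : wd i f z = wl i (fderiv ℝ f z) := by
  rw [wl_apply]
  rcases i with j | j
  · simp [wd, dz, widx, wsign]; ring
  · simp [wd, dzbar, widx, wsign]

/-- Coordinates as real continuous linear maps. -/
def zcL (i : Fin n ⊕ Fin n) : Cn n →L[ℝ] ℂ :=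
  Sum.elim (fun j => (EuclideanSpace.proj j : Cn n →L[ℂ] ℂ).restrictScalars ℝ)
    (fun j => (Complex.conjCLE : ℂ →L[ℝ] ℂ).comp
      ((EuclideanSpace.proj j : Cn n →L[ℂ] ℂ).restrictScalars ℝ)) i

lemma zcL_apply (i : Fin n ⊕ Fin n) (z : Cn n) : zcL i z = zc i z := by
  rcases i with j | j <;> simp [zcL, zc]

lemma zc_eq (i : Fin n ⊕ Fin n) : zc i = (zcL i : Cn n → ℂ) :=
  funext fun z => (zcL_apply i z).symm

@[fun_prop] lemma contDiff_zc (i : Fin n ⊕ Fin n) {k : WithTop ℕ∞} : ContDiff ℝ k (zc i) := by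
  rw [zc_eq]; exact (zcL i).contDiff

@[fun_prop] lemma differentiable_zc (i : Fin n ⊕ Fin n) : Differentiable ℝ (zc i) :=
  (contDiff_zc i (k := 1)).differentiable one_ne_zero

lemma wl_zcL (i k : Fin n ⊕ Fin n) : wl i (zcL k) = if i = k then 1 else 0 := by
  rw [wl_apply, zcL_apply, zcL_apply]
  rcases i with i | i <;> rcases k with k | k <;> by_cases h : i = k <;>
    simp [widx, wsign, h, eq_comm]

/-- The forms `dz_j`, `dz̄_j` are a complex basis of the real-linear forms, and the functionals `wl`
are the dual basis. Every passage between Fréchet and Wirtinger derivatives goes through this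
expansion. -/
lemma clm_eq_sum (φ : Cn n →L[ℝ] ℂ) : φ = ∑ i, wl i φ • zcL i := by
  ext v
  have hv : v = ∑ j, ((v j).re • (EuclideanSpace.single j (1 : ℂ) : Cn n)
      + (v j).im • (EuclideanSpace.single j Complex.I : Cn n)) := by
    ext l
    simp [Finset.sum_apply, Pi.single_apply, Finset.sum_add_distrib]
  have h1 : φ v = ∑ j, ((v j).re * φ (EuclideanSpace.single j (1 : ℂ))
      + (v j).im * φ (EuclideanSpace.single j Complex.I)) := by
    conv_lhs => rw [hv]
    simp
  rw [h1]
  simp only [sum_apply, Fintype.sum_sum_type, ← Finset.sum_add_distrib]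
  refine Finset.sum_congr rfl fun j _ => ?_
  simp only [add_apply, smul_apply, zcL_apply, zc_inl, zc_inr, wl_apply, widx, wsign,
    Sum.elim_inl, Sum.elim_inr, id, smul_eq_mul]
  generalize φ (EuclideanSpace.single j (1 : ℂ)) = a
  generalize φ (EuclideanSpace.single j Complex.I) = b
  generalize v j = w
  apply Complex.ext <;> simp <;> ring

lemma fderiv_eq_sum (f : Cn n → ℂ) (z : Cn n) : fderiv ℝ f z = ∑ i, wd i f z • zcL i := by
  rw [clm_eq_sum (fderiv ℝ f z)]
  simp [wd_eq]

lemma fderiv_apply_eq_sum (f : Cn n → ℂ) (z v : Cn n) :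
    fderiv ℝ f z v = ∑ i, wd i f z * zc i v := by
  rw [fderiv_eq_sum]; simp [zcL_apply]

lemma wd_zc (i k : Fin n ⊕ Fin n) (z : Cn n) : wd i (zc k) z = if i = k then 1 else 0 := by
  rw [wd_eq, zc_eq, ContinuousLinearMap.fderiv, wl_zcL]

lemma wd_const (i : Fin n ⊕ Fin n) (c : ℂ) (z : Cn n) : wd i (fun _ => c) z = 0 := by
  rw [wd_eq]; simp

lemma wd_add {i : Fin n ⊕ Fin n} {f g : Cn n → ℂ} {z : Cn n} (hf : DifferentiableAt ℝ f z)
    (hg : DifferentiableAt ℝ g z) :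
    wd i (fun w => f w + g w) z = wd i f z + wd i g z := by
  simp only [wd_eq]; rw [fderiv_fun_add hf hg, map_add]

lemma wd_sub {i : Fin n ⊕ Fin n} {f g : Cn n → ℂ} {z : Cn n} (hf : DifferentiableAt ℝ f z)
    (hg : DifferentiableAt ℝ g z) :
    wd i (fun w => f w - g w) z = wd i f z - wd i g z := by
  simp only [wd_eq]; rw [fderiv_fun_sub hf hg, map_sub]

lemma wd_sum {ι : Type*} {s : Finset ι} {i : Fin n ⊕ Fin n} {f : ι → Cn n → ℂ} {z : Cn n}
    (hf : ∀ k ∈ s, DifferentiableAt ℝ (f k) z) :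
    wd i (fun w => ∑ k ∈ s, f k w) z = ∑ k ∈ s, wd i (f k) z := by
  simp only [wd_eq]; rw [fderiv_fun_sum hf, map_sum]

lemma wd_mul {i : Fin n ⊕ Fin n} {f g : Cn n → ℂ} {z : Cn n} (hf : DifferentiableAt ℝ f z)
    (hg : DifferentiableAt ℝ g z) :
    wd i (fun w => f w * g w) z = wd i f z * g z + f z * wd i g z := by
  simp only [wd_eq]; rw [fderiv_fun_mul hf hg, map_add, wl_smul, wl_smul]; ring

lemma wd_const_mul {i : Fin n ⊕ Fin n} {f : Cn n → ℂ} {z : Cn n} (c : ℂ)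
    (hf : DifferentiableAt ℝ f z) : wd i (fun w => c * f w) z = c * wd i f z := by
  rw [wd_mul (by fun_prop) hf, wd_const]; ring

lemma wd_conj {j : Fin n ⊕ Fin n} {f : Cn n → ℂ} {z : Cn n} :
    wd j (fun w => conj (f w)) z = conj (wd j.swap f z) := by
  have h : fderiv ℝ (fun w => conj (f w)) z = (Complex.conjCLE : ℂ →L[ℝ] ℂ).comp
      (fderiv ℝ f z) := by
    have := (Complex.conjCLE).comp_fderiv (f := f) (x := z)
    exact this
  rw [wd_eq, wd_eq, h, wl_apply, wl_apply]
  rcases j with j | j <;> simp [widx, wsign, Complex.conj_ofNat]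

lemma contDiffAt_wd {k m : WithTop ℕ∞} {f : Cn n → ℂ} {z : Cn n} (hf : ContDiffAt ℝ m f z)
    (hkm : k + 1 ≤ m) (i : Fin n ⊕ Fin n) : ContDiffAt ℝ k (wd i f) z := by
  have : wd i f = fun w => wl i (fderiv ℝ f w) := funext fun w => wd_eq i f w
  rw [this]
  exact (wl i).contDiff.contDiffAt.comp z (hf.fderiv_right hkm)

lemma contDiff_wd {f : Cn n → ℂ} (hf : ContDiff ℝ ∞ f) (i : Fin n ⊕ Fin n) :
    ContDiff ℝ ∞ (wd i f) :=
  contDiff_iff_contDiffAt.2 fun _ => contDiffAt_wd hf.contDiffAt (by simp) i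

lemma wd_comm {f : Cn n → ℂ} {z : Cn n} (hf : ContDiffAt ℝ 2 f z) (i k : Fin n ⊕ Fin n) :
    wd i (wd k f) z = wd k (wd i f) z := by
  have hd : DifferentiableAt ℝ (fderiv ℝ f) z :=
    (hf.fderiv_right (m := 1) (by norm_num)).differentiableAt one_ne_zero
  have key : ∀ k : Fin n ⊕ Fin n, ∀ v, fderiv ℝ (wd k f) z v = wl k (fderiv ℝ (fderiv ℝ f) z v) := by
    intro k v
    have : wd k f = fun w => wl k (fderiv ℝ f w) := funext fun w => wd_eq k f w
    rw [this]
    change fderiv ℝ ((wl k) ∘ (fderiv ℝ f)) z v = _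
    rw [fderiv_comp z (wl k).differentiableAt hd, ContinuousLinearMap.fderiv]; rfl
  have hs : IsSymmSndFDerivAt ℝ f z := hf.isSymmSndFDerivAt (by simp)
  rw [wd_eq, wd_eq, wl_apply, wl_apply, key, key, key, key, wl_apply, wl_apply, wl_apply, wl_apply]
  rw [hs.eq (EuclideanSpace.single (widx i) 1) (EuclideanSpace.single (widx k) 1),
    hs.eq (EuclideanSpace.single (widx i) 1) (EuclideanSpace.single (widx k) Complex.I),
    hs.eq (EuclideanSpace.single (widx i) Complex.I) (EuclideanSpace.single (widx k) 1),
    hs.eq (EuclideanSpace.single (widx i) Complex.I) (EuclideanSpace.single (widx k) Complex.I)]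
  ring

/-! ### Derivatives along real linear vector fields -/

/-- The derivative of `f` along the linear vector field `A`. -/
def lin (A : Cn n →L[ℝ] Cn n) (f : Cn n → ℂ) (z : Cn n) : ℂ := fderiv ℝ f z (A z)

lemma lin_lin {A B : Cn n →L[ℝ] Cn n} {f : Cn n → ℂ} {z : Cn n} (hf : ContDiffAt ℝ 2 f z) :
    lin A (lin B f) z = fderiv ℝ (fderiv ℝ f) z (A z) (B z) + fderiv ℝ f z (B (A z)) := by
  have hd : DifferentiableAt ℝ (fderiv ℝ f) z :=
    (hf.fderiv_right (m := 1) (by norm_num)).differentiableAt one_ne_zero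
  unfold lin
  rw [fderiv_clm_apply hd (by fun_prop)]
  simp [add_comm]

/-- The second-order terms agree by symmetry of the second derivative, and the first-order terms
agree because a linear map commutes with the identity. -/
lemma lin_comm_id {A : Cn n →L[ℝ] Cn n} {f : Cn n → ℂ} {z : Cn n} (hf : ContDiffAt ℝ 2 f z) :
    lin (ContinuousLinearMap.id ℝ (Cn n)) (lin A f) z
      = lin A (lin (ContinuousLinearMap.id ℝ (Cn n)) f) z := by
  have hs : IsSymmSndFDerivAt ℝ f z := hf.isSymmSndFDerivAt (by simp)
  rw [lin_lin hf, lin_lin hf]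
  simp [hs.eq z (A z)]

lemma opN_eq_lin (f : Cn n → ℂ) (z : Cn n) :
    opN f z = lin (ContinuousLinearMap.id ℝ (Cn n)) f z := by
  rw [lin, fderiv_apply_eq_sum, Fintype.sum_sum_type]
  simp [opN, Finset.sum_add_distrib, mul_comm]

/-- The vector field `z̄_j ∂/∂z_k - z̄_k ∂/∂z_j`, as a conjugate-linear map. -/
def skewField (j k : Fin n) : Cn n →L[ℝ] Cn n := LinearMap.toContinuousLinearMap
  { toFun := fun z => EuclideanSpace.single k (conj (z j)) - EuclideanSpace.single j (conj (z k))
    map_add' := fun x y => by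
      ext l; simp; split_ifs <;> ring
    map_smul' := fun c x => by
      ext l; simp; split_ifs <;> ring }

/-- Multiplication by `i`. -/
def mulI : Cn n →L[ℝ] Cn n := (Complex.I • ContinuousLinearMap.id ℂ (Cn n)).restrictScalars ℝ

@[simp] lemma mulI_apply (z : Cn n) : mulI z = Complex.I • z := rfl

@[simp] lemma skewField_apply (j k : Fin n) (z : Cn n) : skewField j k z =
    EuclideanSpace.single k (conj (z j)) - EuclideanSpace.single j (conj (z k)) := rfl

/-- For a real field `V` the combination `(V - i · iV)/2` is its part of type `(1, 0)`, and the
opposite sign gives the part of type `(0, 1)`. Thus `L_{jk}` and `L̄_{jk}` are the two halves of one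
real field, which makes the flow argument on the sphere available for both. -/
lemma opL_eq_lin (j k : Fin n) (f : Cn n → ℂ) (z : Cn n) :
    opL j k f z = (lin (skewField j k) f z
      - Complex.I * lin (mulI.comp (skewField j k)) f z) / 2 := by
  simp only [lin, fderiv_apply_eq_sum, Fintype.sum_sum_type, opL, wd_inl, wd_inr, zc_inl, zc_inr,
    ContinuousLinearMap.comp_apply, skewField_apply, mulI_apply, PiLp.smul_apply, PiLp.sub_apply,
    smul_eq_mul, map_mul, Complex.conj_I]
  simp only [mul_add, Finset.mul_sum, ← mul_assoc]
  have e1 : ∀ x : Fin n, Complex.I * dz x f z * Complex.I = - dz x f z := fun x => by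
    rw [mul_comm Complex.I, mul_assoc, Complex.I_mul_I]; ring
  have e2 : ∀ x : Fin n, Complex.I * dzbar x f z * -Complex.I = dzbar x f z := fun x => by
    rw [mul_comm Complex.I, mul_assoc, mul_neg, Complex.I_mul_I]; ring
  simp only [e1, e2]
  simp [mul_sub, Finset.sum_sub_distrib]
  ring

lemma opLbar_eq_lin (j k : Fin n) (f : Cn n → ℂ) (z : Cn n) :
    opLbar j k f z = (lin (skewField j k) f z
      + Complex.I * lin (mulI.comp (skewField j k)) f z) / 2 := by
  simp only [lin, fderiv_apply_eq_sum, Fintype.sum_sum_type, opLbar, wd_inl, wd_inr, zc_inl, zc_inr,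
    ContinuousLinearMap.comp_apply, skewField_apply, mulI_apply, PiLp.smul_apply, PiLp.sub_apply,
    smul_eq_mul, map_mul, Complex.conj_I]
  simp only [mul_add, Finset.mul_sum, ← mul_assoc]
  have e1 : ∀ x : Fin n, Complex.I * dz x f z * Complex.I = - dz x f z := fun x => by
    rw [mul_comm Complex.I, mul_assoc, Complex.I_mul_I]; ring
  have e2 : ∀ x : Fin n, Complex.I * dzbar x f z * -Complex.I = dzbar x f z := fun x => by
    rw [mul_comm Complex.I, mul_assoc, mul_neg, Complex.I_mul_I]; ring
  simp only [e1, e2]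
  simp [mul_sub, Finset.sum_sub_distrib, apply_ite conj]
  ring

lemma opR_eq_lin (f : Cn n → ℂ) (z : Cn n) :
    opR f z = -Complex.I * lin mulI f z := by
  simp only [lin, fderiv_apply_eq_sum, Fintype.sum_sum_type, opR, wd_inl, wd_inr, zc_inl, zc_inr,
    mulI_apply, PiLp.smul_apply, smul_eq_mul, map_mul, Complex.conj_I]
  rw [mul_add, Finset.mul_sum, Finset.mul_sum, ← Finset.sum_add_distrib]
  refine Finset.sum_congr rfl fun j _ => ?_
  linear_combination (dz j f z * z j - dzbar j f z * conj (z j)) * Complex.I_mul_I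

lemma inner_single_real (k : Fin n) (a : ℂ) (z : Cn n) :
    inner ℝ (EuclideanSpace.single k a : Cn n) z = (conj a * z k).re := by
  rw [PiLp.inner_apply, Finset.sum_eq_single k]
  · simp [Complex.inner]; ring
  · intro b _ hb; simp [hb]
  · simp

/-- The real linear fields which make up the operators `X`. -/
lemma opX_eq_lin (α : XIndex n) : ∃ (A B : Cn n →L[ℝ] Cn n) (a b : ℂ),
    (∀ z, inner ℝ (A z) z = 0) ∧ (∀ z, inner ℝ (B z) z = 0) ∧
    ∀ f z, opX α f z = a * lin A f z + b * lin B f z := by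
  have hS : ∀ (j k : Fin n) z, inner ℝ (skewField j k z) z = 0 := by
    intro j k z
    rw [skewField_apply, inner_sub_left, inner_single_real, inner_single_real]
    simp; ring
  have hI : ∀ (j k : Fin n) z, inner ℝ (mulI.comp (skewField j k) z) z = 0 := by
    intro j k z
    have : mulI.comp (skewField j k) z = EuclideanSpace.single k (Complex.I * conj (z j))
        - EuclideanSpace.single j (Complex.I * conj (z k)) := by
      ext l; simp [mul_sub]
    rw [this, inner_sub_left, inner_single_real, inner_single_real]
    simp; ring
  have hi : ∀ z : Cn n, inner ℝ (mulI z) z = 0 := by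
    intro z
    rw [PiLp.inner_apply]
    refine Finset.sum_eq_zero fun i _ => ?_
    simp [Complex.inner]; ring
  rcases α with _ | (⟨j, k⟩ | ⟨j, k⟩)
  · exact ⟨mulI, mulI, -Complex.I, 0, hi, hi, fun f z => by simp [opX, opR_eq_lin]⟩
  · exact ⟨_, _, 1 / 2, -Complex.I / 2, hS j k, hI j k, fun f z => by
      simp only [opX, opL_eq_lin]; ring⟩
  · exact ⟨_, _, 1 / 2, Complex.I / 2, hS j k, hI j k, fun f z => by
      simp only [opX, opLbar_eq_lin]; ring⟩

lemma two_le_smooth : (2 : WithTop ℕ∞) ≤ (∞ : WithTop ℕ∞) :=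
  WithTop.coe_le_coe.2 (le_top : (2 : ℕ∞) ≤ ⊤)

/-! ### Bihomogeneous polynomials in `z, z̄` -/

/-- The function `z ↦ P(z, z̄)`. -/
def ev (P : MvPolynomial (Fin n ⊕ Fin n) ℂ) (z : Cn n) : ℂ :=
  MvPolynomial.eval (fun i => zc i z) P

/-- The bidegree of a variable. -/
def bw (i : Fin n ⊕ Fin n) : ℤ × ℤ := Sum.elim (fun _ => (1, 0)) (fun _ => (0, 1)) i

/-- `F` is a bihomogeneous polynomial of bidegree `e`; it vanishes if `e` is not `≥ 0`. -/
def IsPoly (e : ℤ × ℤ) (F : Cn n → ℂ) : Prop :=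
  ∃ P : MvPolynomial (Fin n ⊕ Fin n) ℂ, P.IsWeightedHomogeneous bw e ∧ F = ev P

lemma ev_add (P Q : MvPolynomial (Fin n ⊕ Fin n) ℂ) : ev (P + Q) = fun z => ev P z + ev Q z := by
  ext; simp [ev]

lemma ev_mul (P Q : MvPolynomial (Fin n ⊕ Fin n) ℂ) : ev (P * Q) = fun z => ev P z * ev Q z := by
  ext; simp [ev]

lemma ev_C (c : ℂ) : ev (MvPolynomial.C c : MvPolynomial (Fin n ⊕ Fin n) ℂ) = fun _ => c := by
  ext; simp [ev]

lemma ev_X (i : Fin n ⊕ Fin n) : ev (MvPolynomial.X i) = zc i := by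
  ext; simp [ev]

lemma contDiff_ev (P : MvPolynomial (Fin n ⊕ Fin n) ℂ) : ContDiff ℝ ∞ (ev P) := by
  induction P using MvPolynomial.induction_on with
  | C a => rw [ev_C]; exact contDiff_const
  | add p q hp hq => rw [ev_add]; exact hp.add hq
  | mul_X p i hp => rw [ev_mul, ev_X]; exact hp.mul (contDiff_zc i)

lemma differentiable_ev (P : MvPolynomial (Fin n ⊕ Fin n) ℂ) : Differentiable ℝ (ev P) :=
  (contDiff_ev P).differentiable (by simp)

lemma wd_ev (i : Fin n ⊕ Fin n) (P : MvPolynomial (Fin n ⊕ Fin n) ℂ) :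
    wd i (ev P) = ev (MvPolynomial.pderiv i P) := by
  ext z
  induction P using MvPolynomial.induction_on with
  | C a => rw [ev_C, wd_const]; simp [ev]
  | add p q hp hq =>
    rw [ev_add, wd_add (differentiable_ev p z) (differentiable_ev q z), hp, hq, map_add, ev_add]
  | mul_X p k hp =>
    rw [ev_mul, wd_mul (differentiable_ev p z) (differentiable_ev _ z), hp, ev_X, wd_zc,
      MvPolynomial.pderiv_mul, MvPolynomial.pderiv_X, ev_add, ev_mul, ev_mul, ev_X]
    simp [ev, Pi.single_apply, eq_comm]

namespace IsPoly

variable {e e' : ℤ × ℤ} {F G : Cn n → ℂ}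

lemma contDiff (hF : IsPoly e F) : ContDiff ℝ ∞ F := by
  obtain ⟨P, -, rfl⟩ := hF; exact contDiff_ev P

lemma differentiable (hF : IsPoly e F) : Differentiable ℝ F :=
  hF.contDiff.differentiable (by simp)

lemma add (hF : IsPoly e F) (hG : IsPoly e G) : IsPoly e fun z => F z + G z := by
  obtain ⟨P, hP, rfl⟩ := hF
  obtain ⟨Q, hQ, rfl⟩ := hG
  exact ⟨P + Q, hP.add hQ, (ev_add P Q).symm⟩

lemma mul (hF : IsPoly e F) (hG : IsPoly e' G) : IsPoly (e + e') fun z => F z * G z := by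
  obtain ⟨P, hP, rfl⟩ := hF
  obtain ⟨Q, hQ, rfl⟩ := hG
  exact ⟨P * Q, hP.mul hQ, (ev_mul P Q).symm⟩

lemma const (c : ℂ) : IsPoly 0 (fun _ : Cn n => c) :=
  ⟨_, MvPolynomial.isWeightedHomogeneous_C bw c, (ev_C c).symm⟩

lemma zc (i : Fin n ⊕ Fin n) : IsPoly (bw i) (zc i) :=
  ⟨_, MvPolynomial.isWeightedHomogeneous_X ℂ bw i, (ev_X i).symm⟩

lemma zero : IsPoly e (fun _ : Cn n => 0) :=
  ⟨0, MvPolynomial.isWeightedHomogeneous_zero ℂ bw e, by ext; simp [ev]⟩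

lemma congr (hF : IsPoly e F) (h : e = e') : IsPoly e' F := h ▸ hF

lemma const_mul (c : ℂ) (hF : IsPoly e F) : IsPoly e fun z => c * F z :=
  ((const c).mul hF).congr (zero_add e)

lemma sub (hF : IsPoly e F) (hG : IsPoly e G) : IsPoly e fun z => F z - G z := by
  simpa [sub_eq_add_neg] using hF.add (hG.const_mul (-1))

lemma sum {ι : Type*} {s : Finset ι} {F : ι → Cn n → ℂ} (h : ∀ i ∈ s, IsPoly e (F i)) :
    IsPoly e fun z => ∑ i ∈ s, F i z := by
  classical
  induction s using Finset.induction_on with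
  | empty => simpa using zero
  | insert a s ha ih =>
    simp only [Finset.sum_insert ha]
    exact (h a (by simp)).add (ih fun i hi => h i (by simp [hi]))

lemma wd (i : Fin n ⊕ Fin n) (hF : IsPoly e F) : IsPoly (e - bw i) (wd i F) := by
  obtain ⟨P, hP, rfl⟩ := hF
  exact ⟨_, hP.pderiv (by simp), wd_ev i P⟩

lemma degree_eq (w : ℤ × ℤ →+ ℤ) {P : MvPolynomial (Fin n ⊕ Fin n) ℂ}
    (hP : P.IsWeightedHomogeneous bw e) {d : Fin n ⊕ Fin n →₀ ℕ} (hd : P.coeff d ≠ 0) :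
    ∑ i, (d i : ℤ) * w (bw i) = w e := by
  rw [← hP hd, Finsupp.weight_apply, Finsupp.sum_fintype _ _ (by simp), map_sum]
  exact Finset.sum_congr rfl fun i _ => by rw [map_nsmul, nsmul_eq_mul]

/-- Integer bidegrees allow derivatives and shifts to be subtracted without case distinctions. The
price is that negative bidegrees have to be discarded, which happens here. -/
lemma eq_zero (hF : IsPoly e F) (he : e.1 < 0 ∨ e.2 < 0) : F = fun _ => 0 := by
  obtain ⟨P, hP, rfl⟩ := hF
  suffices P = 0 by ext; simp [this, ev]
  by_contra hne
  obtain ⟨d, hd⟩ := MvPolynomial.ne_zero_iff.1 hne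
  have h1 := degree_eq (AddMonoidHom.fst ℤ ℤ) hP hd
  have h2 := degree_eq (AddMonoidHom.snd ℤ ℤ) hP hd
  simp only [Fintype.sum_sum_type, AddMonoidHom.coe_fst, AddMonoidHom.coe_snd, bw,
    Sum.elim_inl, Sum.elim_inr, mul_one, mul_zero, Finset.sum_const_zero, add_zero,
    zero_add] at h1 h2
  have h3 : 0 ≤ e.1 := h1 ▸ Finset.sum_nonneg fun i _ => by positivity
  have h4 : 0 ≤ e.2 := h2 ▸ Finset.sum_nonneg fun i _ => by positivity
  omega

/-- Euler's identity for a grading by natural weights. -/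
lemma euler_aux (w : ℤ × ℤ →+ ℤ) (w' : Fin n ⊕ Fin n → ℕ) (hw : ∀ i, w (bw i) = w' i)
    (hF : IsPoly e F) (z : Cn n) :
    ∑ i, (w' i : ℂ) * (MHarm.zc i z * MHarm.wd i F z) = (w e : ℂ) * F z := by
  obtain ⟨P, hP, rfl⟩ := hF
  by_cases h0 : P = 0
  · have : ev (0 : MvPolynomial (Fin n ⊕ Fin n) ℂ) = fun _ => 0 := by ext; simp [ev]
    simp [h0, this, wd_const]
  obtain ⟨d, hd⟩ := MvPolynomial.ne_zero_iff.1 h0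
  have hd' := degree_eq w hP hd
  have hm : P.IsWeightedHomogeneous w' (∑ i, d i * w' i) := by
    intro d' hd1
    have := degree_eq w hP hd1
    rw [Finsupp.weight_apply, Finsupp.sum_fintype _ _ (by simp)]
    simp only [hw] at this hd'
    have := this.trans hd'.symm
    simp only [smul_eq_mul]
    exact_mod_cast this
  have h := congrArg (fun Q => ev Q z) hm.sum_weight_X_mul_pderiv
  have he : ((w e : ℤ) : ℂ) = ((∑ i, d i * w' i : ℕ) : ℂ) := by
    rw [← hd']; simp [hw]
  rw [he]
  simp only [ev, map_sum, map_mul, MvPolynomial.eval_X, nsmul_eq_mul] at h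
  simp only [wd_ev]
  simpa [ev] using h

lemma euler_z (hF : IsPoly e F) (z : Cn n) : ∑ j, z j * dz j F z = e.1 * F z := by
  have := euler_aux (AddMonoidHom.fst ℤ ℤ) (Sum.elim (fun _ => 1) (fun _ => 0))
    (by rintro (j | j) <;> simp [bw]) hF z
  simpa [Fintype.sum_sum_type] using this

lemma euler_zbar (hF : IsPoly e F) (z : Cn n) :
    ∑ j, conj (z j) * dzbar j F z = e.2 * F z := by
  have := euler_aux (AddMonoidHom.snd ℤ ℤ) (Sum.elim (fun _ => 0) (fun _ => 1))
    (by rintro (j | j) <;> simp [bw]) hF z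
  simpa [Fintype.sum_sum_type] using this

lemma smul_eq {p q : ℕ} (hF : IsPoly ((p : ℤ), (q : ℤ)) F) (c : ℂ) (z : Cn n) :
    F (c • z) = c ^ p * conj c ^ q * F z := by
  obtain ⟨P, hP, rfl⟩ := hF
  simp only [ev, MvPolynomial.eval_eq', Finset.mul_sum]
  refine Finset.sum_congr rfl fun d hd => ?_
  have hd := MvPolynomial.mem_support_iff.1 hd
  have h1 := degree_eq (AddMonoidHom.fst ℤ ℤ) hP hd
  have h2 := degree_eq (AddMonoidHom.snd ℤ ℤ) hP hd
  simp only [Fintype.sum_sum_type, AddMonoidHom.coe_fst, AddMonoidHom.coe_snd, bw,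
    Sum.elim_inl, Sum.elim_inr, mul_one, mul_zero, Finset.sum_const_zero, add_zero,
    zero_add] at h1 h2
  have h1' : ∑ j, d (Sum.inl j) = p := by exact_mod_cast h1
  have h2' : ∑ j, d (Sum.inr j) = q := by exact_mod_cast h2
  simp only [Fintype.prod_sum_type, zc_inl, zc_inr, PiLp.smul_apply, smul_eq_mul, map_mul,
    mul_pow, Finset.prod_mul_distrib, Finset.prod_pow_eq_pow_sum, h1', h2']
  ring

lemma real_smul_eq {p q : ℕ} (hF : IsPoly ((p : ℤ), (q : ℤ)) F) (r : ℝ) (z : Cn n) :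
    F (r • z) = (r : ℂ) ^ (p + q) * F z := by
  have := hF.smul_eq (r : ℂ) z
  rw [Complex.conj_ofReal] at this
  rw [pow_add, ← this]; rfl

end IsPoly

/-! ### The Euclidean Laplacian -/

/-- A quarter of the Euclidean Laplacian. -/
def lap (f : Cn n → ℂ) (z : Cn n) : ℂ := ∑ j, dz j (dzbar j f) z

/-- `|z|²` as a polynomial function. -/
def nsq (z : Cn n) : ℂ := ∑ j, z j * conj (z j)

lemma nsq_eq (z : Cn n) : nsq z = ((‖z‖ ^ 2 : ℝ) : ℂ) := by
  rw [EuclideanSpace.norm_sq_eq, nsq]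
  push_cast
  exact Finset.sum_congr rfl fun j _ => by rw [Complex.mul_conj, Complex.normSq_eq_norm_sq]; simp

lemma isPoly_nsq : IsPoly (1, 1) (nsq : Cn n → ℂ) :=
  IsPoly.sum fun j _ => (IsPoly.zc (Sum.inl j)).mul (IsPoly.zc (Sum.inr j))

lemma isPoly_lap {e : ℤ × ℤ} {F : Cn n → ℂ} (hF : IsPoly e F) : IsPoly (e - (1, 1)) (lap F) :=
  IsPoly.sum fun j _ => ((hF.wd (Sum.inr j)).wd (Sum.inl j)).congr (by
    ext <;> simp [bw])

lemma wd_zc_mul {i a : Fin n ⊕ Fin n} {u : Cn n → ℂ} {z : Cn n} (hu : DifferentiableAt ℝ u z) :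
    wd i (fun w => zc a w * u w) z = (if i = a then 1 else 0) * u z + zc a z * wd i u z := by
  rw [wd_mul (differentiable_zc a z) hu, wd_zc]

lemma lap_add {f g : Cn n → ℂ} (hf : ContDiff ℝ ∞ f) (hg : ContDiff ℝ ∞ g) (z : Cn n) :
    lap (fun w => f w + g w) z = lap f z + lap g z := by
  rw [lap, lap, lap, ← Finset.sum_add_distrib]
  refine Finset.sum_congr rfl fun j _ => ?_
  have : wd (Sum.inr j) (fun w => f w + g w) = fun w => wd (Sum.inr j) f w + wd (Sum.inr j) g w :=
    funext fun w => wd_add (hf.differentiable (by simp) w) (hg.differentiable (by simp) w)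
  simp only [← wd_inl, ← wd_inr, this]
  exact wd_add ((contDiff_wd hf _).differentiable (by simp) z)
    ((contDiff_wd hg _).differentiable (by simp) z)

lemma lap_const_mul {f : Cn n → ℂ} (hf : ContDiff ℝ ∞ f) (c : ℂ) (z : Cn n) :
    lap (fun w => c * f w) z = c * lap f z := by
  rw [lap, lap, Finset.mul_sum]
  refine Finset.sum_congr rfl fun j _ => ?_
  have : wd (Sum.inr j) (fun w => c * f w) = fun w => c * wd (Sum.inr j) f w :=
    funext fun w => wd_const_mul c (hf.differentiable (by simp) w)
  simp only [← wd_inl, ← wd_inr, this]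
  exact wd_const_mul c ((contDiff_wd hf _).differentiable (by simp) z)

lemma lap_zero (z : Cn n) : lap (fun _ : Cn n => (0 : ℂ)) z = 0 := by
  have := lap_const_mul (contDiff_const (c := (0 : ℂ))) 0 z
  simpa using this

lemma lap_sum {ι : Type*} (s : Finset ι) {f : ι → Cn n → ℂ} (hf : ∀ i, ContDiff ℝ ∞ (f i))
    (z : Cn n) : lap (fun w => ∑ i ∈ s, f i w) z = ∑ i ∈ s, lap (f i) z := by
  classical
  induction s using Finset.induction_on with
  | empty => simp [lap_zero]
  | insert a s ha ih =>
    simp only [Finset.sum_insert ha]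
    rw [lap_add (hf a) (ContDiff.sum fun i _ => hf i), ih]

lemma wd_smooth_comm {f : Cn n → ℂ} (hf : ContDiff ℝ ∞ f) (i k : Fin n ⊕ Fin n) :
    wd i (wd k f) = wd k (wd i f) :=
  funext fun _ => wd_comm (hf.contDiffAt.of_le two_le_smooth) i k

lemma lap_wd {f : Cn n → ℂ} (hf : ContDiff ℝ ∞ f) (i : Fin n ⊕ Fin n) (z : Cn n) :
    lap (wd i f) z = wd i (lap f) z := by
  have : lap f = fun w => ∑ j, wd (Sum.inl j) (wd (Sum.inr j) f) w := rfl
  rw [this, wd_sum fun k _ => (contDiff_wd (contDiff_wd hf _) _).differentiable (by simp) z]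
  refine Finset.sum_congr rfl fun j _ => ?_
  rw [← wd_inl, ← wd_inr, wd_smooth_comm hf, wd_smooth_comm (contDiff_wd hf _)]

/-- A coordinate is linear, so only the cross term survives: differentiating `z_j` leaves `∂̄_j` to
act on `f`, and vice versa. -/
lemma lap_zc_mul {f : Cn n → ℂ} (hf : ContDiff ℝ ∞ f) (i : Fin n ⊕ Fin n) (z : Cn n) :
    lap (fun w => zc i w * f w) z = wd i.swap f z + zc i z * lap f z := by
  have h1 : ∀ j, wd (Sum.inr j) (fun w => zc i w * f w) =
      fun w => (if Sum.inr j = i then 1 else 0) * f w + zc i w * wd (Sum.inr j) f w := fun j =>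
    funext fun w => wd_zc_mul (hf.differentiable (by simp) w)
  have hd : ∀ j, Differentiable ℝ (wd j f) := fun j =>
    (contDiff_wd hf j).differentiable (by simp)
  have h0 : Differentiable ℝ f := hf.differentiable (by simp)
  have h2 : ∀ j, wd (Sum.inl j) (wd (Sum.inr j) (fun w => zc i w * f w)) z =
      (if Sum.inr j = i then 1 else 0) * wd (Sum.inl j) f z
      + ((if Sum.inl j = i then 1 else 0) * wd (Sum.inr j) f z
        + zc i z * wd (Sum.inl j) (wd (Sum.inr j) f) z) := by
    intro j
    have hm : DifferentiableAt ℝ (fun w => zc i w * wd (Sum.inr j) f w) z :=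
      (differentiable_zc i z).mul (hd _ z)
    rw [h1, wd_add ((h0 z).const_mul _) hm, wd_const_mul _ (h0 z), wd_zc_mul (hd _ z)]
  simp only [lap, ← wd_inl, ← wd_inr, h2, Finset.sum_add_distrib, Finset.mul_sum]
  rcases i with i | i <;> simp

/-! ### Harmonic bihomogeneous polynomials -/

/-- Harmonic bihomogeneous polynomials of bidegree `e`. -/
def BH (e : ℤ × ℤ) (F : Cn n → ℂ) : Prop := IsPoly e F ∧ ∀ z, lap F z = 0

namespace BH

variable {e e' : ℤ × ℤ} {F G : Cn n → ℂ}

lemma contDiff (h : BH e F) : ContDiff ℝ ∞ F := h.1.contDiff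

lemma congr (hF : BH e F) (h : e = e') : BH e' F := h ▸ hF

lemma add (hF : BH e F) (hG : BH e G) : BH e fun z => F z + G z :=
  ⟨hF.1.add hG.1, fun z => by rw [lap_add hF.contDiff hG.contDiff, hF.2, hG.2, add_zero]⟩

lemma const_mul (c : ℂ) (hF : BH e F) : BH e fun z => c * F z :=
  ⟨hF.1.const_mul c, fun z => by rw [lap_const_mul hF.contDiff, hF.2, mul_zero]⟩

lemma sub (hF : BH e F) (hG : BH e G) : BH e fun z => F z - G z := by
  simpa [sub_eq_add_neg] using hF.add (hG.const_mul (-1))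

lemma zero : BH e (fun _ : Cn n => (0 : ℂ)) := ⟨IsPoly.zero, lap_zero⟩

lemma wd (i : Fin n ⊕ Fin n) (hF : BH e F) : BH (e - bw i) (wd i F) :=
  ⟨hF.1.wd i, fun z => by
    rw [lap_wd hF.contDiff, show lap F = fun _ => 0 from funext hF.2, wd_const]⟩

lemma one : BH 0 (fun _ : Cn n => (1 : ℂ)) := ⟨IsPoly.const 1, fun z => by
  have h : MHarm.wd (n := n) = MHarm.wd := rfl
  have : ∀ j, dzbar j (fun _ : Cn n => (1 : ℂ)) = fun _ => 0 := fun j =>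
    funext fun w => wd_const (Sum.inr j) 1 w
  simp only [lap, this]
  exact Finset.sum_eq_zero fun j _ => wd_const (Sum.inl j) 0 z⟩

/-- The commutator of the Laplacian with `z̄_j ∂_k - z̄_k ∂_j` is `∂_j ∂_k - ∂_k ∂_j = 0`. -/
lemma opL (j k : Fin n) (hF : BH e F) : BH (e + (-1, 1)) (opL j k F) := by
  have hk := hF.wd (Sum.inl k)
  have hj := hF.wd (Sum.inl j)
  have he : e - bw (Sum.inl k) + bw (Sum.inr j) = e + (-1, 1) := by ext <;> simp [bw]; ring
  have he' : e - bw (Sum.inl j) + bw (Sum.inr k) = e + (-1, 1) := by ext <;> simp [bw]; ring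
  refine ⟨(((IsPoly.zc (Sum.inr j)).mul hk.1).congr (by rw [← he, add_comm])).sub
    (((IsPoly.zc (Sum.inr k)).mul hj.1).congr (by rw [← he', add_comm])), fun z => ?_⟩
  have h1 := lap_zc_mul hk.contDiff (Sum.inr j) z
  have h2 := lap_zc_mul hj.contDiff (Sum.inr k) z
  rw [hk.2, mul_zero, add_zero] at h1
  rw [hj.2, mul_zero, add_zero] at h2
  have c1 : ContDiff ℝ ∞ fun w => zc (Sum.inr j) w * MHarm.wd (Sum.inl k) F w :=
    (contDiff_zc _).mul hk.contDiff
  have c2 : ContDiff ℝ ∞ fun w => zc (Sum.inr k) w * MHarm.wd (Sum.inl j) F w :=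
    (contDiff_zc _).mul hj.contDiff
  have h3 := lap_add c1 (contDiff_const.mul c2 : ContDiff ℝ ∞ fun w => (-1 : ℂ) * _) z
  rw [lap_const_mul c2, h1, h2, wd_smooth_comm hF.contDiff] at h3
  have : MHarm.opL j k F = fun w => zc (Sum.inr j) w * MHarm.wd (Sum.inl k) F w
    + (-1) * (zc (Sum.inr k) w * MHarm.wd (Sum.inl j) F w) := by
    ext w; simp [MHarm.opL]; ring
  rw [this, h3]
  simp

lemma opLbar (j k : Fin n) (hF : BH e F) : BH (e + (1, -1)) (opLbar j k F) := by
  have hk := hF.wd (Sum.inr k)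
  have hj := hF.wd (Sum.inr j)
  have he : e - bw (Sum.inr k) + bw (Sum.inl j) = e + (1, -1) := by ext <;> simp [bw]; ring
  have he' : e - bw (Sum.inr j) + bw (Sum.inl k) = e + (1, -1) := by ext <;> simp [bw]; ring
  refine ⟨(((IsPoly.zc (Sum.inl j)).mul hk.1).congr (by rw [← he, add_comm])).sub
    (((IsPoly.zc (Sum.inl k)).mul hj.1).congr (by rw [← he', add_comm])), fun z => ?_⟩
  have h1 := lap_zc_mul hk.contDiff (Sum.inl j) z
  have h2 := lap_zc_mul hj.contDiff (Sum.inl k) z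
  rw [hk.2, mul_zero, add_zero] at h1
  rw [hj.2, mul_zero, add_zero] at h2
  have c1 : ContDiff ℝ ∞ fun w => zc (Sum.inl j) w * MHarm.wd (Sum.inr k) F w :=
    (contDiff_zc _).mul hk.contDiff
  have c2 : ContDiff ℝ ∞ fun w => zc (Sum.inl k) w * MHarm.wd (Sum.inr j) F w :=
    (contDiff_zc _).mul hj.contDiff
  have h3 := lap_add c1 (contDiff_const.mul c2 : ContDiff ℝ ∞ fun w => (-1 : ℂ) * _) z
  rw [lap_const_mul c2, h1, h2, wd_smooth_comm hF.contDiff] at h3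
  have : MHarm.opLbar j k F = fun w => zc (Sum.inl j) w * MHarm.wd (Sum.inr k) F w
    + (-1) * (zc (Sum.inl k) w * MHarm.wd (Sum.inr j) F w) := by
    ext w; simp [MHarm.opLbar]; ring
  rw [this, h3]
  simp

lemma opR_eq (hF : IsPoly e F) (z : Cn n) : opR F z = ((e.1 - e.2 : ℤ) : ℂ) * F z := by
  rw [opR, Finset.sum_sub_distrib, hF.euler_z, hF.euler_zbar]; push_cast; ring

end BH

/-- The bidegree shift of the operators `X`. -/
def xshift : XIndex n → ℤ × ℤ
  | none => 0
  | some (Sum.inl _) => (-1, 1)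
  | some (Sum.inr _) => (1, -1)

lemma BH.opX {e : ℤ × ℤ} {F : Cn n → ℂ} (α : XIndex n) (hF : BH e F) :
    BH (e + xshift α) (opX α F) := by
  rcases α with _ | (⟨j, k⟩ | ⟨j, k⟩)
  · have : MHarm.opX (none : XIndex n) F = fun z => ((e.1 - e.2 : ℤ) : ℂ) * F z :=
      funext fun z => BH.opR_eq hF.1 z
    rw [this]
    exact (hF.const_mul _).congr (by simp [xshift])
  · exact hF.opL j k
  · exact hF.opLbar j k

/-! ### Polar form of the second order operators -/

/-- The radial part `∑ z_j z̄_k ∂_j ∂̄_k`. -/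
def rad2 (f : Cn n → ℂ) (z : Cn n) : ℂ := ∑ j, ∑ k, z j * conj (z k) * dz j (dzbar k f) z

lemma dzbar_conj_mul_aux {f : Cn n → ℂ} {z : Cn n} (hf : ContDiffAt ℝ 2 f z) (i j k : Fin n) :
    dzbar i (opL j k f) z =
      (if i = j then 1 else 0) * dz k f z + conj (z j) * dz k (dzbar i f) z
      - ((if i = k then 1 else 0) * dz j f z + conj (z k) * dz j (dzbar i f) z) := by
  have hd : ∀ a, DifferentiableAt ℝ (wd a f) z := fun a =>
    (contDiffAt_wd hf (k := 1) (by norm_num) a).differentiableAt one_ne_zero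
  have h1 := wd_zc_mul (i := Sum.inr i) (a := Sum.inr j) (hd (Sum.inl k))
  have h2 := wd_zc_mul (i := Sum.inr i) (a := Sum.inr k) (hd (Sum.inl j))
  rw [wd_comm hf] at h1 h2
  have h3 := wd_sub (i := Sum.inr i) ((differentiable_zc (Sum.inr j) z).mul (hd (Sum.inl k)))
    ((differentiable_zc (Sum.inr k) z).mul (hd (Sum.inl j)))
  refine h3.trans ?_
  refine (congrArg₂ (· - ·) h1 h2).trans ?_
  simp

lemma dz_mul_aux {f : Cn n → ℂ} {z : Cn n} (hf : ContDiffAt ℝ 2 f z) (i j k : Fin n) :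
    dz i (opLbar j k f) z =
      (if i = j then 1 else 0) * dzbar k f z + z j * dz i (dzbar k f) z
      - ((if i = k then 1 else 0) * dzbar j f z + z k * dz i (dzbar j f) z) := by
  have hd : ∀ a, DifferentiableAt ℝ (wd a f) z := fun a =>
    (contDiffAt_wd hf (k := 1) (by norm_num) a).differentiableAt one_ne_zero
  have h1 := wd_zc_mul (i := Sum.inl i) (a := Sum.inl j) (hd (Sum.inr k))
  have h2 := wd_zc_mul (i := Sum.inl i) (a := Sum.inl k) (hd (Sum.inr j))
  have h3 := wd_sub (i := Sum.inl i) ((differentiable_zc (Sum.inl j) z).mul (hd (Sum.inr k)))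
    ((differentiable_zc (Sum.inl k) z).mul (hd (Sum.inr j)))
  refine h3.trans ?_
  refine (congrArg₂ (· - ·) h1 h2).trans ?_
  simp

/-- Polar form of the Laplacian: the tangential second-order operator equals `|z|²` times the
Laplacian minus radial terms. The hypothesis `lap f = κ * rad2 f` then leaves only `N`, `R` and
their squares, and harmonicity yields eigenvalues. -/
lemma sum_opLbar_opL {f : Cn n → ℂ} {z : Cn n} (hf : ContDiffAt ℝ 2 f z) :
    ∑ j, ∑ k, opLbar j k (opL j k f) z =
      2 * (nsq z * lap f z - (n - 1) * ∑ j, z j * dz j f z - rad2 f z) := by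
  have h : ∀ j k, opLbar j k (opL j k f) z =
      (if k = j then z j * dz k f z else 0) + z j * conj (z j) * dz k (dzbar k f) z
      - z j * dz j f z - z j * conj (z k) * dz j (dzbar k f) z
      - z k * dz k f z - z k * conj (z j) * dz k (dzbar j f) z
      + (if k = j then z k * dz j f z else 0) + z k * conj (z k) * dz j (dzbar j f) z := by
    intro j k
    rw [opLbar, dzbar_conj_mul_aux hf, dzbar_conj_mul_aux hf]
    by_cases hjk : k = j
    · subst hjk; simp; ring
    · simp [hjk, Ne.symm hjk]; ring
  simp only [h, Finset.sum_add_distrib, Finset.sum_sub_distrib, nsq, rad2, lap]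
  rw [Finset.sum_comm (f := fun j k => z k * conj (z j) * dz k (dzbar j f) z)]
  simp only [Finset.sum_ite_eq', Finset.mem_univ, if_true, Finset.sum_const, Finset.card_univ,
    Fintype.card_fin, nsmul_eq_mul, ← Finset.mul_sum, ← Finset.sum_mul]
  ring

lemma sum_opL_opLbar {f : Cn n → ℂ} {z : Cn n} (hf : ContDiffAt ℝ 2 f z) :
    ∑ j, ∑ k, opL j k (opLbar j k f) z =
      2 * (nsq z * lap f z - (n - 1) * ∑ j, conj (z j) * dzbar j f z - rad2 f z) := by
  have h : ∀ j k, opL j k (opLbar j k f) z =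
      (if k = j then conj (z j) * dzbar k f z else 0) + z j * conj (z j) * dz k (dzbar k f) z
      - conj (z j) * dzbar j f z - z k * conj (z j) * dz k (dzbar j f) z
      - conj (z k) * dzbar k f z - z j * conj (z k) * dz j (dzbar k f) z
      + (if k = j then conj (z k) * dzbar j f z else 0) + z k * conj (z k) * dz j (dzbar j f) z := by
    intro j k
    rw [opL, dz_mul_aux hf, dz_mul_aux hf]
    by_cases hjk : k = j
    · subst hjk; simp; ring
    · simp [hjk, Ne.symm hjk]; ring
  simp only [h, Finset.sum_add_distrib, Finset.sum_sub_distrib, nsq, rad2, lap]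
  rw [Finset.sum_comm (f := fun j k => z k * conj (z j) * dz k (dzbar j f) z)]
  simp only [Finset.sum_ite_eq', Finset.mem_univ, if_true, Finset.sum_const, Finset.card_univ,
    Fintype.card_fin, nsmul_eq_mul, ← Finset.mul_sum, ← Finset.sum_mul]
  ring

lemma dz_euler_zbar {f : Cn n → ℂ} {z : Cn n} (hf : ContDiffAt ℝ 2 f z) (j : Fin n) :
    dz j (fun w => ∑ k, conj (w k) * dzbar k f w) z = ∑ k, conj (z k) * dz j (dzbar k f) z := by
  have hd : ∀ a, DifferentiableAt ℝ (wd a f) z := fun a =>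
    (contDiffAt_wd hf (k := 1) (by norm_num) a).differentiableAt one_ne_zero
  refine (wd_sum (i := Sum.inl j)
    fun k _ => (differentiable_zc (Sum.inr k) z).mul (hd (Sum.inr k))).trans ?_
  refine Finset.sum_congr rfl fun k _ => ?_
  refine (wd_zc_mul (hd (Sum.inr k))).trans ?_
  simp

lemma rad2_eq {f : Cn n → ℂ} {z : Cn n} (hf : ContDiffAt ℝ 2 f z) :
    rad2 f z = ∑ j, z j * dz j (fun w => ∑ k, conj (w k) * dzbar k f w) z := by
  simp only [rad2, dz_euler_zbar hf, Finset.mul_sum, mul_assoc]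

lemma IsPoly.rad2_eq {e : ℤ × ℤ} {F : Cn n → ℂ} (hF : IsPoly e F) (z : Cn n) :
    rad2 F z = e.1 * e.2 * F z := by
  rw [MHarm.rad2_eq (hF.contDiff.contDiffAt.of_le two_le_smooth)]
  have : (fun w => ∑ k, conj (w k) * dzbar k F w) = fun w => (e.2 : ℂ) * F w :=
    funext fun w => hF.euler_zbar w
  rw [this, (hF.const_mul _).euler_z z]; ring

/-- The eigenvalue of `-½ ∑ L̄_{jk} L_{jk}`. -/
lemma BH.sum_opLbar_opL {e : ℤ × ℤ} {F : Cn n → ℂ} (hF : BH e F) (z : Cn n) :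
    ∑ j, ∑ k, MHarm.opLbar j k (MHarm.opL j k F) z = -2 * (e.1 * (n - 1 + e.2)) * F z := by
  rw [MHarm.sum_opLbar_opL (hF.contDiff.contDiffAt.of_le two_le_smooth), hF.2,
    hF.1.euler_z, hF.1.rad2_eq]
  ring

lemma BH.sum_opL_opLbar {e : ℤ × ℤ} {F : Cn n → ℂ} (hF : BH e F) (z : Cn n) :
    ∑ j, ∑ k, MHarm.opL j k (MHarm.opLbar j k F) z = -2 * (e.2 * (n - 1 + e.1)) * F z := by
  rw [MHarm.sum_opL_opLbar (hF.contDiff.contDiffAt.of_le two_le_smooth), hF.2,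
    hF.1.euler_zbar, hF.1.rad2_eq]
  ring

/-! ### Decomposition of polynomials -/

lemma lap_nsq_mul {e : ℤ × ℤ} {G : Cn n → ℂ} (hG : IsPoly e G) (z : Cn n) :
    lap (fun w => nsq w * G w) z = (n + e.1 + e.2) * G z + nsq z * lap G z := by
  have h1 : (fun w => nsq w * G w) =
      fun w : Cn n => ∑ j, zc (Sum.inl j) w * (zc (Sum.inr j) w * G w) := by
    ext w; simp [nsq, Finset.sum_mul, mul_assoc]
  have hG' := hG.contDiff
  rw [h1, lap_sum _ fun j => (contDiff_zc _).mul ((contDiff_zc _).mul hG')]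
  have h2 : ∀ j, lap (fun w => zc (Sum.inl j) w * (zc (Sum.inr j) w * G w)) z =
      G z + conj (z j) * dzbar j G z + z j * dz j G z + z j * conj (z j) * lap G z := by
    intro j
    rw [lap_zc_mul ((contDiff_zc _).mul hG'), lap_zc_mul hG', Sum.swap_inl,
      wd_zc_mul (hG'.differentiable (by simp) z)]
    simp; ring
  simp only [h2, Finset.sum_add_distrib, hG.euler_z, hG.euler_zbar, nsq, ← Finset.sum_mul]
  simp; ring

lemma isPoly_nsq_pow_mul {e : ℤ × ℤ} {G : Cn n → ℂ} (hG : IsPoly e G) (m : ℕ) :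
    IsPoly (e.1 + m, e.2 + m) (fun w => nsq w ^ m * G w) := by
  induction m with
  | zero => simpa using hG
  | succ m ih =>
    have : (fun w : Cn n => nsq w ^ (m + 1) * G w) = fun w => nsq w * (nsq w ^ m * G w) := by
      ext w; ring
    rw [this]
    refine (isPoly_nsq.mul ih).congr ?_
    ext <;> simp <;> ring

lemma lap_nsq_pow_mul {e : ℤ × ℤ} {H : Cn n → ℂ} (hH : BH e H) (m : ℕ) (z : Cn n) :
    lap (fun w => nsq w ^ (m + 1) * H w) z =
      (m + 1) * (m + n + e.1 + e.2) * (nsq z ^ m * H z) := by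
  induction m with
  | zero =>
    have := lap_nsq_mul hH.1 z
    rw [hH.2] at this
    simpa using this
  | succ m ih =>
    have h1 : (fun w : Cn n => nsq w ^ (m + 1 + 1) * H w)
        = fun w => nsq w * (nsq w ^ (m + 1) * H w) := by ext w; ring
    rw [h1, lap_nsq_mul (isPoly_nsq_pow_mul hH.1 (m + 1)), ih]
    push_cast
    ring

/-- Every bihomogeneous polynomial is a combination of powers of `|z|²` with harmonic
coefficients. -/
lemma IsPoly.exists_decomp (hn : 1 ≤ n) (N : ℕ) : ∀ {e : ℤ × ℤ} {F : Cn n → ℂ}, IsPoly e F →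
    e.1 < N → ∃ H : ℕ → Cn n → ℂ, (∀ j : ℕ, BH (e.1 - j, e.2 - j) (H j)) ∧
      ∀ z, F z = ∑ j ∈ Finset.range N, nsq z ^ j * H j z := by
  induction N with
  | zero =>
    intro e F hF he
    refine ⟨fun _ _ => 0, fun j => BH.zero, fun z => ?_⟩
    rw [hF.eq_zero (Or.inl (by simpa using he))]; simp
  | succ N ih =>
    intro e F hF he
    obtain ⟨H, hH, hs⟩ := ih (isPoly_lap hF) (by simp at he ⊢; omega)
    -- These invert the factor of `lap_nsq_pow_mul` for `H j`, whose bidegree is `e - (1, 1) - (j,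
    -- j)`. Where that bidegree is negative `H j` vanishes and the value is immaterial.
    let c : ℕ → ℂ := fun j => (((j : ℂ) + 1) * (j + n + (e.1 - 1 - j) + (e.2 - 1 - j)))⁻¹
    have hlap : ∀ j z, lap (fun w => nsq w ^ (j + 1) * (c j * H j w)) z = nsq z ^ j * H j z := by
      intro j z
      rw [lap_nsq_pow_mul ((hH j).const_mul (c j)) j z]
      by_cases hneg : e.1 - 1 - j < 0 ∨ e.2 - 1 - (j : ℤ) < 0
      · rw [(hH j).1.eq_zero (by simpa using hneg)]; simp
      · push Not at hneg
        have hne : ((j : ℂ) + 1) * (j + n + (e.1 - 1 - j) + (e.2 - 1 - j)) ≠ 0 := by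
          refine mul_ne_zero (by exact_mod_cast Nat.succ_ne_zero j) ?_
          have : (0 : ℤ) < j + n + (e.1 - 1 - j) + (e.2 - 1 - j) := by omega
          exact_mod_cast this.ne'
        simp only [c, Prod.fst_sub, Prod.snd_sub]
        push_cast
        rw [show nsq z ^ j * (((↑j + 1) * (↑j + ↑n + (↑e.1 - 1 - ↑j) + (↑e.2 - 1 - ↑j)))⁻¹ * H j z)
          = ((↑j + 1) * (↑j + ↑n + (↑e.1 - 1 - ↑j) + (↑e.2 - 1 - ↑j)))⁻¹ * (nsq z ^ j * H j z) by
            ring, ← mul_assoc, mul_inv_cancel₀ hne, one_mul]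
    -- `Q` has the Laplacian of `F` and is divisible by `|z|²`, so `F - Q` is the harmonic component
    -- of index `0`.
    let Q : Cn n → ℂ := fun w => ∑ j ∈ Finset.range N, nsq w ^ (j + 1) * (c j * H j w)
    have hQ : IsPoly e Q := IsPoly.sum fun j _ =>
      (isPoly_nsq_pow_mul ((hH j).1.const_mul (c j)) (j + 1)).congr (by ext <;> simp <;> ring)
    have hlQ : ∀ z, lap Q z = lap F z := fun z => by
      rw [lap_sum _ fun j => (isPoly_nsq_pow_mul ((hH j).1.const_mul (c j)) (j + 1)).contDiff, hs]
      exact Finset.sum_congr rfl fun j _ => hlap j z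
    have h0 : BH e (fun z => F z - Q z) := ⟨hF.sub hQ, fun z => by
      have := lap_add hF.contDiff (hQ.const_mul (-1)).contDiff z
      rw [lap_const_mul hQ.contDiff, hlQ] at this
      simpa [sub_eq_add_neg] using this⟩
    refine ⟨fun j => Nat.casesOn j (fun z => F z - Q z) fun j z => c j * H j z, ?_, fun z => ?_⟩
    · rintro (_ | j)
      · exact h0.congr (by ext <;> simp)
      · exact ((hH j).const_mul (c j)).congr (by ext <;> simp <;> ring)
    · rw [Finset.sum_range_succ']
      simp [Q]

/-! ### Comparison with Mathlib's Laplacian -/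

lemma iteratedFDeriv_two_eq {f : Cn n → ℂ} {z : Cn n} (v : Cn n) :
    iteratedFDeriv ℝ 2 f z ![v, v] = fderiv ℝ (fderiv ℝ f) z v v := by
  rw [iteratedFDeriv_two_apply]; simp

lemma laplacian_eq_lap {f : Cn n → ℂ} {z : Cn n} (hf : ContDiffAt ℝ 2 f z) :
    Laplacian.laplacian f z = 4 * lap f z := by
  have hd : DifferentiableAt ℝ (fderiv ℝ f) z :=
    (hf.fderiv_right (m := 1) (by norm_num)).differentiableAt one_ne_zero
  have key : ∀ k : Fin n ⊕ Fin n, ∀ v,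
      fderiv ℝ (wd k f) z v = wl k (fderiv ℝ (fderiv ℝ f) z v) := by
    intro k v
    have : wd k f = fun w => wl k (fderiv ℝ f w) := funext fun w => wd_eq k f w
    rw [this]
    change fderiv ℝ ((wl k) ∘ (fderiv ℝ f)) z v = _
    rw [fderiv_comp z (wl k).differentiableAt hd, ContinuousLinearMap.fderiv]; rfl
  have hs : IsSymmSndFDerivAt ℝ f z := hf.isSymmSndFDerivAt (by simp)
  rw [congrFun (InnerProductSpace.laplacian_eq_iteratedFDeriv_orthonormalBasis f
    (Pi.orthonormalBasis fun _ : Fin n => Complex.orthonormalBasisOneI)) z,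
    Fintype.sum_sigma, lap, Finset.mul_sum]
  refine Finset.sum_congr rfl fun j _ => ?_
  rw [Fin.sum_univ_two, iteratedFDeriv_two_eq, iteratedFDeriv_two_eq,
    Pi.orthonormalBasis_apply, Pi.orthonormalBasis_apply]
  have e1 : dz j (dzbar j f) z = wd (Sum.inl j) (wd (Sum.inr j) f) z := rfl
  rw [e1, wd_eq, wl_apply, key, key, wl_apply, wl_apply]
  simp only [widx, wsign, Sum.elim_inl, Sum.elim_inr, id]
  rw [hs.eq (EuclideanSpace.single j Complex.I) (EuclideanSpace.single j 1)]
  simp only [Complex.coe_orthonormalBasisOneI, Matrix.cons_val_zero, Matrix.cons_val_one]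
  change fderiv ℝ (fderiv ℝ f) z (EuclideanSpace.single j 1) (EuclideanSpace.single j 1)
    + fderiv ℝ (fderiv ℝ f) z (EuclideanSpace.single j Complex.I)
      (EuclideanSpace.single j Complex.I) = _
  generalize fderiv ℝ (fderiv ℝ f) z (EuclideanSpace.single j 1) (EuclideanSpace.single j 1) = a
  generalize fderiv ℝ (fderiv ℝ f) z (EuclideanSpace.single j Complex.I)
      (EuclideanSpace.single j Complex.I) = b
  ring_nf
  rw [Complex.I_sq]
  ring

lemma ev_eq (P : MvPolynomial (Fin n ⊕ Fin n) ℂ) (z : Cn n) :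
    ev P z = MvPolynomial.eval (Sum.elim (fun j => z j) (fun j => conj (z j))) P := by
  rw [ev]; congr 2

lemma weight_bw (d : Fin n ⊕ Fin n →₀ ℕ) :
    Finsupp.weight bw d =
      (((∑ j, d (Sum.inl j) : ℕ) : ℤ), ((∑ j, d (Sum.inr j) : ℕ) : ℤ)) := by
  rw [Finsupp.weight_apply, Finsupp.sum_fintype _ _ (by simp), Fintype.sum_sum_type]
  ext <;> simp [bw, Prod.fst_sum, Prod.snd_sum]

lemma isBigradedHarmonic_iff (p q : ℕ) (F : Cn n → ℂ) :
    IsBigradedHarmonic p q F ↔ BH ((p : ℤ), (q : ℤ)) F := by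
  have h1 : (∃ P : MvPolynomial (Fin n ⊕ Fin n) ℂ,
      (∀ d ∈ P.support, ∑ j, d (Sum.inl j) = p ∧ ∑ j, d (Sum.inr j) = q) ∧
      ∀ z, F z = MvPolynomial.eval (Sum.elim (fun j => z j) (fun j => conj (z j))) P) ↔
      IsPoly ((p : ℤ), (q : ℤ)) F := by
    refine exists_congr fun P => and_congr ?_ ?_
    · simp only [MvPolynomial.IsWeightedHomogeneous, MvPolynomial.mem_support_iff]
      refine forall_congr' fun d => imp_congr_right fun _ => ?_
      rw [weight_bw, Prod.mk.injEq]
      norm_cast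
    · simp only [funext_iff, ev_eq]
  rw [IsBigradedHarmonic, h1, BH]
  refine and_congr_right fun hF => ?_
  have hc : ∀ z, ContDiffAt ℝ 2 F z := fun z => hF.contDiff.contDiffAt.of_le two_le_smooth
  constructor
  · intro h z
    have := (h z (Set.mem_univ z)).2.self_of_nhds
    rw [laplacian_eq_lap (hc z)] at this
    simpa using this
  · intro h z _
    refine ⟨hc z, Filter.Eventually.of_forall fun w => ?_⟩
    rw [laplacian_eq_lap (hc w), h]; simp

/-- Harmonic bihomogeneous polynomials as a subspace. -/
def bhSub (n : ℕ) (e : ℤ × ℤ) : Submodule ℂ (Cn n → ℂ) where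
  carrier := {F | BH e F}
  add_mem' h h' := h.add h'
  zero_mem' := BH.zero
  smul_mem' c _ h := h.const_mul c

@[simp] lemma mem_bhSub {e : ℤ × ℤ} {F : Cn n → ℂ} : F ∈ bhSub n e ↔ BH e F := Iff.rfl

/-- Finite dimension supplies the orthogonal projection used in `exists_sphProj`. -/
instance (e : ℤ × ℤ) : FiniteDimensional ℂ (bhSub n e) := by
  let ℓ : MvPolynomial (Fin n ⊕ Fin n) ℂ →ₗ[ℂ] (Cn n → ℂ) :=
    { toFun := ev
      map_add' := ev_add
      map_smul' := fun c P => by ext; simp [ev] }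
  have hle : bhSub n e ≤ (MvPolynomial.restrictTotalDegree (Fin n ⊕ Fin n) ℂ
      (e.1 + e.2).toNat).map ℓ := by
    rintro F ⟨⟨P, hP, rfl⟩, -⟩
    refine ⟨P, ?_, rfl⟩
    rw [SetLike.mem_coe, MvPolynomial.mem_restrictTotalDegree]
    refine Finset.sup_le fun d hd => ?_
    have := hP (MvPolynomial.mem_support_iff.1 hd)
    rw [weight_bw] at this
    have hs : (d.sum fun _ k => k) = ∑ i, d i := Finsupp.sum_fintype _ _ (by simp)
    rw [hs, Fintype.sum_sum_type]
    subst this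
    simp only
    omega
  exact Submodule.finiteDimensional_of_le hle

/-! ### The sphere -/

/-- The unit sphere of `ℂⁿ`. -/
abbrev Sph (n : ℕ) : Type := Metric.sphere (0 : Cn n) 1

lemma finrank_Cn : Module.finrank ℝ (Cn n) = 2 * n := by
  rw [← Module.finrank_mul_finrank ℝ ℂ]; simp

instance : IsFiniteMeasure (sigma n) := by
  unfold sigma
  by_cases h : (volume : Measure (Cn n)).toSphere Set.univ = 0
  · rw [Measure.measure_univ_eq_zero.1 h, smul_zero]; infer_instance
  · exact Measure.smul_finite _ (ENNReal.inv_ne_top.2 h)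

instance : (sigma n).IsOpenPosMeasure := by
  unfold sigma
  exact Measure.isOpenPosMeasure_smul _ (ENNReal.inv_ne_zero.2 (measure_ne_top _ _))

lemma sigma_univ (hn : 1 ≤ n) : sigma n Set.univ = 1 := by
  have : Nontrivial (Cn n) := Module.nontrivial_of_finrank_pos (R := ℝ) (by rw [finrank_Cn]; omega)
  rw [sigma, Measure.smul_apply, smul_eq_mul, ENNReal.inv_mul_cancel]
  · exact Measure.measure_univ_ne_zero.2 (Measure.toSphere_ne_zero _)
  · exact measure_ne_top _ _

lemma norm_sph (η : Sph n) : ‖(η : Cn n)‖ = 1 := by simpa using η.2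

lemma sph_integrable {F : Type*} [NormedAddCommGroup F] {g : Sph n → F} (hg : Continuous g) :
    Integrable g (sigma n) :=
  hg.integrable_of_hasCompactSupport (HasCompactSupport.of_compactSpace g)

/-- The action of a linear isometry on the sphere. -/
def sphMap (e : Cn n ≃ₗᵢ[ℝ] Cn n) (η : Sph n) : Sph n :=
  ⟨e η, by simp⟩

lemma continuous_sphMap (e : Cn n ≃ₗᵢ[ℝ] Cn n) : Continuous (sphMap e) :=
  (e.continuous.comp continuous_subtype_val).subtype_mk _

-- The spherical measure of a set is a multiple of the volume of the cone over it. A linear isometry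
-- maps cones to cones and preserves volume.
open scoped Pointwise in
lemma measurePreserving_sphMap (e : Cn n ≃ₗᵢ[ℝ] Cn n) :
    MeasurePreserving (sphMap e) (sigma n) (sigma n) := by
  have hm := (continuous_sphMap e).measurable
  refine ⟨hm, ?_⟩
  rw [sigma, Measure.map_smul]
  congr 1
  ext s hs
  rw [Measure.map_apply hm hs, Measure.toSphere_apply' _ hs, Measure.toSphere_apply' _ (hm hs)]
  congr 1
  have : Set.Ioo (0 : ℝ) 1 • ((↑) '' (sphMap e ⁻¹' s) : Set (Cn n)) =
      e ⁻¹' (Set.Ioo (0 : ℝ) 1 • ((↑) '' s)) := by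
    ext z
    simp only [Set.mem_smul, Set.mem_image, Set.mem_preimage]
    constructor
    · rintro ⟨r, hr, _, ⟨η, hη, rfl⟩, rfl⟩
      exact ⟨r, hr, _, ⟨_, hη, rfl⟩, by simp [sphMap]⟩
    · rintro ⟨r, hr, _, ⟨η, hη, rfl⟩, h⟩
      refine ⟨r, hr, e.symm η, ⟨⟨e.symm η, by simp⟩, ?_, rfl⟩, ?_⟩
      · convert hη; exact Subtype.ext (by simp [sphMap])
      · rw [← e.symm.map_smul, h]; simp
  rw [this]
  refine e.measurePreserving.measure_preimage_emb e.toHomeomorph.measurableEmbedding _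

lemma integral_sphMap (e : Cn n ≃ₗᵢ[ℝ] Cn n) (g : Sph n → ℂ) :
    ∫ η, g (sphMap e η) ∂(sigma n) = ∫ η, g η ∂(sigma n) := by
  have hemb : MeasurableEmbedding (sphMap e) := by
    refine (Homeomorph.mk ⟨sphMap e, sphMap e.symm, fun η => ?_, fun η => ?_⟩
      (continuous_sphMap e) (continuous_sphMap e.symm)).measurableEmbedding
    · exact Subtype.ext (by simp [sphMap])
    · exact Subtype.ext (by simp [sphMap])
  exact (measurePreserving_sphMap e).integral_comp hemb g

/-- `u` is `C^k` near the unit sphere. -/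
def SmoothNearSph (k : WithTop ℕ∞) (u : Cn n → ℂ) : Prop :=
  ∀ η : Sph n, ContDiffAt ℝ k u (η : Cn n)

lemma SmoothNearSph.continuous {k : WithTop ℕ∞} {u : Cn n → ℂ} (h : SmoothNearSph k u) :
    Continuous fun η : Sph n => u η :=
  continuous_iff_continuousAt.2 fun η =>
    (h η).continuousAt.comp continuous_subtype_val.continuousAt

lemma continuousAt_lin {A : Cn n →L[ℝ] Cn n} {u : Cn n → ℂ} {z : Cn n}
    (h : ContDiffAt ℝ 1 u z) : ContinuousAt (lin A u) z :=
  ((h.fderiv_right (m := 0) (by norm_num)).continuousAt).clm_apply A.continuous.continuousAt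

/-- Such an `A` is skew-adjoint, so its flow `exp (θ A)` consists of isometries. The integral of `u`
along the flow does not depend on `θ`, and its derivative is the integral of `A u`. -/
lemma integral_lin_eq_zero {A : Cn n →L[ℝ] Cn n} (hA : ∀ z, inner ℝ (A z) z = 0)
    {u : Cn n → ℂ} (hu : SmoothNearSph 1 u) : ∫ η : Sph n, lin A u η ∂(sigma n) = 0 := by
  have hadj : ∀ x y, inner ℝ (A x) y = - inner ℝ x (A y) := by
    intro x y
    have := hA (x + y)
    simp only [map_add, inner_add_left, inner_add_right, hA, zero_add, add_zero] at this
    rw [real_inner_comm (A y) x] 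
    linarith
  have hstar : star A = -A := by
    rw [ContinuousLinearMap.star_eq_adjoint]
    refine ContinuousLinearMap.ext fun x => ext_inner_right ℝ fun y => ?_
    rw [ContinuousLinearMap.adjoint_inner_left, neg_apply, inner_neg_left,
      hadj, neg_neg]
  let : NormedAlgebra ℚ (Cn n →L[ℝ] Cn n) := NormedAlgebra.restrictScalars ℚ ℝ _
  have hmem : ∀ θ : ℝ, NormedSpace.exp (θ • A) ∈ unitary (Cn n →L[ℝ] Cn n) := fun θ =>
    NormedSpace.exp_mem_unitary_of_mem_skewAdjoint (by
      rw [skewAdjoint.mem_iff, star_smul, hstar]; simp)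
  let e : ℝ → (Cn n ≃ₗᵢ[ℝ] Cn n) := fun θ => Unitary.linearIsometryEquiv ⟨_, hmem θ⟩
  have he : ∀ θ z, e θ z = NormedSpace.exp (θ • A) z := fun θ z => rfl
  have hder : ∀ (θ : ℝ) (η : Sph n),
      HasDerivAt (fun t => u (sphMap (e t) η)) (lin A u (sphMap (e θ) η)) θ := by
    intro θ η
    have h1 : HasDerivAt (fun t : ℝ => NormedSpace.exp (t • A) (η : Cn n))
        (A (NormedSpace.exp (θ • A) (η : Cn n))) θ :=
      (hasDerivAt_exp_smul_const' A θ).clm_apply (hasDerivAt_const θ (η : Cn n)) |>.congr_deriv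
        (by simp)
    have h2 := (((hu (sphMap (e θ) η)).differentiableAt one_ne_zero).hasFDerivAt)
    exact h2.comp_hasDerivAt θ h1
  have hcont : Continuous fun η : Sph n => lin A u η :=
    continuous_iff_continuousAt.2 fun η =>
      (continuousAt_lin (hu η)).comp continuous_subtype_val.continuousAt
  obtain ⟨C, hC⟩ := (isCompact_univ (X := Sph n)).exists_bound_of_continuousOn hcont.continuousOn
  have hmain := hasDerivAt_integral_of_dominated_loc_of_deriv_le (μ := sigma n)
    (F := fun t (η : Sph n) => u (sphMap (e t) η)) (x₀ := (0 : ℝ)) (bound := fun _ => C)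
    (F' := fun t η => lin A u (sphMap (e t) η)) Filter.univ_mem
    (Filter.Eventually.of_forall fun t =>
      (hu.continuous.comp (continuous_sphMap (e t))).aestronglyMeasurable)
    (sph_integrable (hu.continuous.comp (continuous_sphMap (e 0))))
    ((hcont.comp (continuous_sphMap (e 0))).aestronglyMeasurable)
    (Filter.Eventually.of_forall fun η t _ => hC _ (Set.mem_univ _))
    (integrable_const C)
    (Filter.Eventually.of_forall fun η t _ => hder t η)
  have h3 : (fun t => ∫ η, u (sphMap (e t) η) ∂(sigma n)) = fun _ => ∫ η : Sph n, u η ∂(sigma n) :=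
    funext fun t => integral_sphMap (e t) fun η => u η
  have h4 := hmain.2
  rw [h3] at h4
  have h5 := h4.unique (hasDerivAt_const _ _)
  rw [← h5]
  -- The flow at time `0` need not be evaluated: it is an isometry, which rotation invariance
  -- removes.
  exact (integral_sphMap (e 0) fun η => lin A u η).symm

/-! ### Adjoints of the tangential operators -/

lemma lin_mul {A : Cn n →L[ℝ] Cn n} {u v : Cn n → ℂ} {z : Cn n} (hu : DifferentiableAt ℝ u z)
    (hv : DifferentiableAt ℝ v z) :
    lin A (fun w => u w * v w) z = lin A u z * v z + u z * lin A v z := by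
  simp only [lin]; rw [fderiv_fun_mul hu hv]; simp; ring

lemma opX_mul (α : XIndex n) {u v : Cn n → ℂ} {z : Cn n} (hu : DifferentiableAt ℝ u z)
    (hv : DifferentiableAt ℝ v z) :
    opX α (fun w => u w * v w) z = opX α u z * v z + u z * opX α v z := by
  obtain ⟨A, B, a, b, -, -, h⟩ := opX_eq_lin α
  rw [h, h, h, lin_mul hu hv, lin_mul hu hv]; ring

lemma SmoothNearSph.opX {k m : WithTop ℕ∞} {u : Cn n → ℂ} (hu : SmoothNearSph m u)
    (hkm : k + 1 ≤ m) (α : XIndex n) : SmoothNearSph k (opX α u) := by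
  intro η
  obtain ⟨A, B, a, b, -, -, h⟩ := opX_eq_lin α
  have : MHarm.opX α u = fun z => a * lin A u z + b * lin B u z := funext fun z => h u z
  rw [this]
  have hd := (hu η).fderiv_right hkm
  exact (contDiffAt_const.mul (hd.clm_apply A.contDiff.contDiffAt)).add
    (contDiffAt_const.mul (hd.clm_apply B.contDiff.contDiffAt))

lemma SmoothNearSph.continuous_opX {u : Cn n → ℂ} (hu : SmoothNearSph 1 u) (α : XIndex n) :
    Continuous fun η : Sph n => MHarm.opX α u η :=
  (hu.opX (k := 0) (by norm_num) α).continuous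

lemma SmoothNearSph.conj {k : WithTop ℕ∞} {u : Cn n → ℂ} (hu : SmoothNearSph k u) :
    SmoothNearSph k fun z => conj (u z) := fun η =>
  (Complex.conjCLE.contDiff.contDiffAt).comp (η : Cn n) (hu η)

lemma SmoothNearSph.mul {k : WithTop ℕ∞} {u v : Cn n → ℂ} (hu : SmoothNearSph k u)
    (hv : SmoothNearSph k v) : SmoothNearSph k fun z => u z * v z := fun η => (hu η).mul (hv η)

lemma integral_opX_eq_zero (α : XIndex n) {u : Cn n → ℂ} (hu : SmoothNearSph 1 u) :
    ∫ η : Sph n, opX α u η ∂(sigma n) = 0 := by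
  obtain ⟨A, B, a, b, hA, hB, h⟩ := opX_eq_lin α
  have hc : ∀ A, Continuous fun η : Sph n => lin A u η := fun A =>
    continuous_iff_continuousAt.2 fun η =>
      (continuousAt_lin (hu η)).comp continuous_subtype_val.continuousAt
  simp only [h]
  rw [integral_add ((sph_integrable (hc A)).const_mul a) ((sph_integrable (hc B)).const_mul b),
    integral_const_mul, integral_const_mul, integral_lin_eq_zero hA hu, integral_lin_eq_zero hB hu]
  simp

/-- The index of the formal adjoint of an operator `X`, up to sign. -/
def xadj : XIndex n → XIndex n
  | none => none
  | some a => some a.swap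

/-- The sign of the formal adjoint. -/
def xsgn : XIndex n → ℂ
  | none => 1
  | some _ => -1

lemma opX_conj (α : XIndex n) (v : Cn n → ℂ) (z : Cn n) :
    opX α (fun w => conj (v w)) z = -xsgn α * conj (opX (xadj α) v z) := by
  have h1 : ∀ j, dz j (fun w => conj (v w)) z = conj (dzbar j v z) := fun j =>
    wd_conj (j := Sum.inl j)
  have h2 : ∀ j, dzbar j (fun w => conj (v w)) z = conj (dz j v z) := fun j =>
    wd_conj (j := Sum.inr j)
  rcases α with _ | (⟨j, k⟩ | ⟨j, k⟩)
  · simp [opX, opR, xadj, xsgn, h1, h2, ← Finset.sum_neg_distrib]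
  · simp [opX, opL, opLbar, xadj, xsgn, h1, h2]
  · simp [opX, opL, opLbar, xadj, xsgn, h1, h2]

/-- Integration by parts on a manifold without boundary: `X (u v̄)` has mean zero and `X` is a
derivation. Conjugation exchanges `L` with `L̄` and changes the sign of `R`, which gives the
adjoints. -/
lemma integral_opX_mul_conj (α : XIndex n) {u v : Cn n → ℂ} (hu : SmoothNearSph 1 u)
    (hv : SmoothNearSph 1 v) :
    ∫ η : Sph n, opX α u η * conj (v η) ∂(sigma n)
      = xsgn α * ∫ η : Sph n, u η * conj (opX (xadj α) v η) ∂(sigma n) := by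
  have h0 := integral_opX_eq_zero α (hu.mul hv.conj)
  have h1 : ∀ η : Sph n, opX α (fun z => u z * conj (v z)) η = opX α u η * conj (v η)
      - xsgn α * (u η * conj (opX (xadj α) v η)) := fun η => by
    rw [opX_mul α ((hu η).differentiableAt one_ne_zero) ((hv.conj η).differentiableAt one_ne_zero),
      opX_conj]
    ring
  simp only [h1] at h0
  have hi1 : Integrable (fun η : Sph n => opX α u η * conj (v η)) (sigma n) :=
    sph_integrable ((hu.continuous_opX α).mul hv.conj.continuous)
  have hi2 : Integrable (fun η : Sph n => u η * conj (opX (xadj α) v η)) (sigma n) :=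
    sph_integrable (hu.continuous.mul (Complex.continuous_conj.comp (hv.continuous_opX _)))
  rw [integral_sub hi1 (hi2.const_mul _), integral_const_mul] at h0
  exact sub_eq_zero.1 h0

lemma SmoothNearSph.opL {k m : WithTop ℕ∞} {u : Cn n → ℂ} (hu : SmoothNearSph m u)
    (hkm : k + 1 ≤ m) (i j : Fin n) : SmoothNearSph k (opL i j u) :=
  hu.opX hkm (some (Sum.inl (i, j)))

lemma SmoothNearSph.opLbar {k m : WithTop ℕ∞} {u : Cn n → ℂ} (hu : SmoothNearSph m u)
    (hkm : k + 1 ≤ m) (i j : Fin n) : SmoothNearSph k (opLbar i j u) :=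
  hu.opX hkm (some (Sum.inr (i, j)))

lemma SmoothNearSph.of_contDiff {k : WithTop ℕ∞} {u : Cn n → ℂ} (hu : ContDiff ℝ k u) :
    SmoothNearSph k u := fun _ => hu.contDiffAt

lemma BH.smoothNearSph {e : ℤ × ℤ} {F : Cn n → ℂ} (hF : BH e F) {k : WithTop ℕ∞}
    (hk : k ≤ (∞ : WithTop ℕ∞)) : SmoothNearSph k F := .of_contDiff (hF.contDiff.of_le hk)

/-- Transfer of `∑ L̄_{jk} L_{jk}` onto a harmonic polynomial. -/
lemma integral_sum_opLbar_opL {e : ℤ × ℤ} {u F : Cn n → ℂ} (hu : SmoothNearSph 2 u)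
    (hF : BH e F) :
    ∫ η : Sph n, (∑ j, ∑ k, opLbar j k (opL j k u) η) * conj (F η) ∂(sigma n)
      = -2 * (e.1 * (n - 1 + e.2)) * ∫ η : Sph n, u η * conj (F η) ∂(sigma n) := by
  have hF2 : SmoothNearSph 2 F := hF.smoothNearSph two_le_smooth
  have h12 : (1 : WithTop ℕ∞) + 1 ≤ 2 := by norm_num
  have h01 : (0 : WithTop ℕ∞) + 1 ≤ 1 := by norm_num
  have hle : ∀ {v : Cn n → ℂ}, SmoothNearSph 2 v → SmoothNearSph 1 v := fun h η =>
    (h η).of_le (by norm_num)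
  have key : ∀ j k, ∫ η : Sph n, opLbar j k (opL j k u) η * conj (F η) ∂(sigma n)
      = ∫ η : Sph n, u η * conj (opLbar j k (opL j k F) η) ∂(sigma n) := by
    intro j k
    have a1 := integral_opX_mul_conj (some (Sum.inr (j, k))) (hu.opL h12 j k) (hle hF2)
    have a2 := integral_opX_mul_conj (some (Sum.inl (j, k))) (hle hu) (hF2.opL h12 j k)
    simp only [opX, xadj, xsgn, Sum.swap_inl, Sum.swap_inr] at a1 a2
    rw [a1, a2]; ring
  have hi1 : ∀ j k, Integrable (fun η : Sph n => opLbar j k (opL j k u) η * conj (F η))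
      (sigma n) := fun j k => sph_integrable
    (((hu.opL h12 j k).opLbar h01 j k).continuous.mul hF2.conj.continuous)
  have hi2 : ∀ j k, Integrable (fun η : Sph n => u η * conj (opLbar j k (opL j k F) η))
      (sigma n) := fun j k => sph_integrable
    (hu.continuous.mul ((hF2.opL h12 j k).opLbar h01 j k).conj.continuous)
  simp only [Finset.sum_mul]
  rw [integral_finsetSum _ fun j _ => integrable_finsetSum _ fun k _ => hi1 j k]
  simp only [integral_finsetSum _ fun k _ => hi1 _ k, key]
  simp only [← integral_finsetSum _ fun k _ => hi2 _ k]
  rw [← integral_finsetSum _ fun j _ => integrable_finsetSum _ fun k _ => hi2 j k,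
    ← integral_const_mul]
  refine integral_congr_ae (Filter.Eventually.of_forall fun η => ?_)
  simp only [← Finset.mul_sum, ← map_sum, hF.sum_opLbar_opL]
  simp [Complex.conj_ofNat]
  ring

lemma integral_opR_mul_conj {e : ℤ × ℤ} {u F : Cn n → ℂ} (hu : SmoothNearSph 1 u)
    (hF : BH e F) :
    ∫ η : Sph n, opR u η * conj (F η) ∂(sigma n)
      = (e.1 - e.2) * ∫ η : Sph n, u η * conj (F η) ∂(sigma n) := by
  have h1 := integral_opX_mul_conj none hu (hF.smoothNearSph (by simp))
  simp only [opX, xadj, xsgn, BH.opR_eq hF.1, one_mul] at h1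
  rw [h1, ← integral_const_mul]
  refine integral_congr_ae (Filter.Eventually.of_forall fun η => ?_)
  simp; ring

/-- Harmonic polynomials of different bidegrees are orthogonal on the sphere. -/
lemma BH.orthogonal (hn : 2 ≤ n) {e e' : ℤ × ℤ} {F G : Cn n → ℂ} (hF : BH e F) (hG : BH e' G)
    (hne : e ≠ e') : ∫ η : Sph n, F η * conj (G η) ∂(sigma n) = 0 := by
  by_cases h1 : e.1 < 0 ∨ e.2 < 0
  · simp [hF.1.eq_zero h1]
  by_cases h2 : e'.1 < 0 ∨ e'.2 < 0
  · simp [hG.1.eq_zero h2]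
  push Not at h1 h2
  have a := integral_opR_mul_conj (hF.smoothNearSph (by simp)) hG
  have b := integral_sum_opLbar_opL (hF.smoothNearSph two_le_smooth) hG
  simp only [BH.opR_eq hF.1, hF.sum_opLbar_opL, mul_assoc, integral_const_mul] at a b
  by_contra hI
  have a' := mul_right_cancel₀ hI a
  have b' : e.1 * ((n : ℂ) - 1 + e.2) = e'.1 * ((n : ℂ) - 1 + e'.2) := by
    have := mul_left_cancel₀ (by norm_num : (-2 : ℂ) ≠ 0) b
    exact mul_right_cancel₀ hI (by linear_combination this)
  have a2 : e.1 - e.2 = e'.1 - e'.2 := by exact_mod_cast a'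
  have b2 : e.1 * ((n : ℤ) - 1 + e.2) = e'.1 * ((n : ℤ) - 1 + e'.2) := by exact_mod_cast b'
  have hn' : (2 : ℤ) ≤ n := by exact_mod_cast hn
  -- The eigenvalues `p - q` of `R` and `p (n - 1 + q)` of `-½ ∑ L̄ L` determine `(p, q)`: once the
  -- first ones agree, the difference of the second ones factors, and `n ≥ 2` makes the second
  -- factor positive.
  have : (e.1 - e'.1) * ((n : ℤ) - 1 + e.2 + e'.1) = 0 := by
    linear_combination b2 + e'.1 * a2
  rcases mul_eq_zero.1 this with h | h
  · exact hne (Prod.ext (by omega) (by omega))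
  · omega

/-! ### The `L²` norm on the sphere -/

/-- The squared norm on the sphere, as a real number. -/
def nrm2 (F : Cn n → ℂ) : ℝ := ∫ η : Sph n, ‖F η‖ ^ 2 ∂(sigma n)

lemma nrm2_nonneg (F : Cn n → ℂ) : 0 ≤ nrm2 F := integral_nonneg fun _ => by positivity

lemma ofReal_nrm2 (F : Cn n → ℂ) :
    (nrm2 F : ℂ) = ∫ η : Sph n, F η * conj (F η) ∂(sigma n) := by
  rw [nrm2, ← integral_complex_ofReal]
  refine integral_congr_ae (Filter.Eventually.of_forall fun η => ?_)
  simp [Complex.mul_conj, Complex.normSq_eq_norm_sq]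

lemma enorm_sq_eq (c : ℂ) : ‖c‖ₑ ^ 2 = ENNReal.ofReal (‖c‖ ^ 2) := by
  rw [ENNReal.ofReal_pow (norm_nonneg _), ofReal_norm]

lemma sphereSqNorm_eq {F : Cn n → ℂ} (hF : Continuous fun η : Sph n => F η) :
    sphereSqNorm F = ENNReal.ofReal (nrm2 F) := by
  have hc : Continuous fun η : Sph n => ‖F η‖ ^ 2 := hF.norm.pow 2
  rw [sphereSqNorm, nrm2, ofReal_integral_eq_lintegral_ofReal (sph_integrable hc)
    (Filter.Eventually.of_forall fun _ => by positivity)]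
  simp only [enorm_sq_eq]

/-- The left side is the pairing of `F` with `∑ X* X F`. Here `R²` contributes `(p - q)²` and the
two families `L`, `L̄` contribute `2p(n - 1 + q)` and `2q(n - 1 + p)`. That the sum depends on `p +
q` only is what makes the iteration possible. -/
lemma BH.sum_nrm2_opX {e : ℤ × ℤ} {F : Cn n → ℂ} (hF : BH e F) :
    ∑ α, nrm2 (MHarm.opX α F) =
      (((e.1 + e.2 : ℤ) : ℝ) ^ 2 + 2 * (n - 1) * ((e.1 + e.2 : ℤ) : ℝ)) * nrm2 F := by
  have hs : SmoothNearSph 1 F := hF.smoothNearSph (by simp)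
  have key : ∀ α, (nrm2 (MHarm.opX α F) : ℂ) = xsgn α *
      ∫ η : Sph n, F η * conj (MHarm.opX (xadj α) (MHarm.opX α F) η) ∂(sigma n) := fun α => by
    rw [ofReal_nrm2]
    exact integral_opX_mul_conj α hs ((hF.opX α).smoothNearSph (by simp))
  have hcont : ∀ α β, Continuous fun η : Sph n => F η * conj (MHarm.opX α (MHarm.opX β F) η) :=
    fun α β => hs.continuous.mul
      (((hF.opX β).opX α).smoothNearSph (k := 0) (by simp)).conj.continuous
  have hsum : (∑ α, nrm2 (MHarm.opX α F) : ℂ) = ∫ η : Sph n, F η * conj (∑ α,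
      conj (xsgn α) * MHarm.opX (xadj α) (MHarm.opX α F) η) ∂(sigma n) := by
    simp only [key, ← integral_const_mul]
    rw [← integral_finsetSum _ fun α _ => (sph_integrable (hcont _ _)).const_mul _]
    refine integral_congr_ae (Filter.Eventually.of_forall fun η => ?_)
    simp only [map_sum, Finset.mul_sum, map_mul, Complex.conj_conj]
    exact Finset.sum_congr rfl fun _ _ => by ring
  have hval : ∀ η, (∑ α, conj (xsgn α) * MHarm.opX (xadj α) (MHarm.opX α F) η) =
      (((e.1 + e.2 : ℤ) : ℂ) ^ 2 + 2 * (n - 1) * ((e.1 + e.2 : ℤ) : ℂ)) * F η := by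
    intro η
    have h0 : MHarm.opR (MHarm.opR F) η = ((e.1 - e.2 : ℤ) : ℂ) * (((e.1 - e.2 : ℤ) : ℂ) * F η) := by
      have : MHarm.opR F = fun z => ((e.1 - e.2 : ℤ) : ℂ) * F z := funext fun z => BH.opR_eq hF.1 z
      rw [this, BH.opR_eq (hF.1.const_mul _)]
    have h1 := hF.sum_opLbar_opL η
    have h2 := hF.sum_opL_opLbar η
    rw [Fintype.sum_option, Fintype.sum_sum_type, Fintype.sum_prod_type, Fintype.sum_prod_type]
    simp only [xsgn, xadj, MHarm.opX, Sum.swap_inl, Sum.swap_inr, map_one, map_neg, one_mul,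
      neg_mul, Finset.sum_neg_distrib, h0, h1, h2]
    push_cast
    ring
  have hfin : (∑ α, nrm2 (MHarm.opX α F) : ℂ) = ((((e.1 + e.2 : ℤ) : ℝ) ^ 2
      + 2 * (n - 1) * ((e.1 + e.2 : ℤ) : ℝ)) * nrm2 F : ℝ) := by
    rw [hsum]
    simp only [hval]
    push_cast
    rw [ofReal_nrm2, ← integral_const_mul]
    refine integral_congr_ae (Filter.Eventually.of_forall fun η => ?_)
    simp [Complex.conj_ofNat]
    ring
  exact_mod_cast hfin

/-! ### Words in the operators `X` and conservation of the total degree -/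

lemma iterX_zero (J : Fin 0 → XIndex n) (f : Cn n → ℂ) : iterX J f = f := by
  simp [iterX]

lemma iterX_cons {r : ℕ} (α : XIndex n) (J : Fin r → XIndex n) (f : Cn n → ℂ) :
    iterX (Fin.cons α J : Fin (r + 1) → XIndex n) f = opX α (iterX J f) := by
  simp [iterX, List.ofFn_succ]

lemma sum_fin_succ {M ι : Type*} [AddCommMonoid M] [Fintype ι] {r : ℕ}
    (g : (Fin (r + 1) → ι) → M) : ∑ J, g J = ∑ α, ∑ J : Fin r → ι, g (Fin.cons α J) := by
  rw [← (Fin.consEquiv fun _ => ι).sum_comp, Fintype.sum_prod_type]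
  rfl

lemma BH.iterX {r : ℕ} (J : Fin r → XIndex n) : ∀ {e : ℤ × ℤ} {F : Cn n → ℂ}, BH e F →
    BH (e + ∑ i, xshift (J i)) (iterX J F) := by
  induction r with
  | zero => intro e F hF; rw [iterX_zero]; exact hF.congr (by simp)
  | succ r ih =>
    intro e F hF
    rw [← Fin.cons_self_tail J, iterX_cons]
    refine ((ih (Fin.tail J) hF).opX (J 0)).congr ?_
    rw [Fin.sum_univ_succ]
    simp only [Fin.cons_zero, Fin.cons_succ]
    abel

lemma xshift_sum (α : XIndex n) : (xshift α).1 + (xshift α).2 = 0 := by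
  rcases α with _ | (_ | _) <;> simp [xshift]

/-- Each `X` moves the bidegree along `p + q = const`, so every letter of the word contributes the
same eigenvalue. -/
lemma BH.sum_nrm2_iterX {e : ℤ × ℤ} {F : Cn n → ℂ} (hF : BH e F) (r : ℕ) :
    ∑ J : Fin r → XIndex n, nrm2 (MHarm.iterX J F) =
      (((e.1 + e.2 : ℤ) : ℝ) ^ 2 + 2 * (n - 1) * ((e.1 + e.2 : ℤ) : ℝ)) ^ r * nrm2 F := by
  induction r with
  | zero => simp [iterX_zero]
  | succ r ih =>
    rw [sum_fin_succ, Finset.sum_comm, pow_succ', mul_assoc, ← ih, Finset.mul_sum]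
    refine Finset.sum_congr rfl fun J _ => ?_
    simp only [iterX_cons, (hF.iterX J).sum_nrm2_opX]
    have : (e + ∑ i, xshift (J i)).1 + (e + ∑ i, xshift (J i)).2 = e.1 + e.2 := by
      have : ∑ i, ((xshift (J i)).1 + (xshift (J i)).2) = 0 :=
        Finset.sum_eq_zero fun i _ => xshift_sum (J i)
      rw [Finset.sum_add_distrib] at this
      simp only [Prod.fst_add, Prod.snd_add, Prod.fst_sum, Prod.snd_sum]
      omega
    rw [this]

/-! ### Polar coordinates -/

lemma lintegral_polar (hn : 1 ≤ n) {g : Cn n → ℝ≥0∞} (hg : Measurable g) :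
    ∫⁻ z, g z = ∫⁻ r in Set.Ioi (0 : ℝ), ENNReal.ofReal (r ^ (2 * n - 1)) *
      ∫⁻ η : Sph n, g (r • (η : Cn n)) ∂(volume : Measure (Cn n)).toSphere := by
  have : Nontrivial (Cn n) := Module.nontrivial_of_finrank_pos (R := ℝ) (by rw [finrank_Cn]; omega)
  have h1 : ∫⁻ z, g z = ∫⁻ x : ({0}ᶜ : Set (Cn n)), g x ∂((volume : Measure (Cn n)).comap (↑)) := by
    rw [lintegral_subtype_comap (measurableSet_singleton _).compl, restrict_compl_singleton]
  have hG : Measurable fun y : Sph n × Set.Ioi (0 : ℝ) => g ((y.2 : ℝ) • (y.1 : Cn n)) :=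
    hg.comp (by fun_prop)
  have h2 := (volume : Measure (Cn n)).measurePreserving_homeomorphUnitSphereProd.lintegral_comp hG
  have h3 : ∀ x : ({0}ᶜ : Set (Cn n)), g (((homeomorphUnitSphereProd (Cn n) x).2 : ℝ) •
      ((homeomorphUnitSphereProd (Cn n) x).1 : Cn n)) = g x := by
    intro x
    congr 1
    have hx : ‖(x : Cn n)‖ ≠ 0 := norm_ne_zero_iff.2 x.2
    simp [smul_smul, hx]
  simp only [h3] at h2
  rw [h1, h2, finrank_Cn, lintegral_prod_symm _ hG.aemeasurable, Measure.volumeIoiPow]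
  have hm : Measurable fun r : Set.Ioi (0 : ℝ) => ENNReal.ofReal ((r : ℝ) ^ (2 * n - 1)) := by
    fun_prop
  rw [lintegral_withDensity_eq_lintegral_mul _ hm hG.lintegral_prod_left']
  exact lintegral_subtype_comap measurableSet_Ioi (fun r : ℝ =>
    ENNReal.ofReal (r ^ (2 * n - 1)) *
      ∫⁻ η : Sph n, g (r • (η : Cn n)) ∂(volume : Measure (Cn n)).toSphere)

/-- The sphere measure is a multiple of the normalized one. -/
lemma toSphere_eq (hn : 1 ≤ n) : (volume : Measure (Cn n)).toSphere =
    (volume : Measure (Cn n)).toSphere Set.univ • sigma n := by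
  have : Nontrivial (Cn n) := Module.nontrivial_of_finrank_pos (R := ℝ) (by rw [finrank_Cn]; omega)
  rw [sigma, smul_smul, ENNReal.mul_inv_cancel, one_smul]
  · exact Measure.measure_univ_ne_zero.2 (Measure.toSphere_ne_zero _)
  · exact measure_ne_top _ _

lemma toSphere_univ_ne_zero (hn : 1 ≤ n) : (volume : Measure (Cn n)).toSphere Set.univ ≠ 0 := by
  have : Nontrivial (Cn n) := Module.nontrivial_of_finrank_pos (R := ℝ) (by rw [finrank_Cn]; omega)
  exact Measure.measure_univ_ne_zero.2 (Measure.toSphere_ne_zero _)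

lemma lintegral_Ioo_sq (h : ℝ → ℝ≥0∞) :
    ∫⁻ t in Set.Ioo (0 : ℝ) 1, h t = ∫⁻ r in Set.Ioo (0 : ℝ) 1, ENNReal.ofReal (2 * r) * h (r ^ 2) := by
  have himg : (fun r : ℝ => r ^ 2) '' Set.Ioo 0 1 = Set.Ioo 0 1 := by
    ext t
    constructor
    · rintro ⟨r, hr, rfl⟩
      exact ⟨by have := hr.1; positivity, by have := hr.1; have := hr.2; nlinarith⟩
    · intro ht
      refine ⟨√t, ⟨Real.sqrt_pos.2 ht.1, ?_⟩, Real.sq_sqrt ht.1.le⟩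
      rw [Real.sqrt_lt' one_pos]; simpa using ht.2
  have := lintegral_image_eq_lintegral_abs_deriv_mul (s := Set.Ioo (0 : ℝ) 1)
    (f := fun r => r ^ 2) (f' := fun r => 2 * r) measurableSet_Ioo
    (fun r _ => by simpa using (hasDerivAt_pow 2 r).hasDerivWithinAt)
    (fun a ha b hb hab => by
      have := ha.1; have := hb.1
      exact (pow_left_inj₀ (by linarith) (by linarith) two_ne_zero).1 hab) h
  rw [himg] at this
  rw [this]
  refine setLIntegral_congr_fun measurableSet_Ioo fun r hr => ?_
  rw [abs_of_pos (by have := hr.1; positivity)]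

/-- The polar coordinate constant for `sqNorm`. -/
def polarConst (n : ℕ) (s : ℝ) : ℝ≥0∞ :=
  ENNReal.ofReal ((ascPochhammer ℝ n).eval (s + 1) / Real.pi ^ n) *
    (volume : Measure (Cn n)).toSphere Set.univ / 2

lemma polarConst_ne_top (s : ℝ) : polarConst n s ≠ ⊤ := by
  unfold polarConst
  exact ENNReal.div_ne_top (ENNReal.mul_ne_top ENNReal.ofReal_ne_top (measure_ne_top _ _))
    two_ne_zero

lemma density_const_pos {s : ℝ} (hs : -1 < s) :
    0 < (ascPochhammer ℝ n).eval (s + 1) / Real.pi ^ n :=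
  div_pos (ascPochhammer_pos n _ (by linarith)) (pow_pos Real.pi_pos n)

lemma polarConst_ne_zero (hn : 1 ≤ n) {s : ℝ} (hs : -1 < s) : polarConst n s ≠ 0 := by
  unfold polarConst
  refine (ENNReal.div_pos (mul_ne_zero ?_ (toSphere_univ_ne_zero hn)) (by simp)).ne'
  simpa using density_const_pos hs

lemma measurable_density (s : ℝ) : Measurable fun z : Cn n =>
    ENNReal.ofReal ((ascPochhammer ℝ n).eval (s + 1) / Real.pi ^ n * (1 - ‖z‖ ^ 2) ^ s) := by
  fun_prop

/-- Polar coordinates followed by `t = r²`: since `r^(2n-1) dr = t^(n-1) dt / 2`, the factor one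
half is part of `polarConst`. -/
lemma sqNorm_polar_of_measurable (hn : 1 ≤ n) {s : ℝ} (hs : -1 < s) {u : Cn n → ℂ}
    (hu : Measurable u) :
    sqNorm s u = polarConst n s * ∫⁻ t in Set.Ioo (0 : ℝ) 1,
      ENNReal.ofReal (t ^ (n - 1) * (1 - t) ^ s) * sphereSqNorm (fun z => u (√t • z)) := by
  set c := (ascPochhammer ℝ n).eval (s + 1) / Real.pi ^ n with hc
  have hcpos : 0 < c := density_const_pos hs
  set V := (volume : Measure (Cn n)).toSphere Set.univ with hV
  have hmeas : Measurable fun z : Cn n => ‖u z‖ₑ ^ 2 := by fun_prop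
  rw [sqNorm, mu, lintegral_withDensity_eq_lintegral_mul _ (measurable_density s) hmeas,
    ← lintegral_indicator measurableSet_ball, lintegral_polar hn
      (((measurable_density s).mul hmeas).indicator measurableSet_ball)]
  have hsub : Set.Ioo (0 : ℝ) 1 ⊆ Set.Ioi 0 := fun r hr => hr.1
  have h1 : ∀ r ∈ Set.Ioi (0 : ℝ), (ENNReal.ofReal (r ^ (2 * n - 1)) *
      ∫⁻ η : Sph n, (unitBall n).indicator ((fun z : Cn n => ENNReal.ofReal
        (c * (1 - ‖z‖ ^ 2) ^ s)) * fun z => ‖u z‖ₑ ^ 2) (r • (η : Cn n))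
          ∂(volume : Measure (Cn n)).toSphere) =
      (Set.Ioo (0 : ℝ) 1).indicator (fun r => V * (ENNReal.ofReal (r ^ (2 * n - 1)) *
        ENNReal.ofReal (c * (1 - r ^ 2) ^ s) * sphereSqNorm (fun z => u (r • z)))) r := by
    intro r hr
    have hnorm : ∀ η : Sph n, ‖r • (η : Cn n)‖ = r := fun η => by
      rw [norm_smul, norm_sph, mul_one, Real.norm_of_nonneg (le_of_lt hr)]
    by_cases hr1 : r < 1
    · rw [Set.indicator_of_mem (show r ∈ Set.Ioo (0 : ℝ) 1 from ⟨hr, hr1⟩)]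
      have : ∀ η : Sph n, (unitBall n).indicator ((fun z : Cn n => ENNReal.ofReal
        (c * (1 - ‖z‖ ^ 2) ^ s)) * fun z => ‖u z‖ₑ ^ 2) (r • (η : Cn n)) =
          ENNReal.ofReal (c * (1 - r ^ 2) ^ s) * ‖u (r • (η : Cn n))‖ₑ ^ 2 := fun η => by
        rw [Set.indicator_of_mem (by simp [hnorm, hr1])]
        simp only [Pi.mul_apply, hnorm]
      simp only [this]
      rw [lintegral_const_mul _ (by fun_prop), toSphere_eq hn, lintegral_smul_measure, sphereSqNorm,
        ← hV, smul_eq_mul]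
      ring
    · rw [Set.indicator_of_notMem (by simp [hr1])]
      have : ∀ η : Sph n, (unitBall n).indicator ((fun z : Cn n => ENNReal.ofReal
        (c * (1 - ‖z‖ ^ 2) ^ s)) * fun z => ‖u z‖ₑ ^ 2) (r • (η : Cn n)) = 0 := fun η =>
        Set.indicator_of_notMem (by simp [hnorm]; linarith) _
      simp [this]
  rw [setLIntegral_congr_fun measurableSet_Ioi h1, lintegral_indicator measurableSet_Ioo,
    Measure.restrict_restrict measurableSet_Ioo, Set.inter_eq_left.2 hsub,
    lintegral_Ioo_sq fun t => ENNReal.ofReal (t ^ (n - 1) * (1 - t) ^ s) *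
      sphereSqNorm (fun z => u (√t • z))]
  have hfin : polarConst n s ≠ ⊤ := polarConst_ne_top s
  rw [← lintegral_const_mul' _ _ hfin]
  refine setLIntegral_congr_fun measurableSet_Ioo fun r hr => ?_
  have hr0 : 0 < r := hr.1
  have hr2 : 0 < 1 - r ^ 2 := by have := hr.2; nlinarith
  have hpow : 0 < (1 - r ^ 2) ^ s := Real.rpow_pos_of_pos hr2 s
  simp only [Real.sqrt_sq hr0.le, polarConst, ← hc, ← hV]
  generalize sphereSqNorm (fun z => u (r • z)) = X
  have e2 : ENNReal.ofReal (2 * r) * (ENNReal.ofReal ((r ^ 2) ^ (n - 1) * (1 - r ^ 2) ^ s) * X) =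
      2 * (ENNReal.ofReal (r ^ (2 * n - 1)) * ENNReal.ofReal ((1 - r ^ 2) ^ s) * X) := by
    rw [← mul_assoc, ← ENNReal.ofReal_mul (by positivity), ← ENNReal.ofReal_mul (by positivity),
      show (2 : ℝ≥0∞) = ENNReal.ofReal 2 by simp, ← mul_assoc (ENNReal.ofReal 2),
      ← ENNReal.ofReal_mul (by norm_num)]
    congr 2
    have : r ^ (2 * n - 1) = r * (r ^ 2) ^ (n - 1) := by
      rw [← pow_mul, ← pow_succ']; congr 1; omega
    rw [this]; ring
  rw [e2, ENNReal.ofReal_mul hcpos.le, ENNReal.div_eq_inv_mul]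
  have h2 : (2 : ℝ≥0∞)⁻¹ * 2 = 1 := ENNReal.inv_mul_cancel (by simp) (by simp)
  calc _ = 1 * (V * (ENNReal.ofReal (r ^ (2 * n - 1)) *
        (ENNReal.ofReal c * ENNReal.ofReal ((1 - r ^ 2) ^ s)) * X)) := by rw [one_mul]
    _ = _ := by rw [← h2]; ring

lemma smul_sph_mem_ball {t : ℝ} (ht : t ∈ Set.Ioo (0 : ℝ) 1) (η : Sph n) :
    √t • (η : Cn n) ∈ unitBall n := by
  rw [mem_ball_zero_iff, norm_smul, norm_sph, mul_one, Real.norm_of_nonneg (Real.sqrt_nonneg _),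
    Real.sqrt_lt' one_pos]
  simpa using ht.2

lemma ae_mu_mem_ball (s : ℝ) : ∀ᵐ z ∂(mu n s), z ∈ unitBall n :=
  (withDensity_absolutelyContinuous _ _).ae_le (ae_restrict_mem measurableSet_ball)

lemma sqNorm_congr {s : ℝ} {u v : Cn n → ℂ} (h : ∀ z ∈ unitBall n, u z = v z) :
    sqNorm s u = sqNorm s v :=
  lintegral_congr_ae (by filter_upwards [ae_mu_mem_ball s] with z hz; rw [h z hz])

/-- Nothing is known about `u` outside the ball; its extension by zero is measurable and has the
same norm. -/
lemma sqNorm_polar (hn : 1 ≤ n) {s : ℝ} (hs : -1 < s) {u : Cn n → ℂ}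
    (hu : ContinuousOn u (unitBall n)) :
    sqNorm s u = polarConst n s * ∫⁻ t in Set.Ioo (0 : ℝ) 1,
      ENNReal.ofReal (t ^ (n - 1) * (1 - t) ^ s) * sphereSqNorm (fun z => u (√t • z)) := by
  classical
  have hm : Measurable ((unitBall n).piecewise u fun _ => 0) :=
    hu.measurable_piecewise continuousOn_const measurableSet_ball
  have h1 : sqNorm s u = sqNorm s ((unitBall n).piecewise u fun _ => 0) :=
    sqNorm_congr fun z hz => (Set.piecewise_eq_of_mem _ _ _ hz).symm
  rw [h1, sqNorm_polar_of_measurable hn hs hm]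
  congr 1
  refine setLIntegral_congr_fun measurableSet_Ioo fun t ht => ?_
  simp only [sphereSqNorm]
  congr 1
  refine lintegral_congr fun η => ?_
  rw [Set.piecewise_eq_of_mem _ _ _ (smul_sph_mem_ball ht η)]

/-! ### Power series with nonnegative coefficients -/

/-- `g` is the sum on `(-1, 1)` of a power series with nonnegative coefficients `b`. -/
structure NonnegSeries (b : ℕ → ℝ) (g : ℝ → ℝ) : Prop where
  nonneg : ∀ m, 0 ≤ b m
  hasSum : ∀ t, |t| < 1 → HasSum (fun m => b m * t ^ m) (g t)

/-- Convexity of `x ↦ x^(m+1)`. Applied termwise, it bounds the derivative of a series with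
nonnegative coefficients at `r` by its value at a larger `r'`. -/
lemma succ_mul_pow_mul_le {r r' : ℝ} (h0 : 0 ≤ r) (h : r ≤ r') (m : ℕ) :
    ((m : ℝ) + 1) * r ^ m * (r' - r) ≤ r' ^ (m + 1) - r ^ (m + 1) := by
  induction m with
  | zero => simp
  | succ m ih =>
    have h1 : r ^ (m + 1) ≤ r' ^ (m + 1) := pow_le_pow_left₀ h0 h _
    have h2 := mul_le_mul_of_nonneg_left ih h0
    have h3 := mul_le_mul_of_nonneg_right h1 (sub_nonneg.2 h)
    push_cast
    rw [pow_succ] at h3 h2 ⊢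
    nlinarith [pow_succ r' (m + 1), pow_succ r (m + 1), pow_succ r m, pow_succ r' m]

namespace NonnegSeries

variable {b : ℕ → ℝ} {g : ℝ → ℝ}

lemma term_le (h : NonnegSeries b g) {t t' : ℝ} (h0 : 0 ≤ t) (htt : t ≤ t') (m : ℕ) :
    ((m : ℝ) + 1) * b (m + 1) * t ^ m * (t' - t) ≤ b (m + 1) * t' ^ (m + 1) := by
  have h1 := succ_mul_pow_mul_le h0 htt m
  have h2 := mul_le_mul_of_nonneg_left h1 (h.nonneg (m + 1))
  nlinarith [mul_nonneg (h.nonneg (m + 1)) (pow_nonneg h0 (m + 1))]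

lemma hasSum_succ (h : NonnegSeries b g) {t : ℝ} (ht : |t| < 1) :
    HasSum (fun m => b (m + 1) * t ^ (m + 1)) (g t - b 0) := by
  have := (hasSum_nat_add_iff' (f := fun m => b m * t ^ m) 1).2 (h.hasSum t ht)
  simpa using this

lemma summable_deriv (h : NonnegSeries b g) {r : ℝ} (h0 : 0 ≤ r) (h1 : r < 1) :
    Summable fun m : ℕ => ((m : ℝ) + 1) * b (m + 1) * r ^ m := by
  obtain ⟨r', hr, hr1⟩ := exists_between h1
  have hs := ((h.hasSum_succ (t := r') (by rw [abs_of_nonneg (by linarith)]; exact hr1)).summable).mul_right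
    ((r' - r)⁻¹)
  refine Summable.of_nonneg_of_le (fun m => ?_) (fun m => ?_) hs
  · have := h.nonneg (m + 1); positivity
  · rw [← div_eq_mul_inv, le_div_iff₀ (by linarith)]
    exact h.term_le h0 hr.le m

lemma hasDerivAt (h : NonnegSeries b g) {t : ℝ} (ht : |t| < 1) :
    HasDerivAt g (∑' m : ℕ, ((m : ℝ) + 1) * b (m + 1) * t ^ m) t := by
  obtain ⟨r, hr, hr1⟩ := exists_between ht
  have hr0 : 0 ≤ r := (abs_nonneg t).trans hr.le
  have hmem : t ∈ Set.Ioo (-r) r := abs_lt.1 hr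
  have key := hasDerivAt_tsum_of_isPreconnected (𝕜 := ℝ) (h.summable_deriv hr0 hr1)
    (g := fun m t => b (m + 1) * t ^ (m + 1)) (t := Set.Ioo (-r) r)
    (g' := fun m t => ((m : ℝ) + 1) * b (m + 1) * t ^ m) isOpen_Ioo isPreconnected_Ioo
    (fun m y _ => by
      have := (hasDerivAt_pow (m + 1) y).const_mul (b (m + 1))
      refine this.congr_deriv ?_
      push_cast; ring)
    (fun m y hy => by
      rw [norm_mul, norm_pow, Real.norm_eq_abs, Real.norm_eq_abs,
        abs_of_nonneg (mul_nonneg (by positivity) (h.nonneg (m + 1)))]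
      have hy' : |y| ≤ r := (abs_lt.2 hy).le
      have := h.nonneg (m + 1)
      gcongr) hmem ((h.hasSum_succ ht).summable) hmem
  have hev : g =ᶠ[𝓝 t] fun z => (∑' m, b (m + 1) * z ^ (m + 1)) + b 0 := by
    filter_upwards [isOpen_Ioo.mem_nhds hmem] with z hz
    have hz1 : |z| < 1 := (abs_lt.2 hz).trans hr1
    rw [(h.hasSum_succ hz1).tsum_eq]; ring
  exact (key.add_const (b 0)).congr_of_eventuallyEq hev

lemma deriv (h : NonnegSeries b g) :
    NonnegSeries (fun m => ((m : ℝ) + 1) * b (m + 1)) (deriv g) := by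
  refine ⟨fun m => mul_nonneg (by positivity) (h.nonneg _), fun t ht => ?_⟩
  rw [(h.hasDerivAt ht).deriv]
  refine Summable.hasSum (.of_norm ?_)
  have := h.summable_deriv (abs_nonneg t) ht
  refine this.congr fun m => ?_
  rw [norm_mul, norm_pow, Real.norm_eq_abs, Real.norm_eq_abs,
        abs_of_nonneg (mul_nonneg (by positivity) (h.nonneg (m + 1)))]

lemma eval_nonneg (h : NonnegSeries b g) {t : ℝ} (h0 : 0 ≤ t) (h1 : t < 1) : 0 ≤ g t :=
  (h.hasSum t (by rwa [abs_of_nonneg h0])).nonneg fun m => mul_nonneg (h.nonneg m) (by positivity)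

lemma mono (h : NonnegSeries b g) {t t' : ℝ} (h0 : 0 ≤ t) (htt : t ≤ t') (h1 : t' < 1) :
    g t ≤ g t' :=
  hasSum_le (fun m => by have := h.nonneg m; gcongr)
    (h.hasSum t (by rw [abs_of_nonneg h0]; linarith))
    (h.hasSum t' (by rw [abs_of_nonneg (h0.trans htt)]; exact h1))

lemma coeff_zero_le (h : NonnegSeries b g) {t : ℝ} (h0 : 0 ≤ t) (h1 : t < 1) : b 0 ≤ g t := by
  have h2 := h.hasSum_succ (t := t) (by rwa [abs_of_nonneg h0])
  have := h2.nonneg fun m => mul_nonneg (h.nonneg _) (by positivity)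
  linarith

/-- A Cauchy estimate with an explicit constant independent of the series: nonnegativity of the
coefficients permits comparison term by term. -/
lemma deriv_mul_le (h : NonnegSeries b g) {t t' : ℝ} (h0 : 0 ≤ t) (htt : t ≤ t') (h1 : t' < 1) :
    _root_.deriv g t * (t' - t) ≤ g t' := by
  have e1 := (h.deriv.hasSum t (by rw [abs_of_nonneg h0]; linarith)).mul_right (t' - t)
  have e2 := h.hasSum_succ (t := t') (by rwa [abs_of_nonneg (h0.trans htt)])
  have := hasSum_le (fun m => h.term_le h0 htt m) e1 e2
  linarith [h.nonneg 0]

lemma iteratedDeriv (i : ℕ) : ∀ {b : ℕ → ℝ} {g : ℝ → ℝ}, NonnegSeries b g →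
    ∃ b', NonnegSeries b' (iteratedDeriv i g) := by
  induction i with
  | zero => intro b g h; exact ⟨b, by simpa using h⟩
  | succ i ih => intro b g h; rw [iteratedDeriv_succ']; exact ih h.deriv

/-- Iterates `deriv_mul_le` through intermediate points. The constant is chosen before the series,
hence serves all `S_{pq}` at once. -/
lemma iteratedDeriv_le (i : ℕ) : ∀ {t₀ t₁ : ℝ}, 0 ≤ t₀ → t₀ < t₁ → t₁ < 1 →
    ∃ C : ℝ, 0 ≤ C ∧ ∀ (b : ℕ → ℝ) (g : ℝ → ℝ), NonnegSeries b g →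
      ∀ t, 0 ≤ t → t ≤ t₀ → _root_.iteratedDeriv i g t ≤ C * g t₁ := by
  induction i with
  | zero =>
    intro t₀ t₁ h0 h1 h2
    exact ⟨1, zero_le_one, fun b g h t ht ht' => by
      simpa using h.mono ht (ht'.trans h1.le) h2⟩
  | succ i ih =>
    intro t₀ t₁ h0 h1 h2
    obtain ⟨tm, hm0, hm1⟩ := exists_between h1
    obtain ⟨C, hC, hb⟩ := ih h0 hm0 (hm1.trans h2)
    refine ⟨C / (t₁ - tm), div_nonneg hC (by linarith), fun b g h t ht ht' => ?_⟩
    rw [iteratedDeriv_succ']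
    refine (hb _ _ h.deriv t ht ht').trans ?_
    have h3 := h.deriv_mul_le (t := tm) (t' := t₁) (by linarith) hm1.le h2
    rw [div_mul_eq_mul_div, le_div_iff₀ (by linarith), mul_assoc]
    exact mul_le_mul_of_nonneg_left h3 hC

lemma contDiffOn (h : NonnegSeries b g) : ContDiffOn ℝ ∞ g (Set.Ioo (-1) 1) := by
  refine contDiffOn_infty.2 fun k => ?_
  induction k generalizing b g with
  | zero =>
    exact contDiffOn_zero.2 fun t ht =>
      (h.hasDerivAt (abs_lt.2 ht)).continuousAt.continuousWithinAt
  | succ k ih =>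
    rw [show ((k + 1 : ℕ) : WithTop ℕ∞) = (k : WithTop ℕ∞) + 1 by norm_cast,
      contDiffOn_succ_iff_deriv_of_isOpen isOpen_Ioo]
    exact ⟨fun t ht => (h.hasDerivAt (abs_lt.2 ht)).differentiableAt.differentiableWithinAt,
      by simp, ih h.deriv⟩

lemma contDiffAt (h : NonnegSeries b g) {t : ℝ} (ht : |t| < 1) : ContDiffAt ℝ ∞ g t :=
  h.contDiffOn.contDiffAt (isOpen_Ioo.mem_nhds (abs_lt.1 ht))

/-- The operator `t d/dt` on the level of coefficients. -/
lemma theta (h : NonnegSeries b g) :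
    NonnegSeries (fun m => m * b m) (fun t => t * _root_.deriv g t) := by
  refine ⟨fun m => mul_nonneg (by positivity) (h.nonneg m), fun t ht => ?_⟩
  have := (h.deriv.hasSum t ht).mul_left t
  refine (hasSum_nat_add_iff' (f := fun m : ℕ => (m : ℝ) * b m * t ^ m) 1).1 ?_
  simp only [Finset.range_one, Finset.sum_singleton, Nat.cast_zero, zero_mul, sub_zero]
  exact this.congr_fun fun m => by push_cast; ring

end NonnegSeries

/-! ### The functions `S_{pq}` -/

/-- The normalizing constant of `S_{pq}`. -/
def sConst (n p q : ℕ) : ℝ := (ascPochhammer ℝ p).eval (n : ℝ) * (ascPochhammer ℝ q).eval (n : ℝ)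
      / (ascPochhammer ℝ (p + q)).eval (n : ℝ)

/-- The Taylor coefficients of `S_{pq}`. -/
def sCoeff (n p q m : ℕ) : ℝ :=
  sConst n p q * ordinaryHypergeometricCoefficient (p : ℝ) (q : ℝ) ((p : ℝ) + q + n) m

lemma sConst_pos (hn : 1 ≤ n) (p q : ℕ) : 0 < sConst n p q := by
  have hn' : (0 : ℝ) < n := by exact_mod_cast hn
  exact div_pos (mul_pos (ascPochhammer_pos _ _ hn') (ascPochhammer_pos _ _ hn'))
    (ascPochhammer_pos _ _ hn')

lemma ascPochhammer_eval_nonneg (m p : ℕ) : 0 ≤ (ascPochhammer ℝ m).eval (p : ℝ) := by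
  induction m with
  | zero => simp
  | succ m ih => rw [ascPochhammer_succ_eval]; positivity

/-- If `p` or `q` is zero the hypergeometric series terminates and its radius is infinite; otherwise
no parameter is a nonpositive integer and the radius is one. -/
lemma one_le_radius (hn : 1 ≤ n) (p q : ℕ) :
    1 ≤ (ordinaryHypergeometricSeries ℝ (p : ℝ) (q : ℝ) ((p : ℝ) + q + n)).radius := by
  have hn' : (0 : ℝ) < n := by exact_mod_cast hn
  rcases Nat.eq_zero_or_pos p with rfl | hp
  · have := ordinaryHypergeometric_radius_top_of_neg_nat₁ ℝ (q : ℝ) (((0 : ℕ) : ℝ) + q + n) (k := 0)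
    have e : (-((0 : ℕ) : ℝ)) = ((0 : ℕ) : ℝ) := by simp
    rw [e] at this
    rw [this]; exact le_top
  rcases Nat.eq_zero_or_pos q with rfl | hq
  · have := ordinaryHypergeometric_radius_top_of_neg_nat₂ ℝ (p : ℝ) ((p : ℝ) + ((0 : ℕ) : ℝ) + n)
      (k := 0)
    have e : (-((0 : ℕ) : ℝ)) = ((0 : ℕ) : ℝ) := by simp
    rw [e] at this
    rw [this]; exact le_top
  have hp' : (0 : ℝ) < p := by exact_mod_cast hp
  have hq' : (0 : ℝ) < q := by exact_mod_cast hq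
  rw [ordinaryHypergeometricSeries_radius_eq_one]
  intro k
  have hk : (0 : ℝ) ≤ k := Nat.cast_nonneg k
  exact ⟨by linarith, by linarith, by linarith⟩

lemma nonnegSeries_S (hn : 1 ≤ n) (p q : ℕ) : NonnegSeries (sCoeff n p q) (S n p q) := by
  refine ⟨fun m => ?_, fun t ht => ?_⟩
  · refine mul_nonneg (sConst_pos hn p q).le ?_
    have h1 := ascPochhammer_eval_nonneg m p
    have h2 := ascPochhammer_eval_nonneg m q
    have h3 := ascPochhammer_eval_nonneg m (p + q + n)
    push_cast at h3
    unfold ordinaryHypergeometricCoefficient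
    positivity
  · have hmem : t ∈ Metric.eball (0 : ℝ)
        (ordinaryHypergeometricSeries ℝ (p : ℝ) (q : ℝ) ((p : ℝ) + q + n)).radius := by
      refine Metric.eball_subset_eball (one_le_radius hn p q) ?_
      rw [Metric.mem_eball, edist_zero_right, ← ofReal_norm, Real.norm_eq_abs]
      simpa using ht
    have := FormalMultilinearSeries.hasSum _ hmem
    simp only [ordinaryHypergeometricSeries_apply_eq, smul_eq_mul] at this
    have h2 := this.mul_left (sConst n p q)
    simp only [← mul_assoc] at h2 ⊢
    simpa [sCoeff, S, sConst, ordinaryHypergeometric, mul_assoc] using h2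

/-- The hypergeometric recursion, which is the differential equation read off at the level of
coefficients. -/
lemma sCoeff_succ (hn : 1 ≤ n) (p q m : ℕ) :
    ((m : ℝ) + 1) * (m + p + q + n) * sCoeff n p q (m + 1) =
      (m + p) * (m + q) * sCoeff n p q m := by
  have hn' : (0 : ℝ) < n := by exact_mod_cast hn
  have hc : ((ascPochhammer ℝ m).eval ((p : ℝ) + q + n)) ≠ 0 :=
    (ascPochhammer_pos _ _ (by positivity)).ne'
  have hc2 : ((p : ℝ) + q + n + m) ≠ 0 := by positivity
  have hf : (m.factorial : ℝ) ≠ 0 := by positivity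
  simp only [sCoeff, ordinaryHypergeometricCoefficient, ascPochhammer_succ_eval,
    Nat.factorial_succ]
  push_cast
  field_simp
  ring

lemma S_pos (hn : 1 ≤ n) (p q : ℕ) {t : ℝ} (h0 : 0 ≤ t) (h1 : t < 1) : 0 < S n p q t := by
  refine lt_of_lt_of_le ?_ ((nonnegSeries_S hn p q).coeff_zero_le h0 h1)
  simpa [sCoeff, ordinaryHypergeometricCoefficient] using sConst_pos hn p q

lemma eulerOp_congr {f g : ℝ → ℝ} {t : ℝ} (h : f =ᶠ[𝓝 t] g) : eulerOp f t = eulerOp g t := by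
  rw [eulerOp, eulerOp, h.deriv_eq]

/-- The radial profile of the solid harmonics. -/
def gfun (n p q : ℕ) (u : ℝ) : ℝ := u ^ (((p : ℝ) + q) / 2) * S n p q u

lemma eulerOp_rpow_mul {a t : ℝ} (ht : 0 < t) {h : ℝ → ℝ} (hh : DifferentiableAt ℝ h t) :
    eulerOp (fun u => u ^ a * h u) t = t ^ a * (2 * a * h t + 2 * (t * deriv h t)) := by
  have h1 := (Real.hasDerivAt_rpow_const (p := a) (Or.inl ht.ne')).mul hh.hasDerivAt
  have h2 : (fun u : ℝ => u ^ a * h u) = (fun u : ℝ => u ^ a) * h := rfl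
  rw [eulerOp, h2, h1.deriv, Real.rpow_sub_one ht.ne']
  field_simp

/-- The differential equation of `S_{pq}`, with `θ = t d/dt`. -/
lemma S_ode (hn : 1 ≤ n) (p q : ℕ) {t : ℝ} (ht : |t| < 1) :
    t * deriv (fun u => u * deriv (S n p q) u) t + (p + q + n - 1) * (t * deriv (S n p q) t) =
      t * (t * deriv (fun u => u * deriv (S n p q) u) t + (p + q) * (t * deriv (S n p q) t)
        + p * q * S n p q t) := by
  have h := nonnegSeries_S hn p q
  have h0 := h.hasSum t ht
  have h1 := h.theta.hasSum t ht
  have h2 := h.theta.theta.hasSum t ht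
  have hl := h2.add (h1.mul_left ((p : ℝ) + q + n - 1))
  have hr := ((h2.add (h1.mul_left ((p : ℝ) + q))).add (h0.mul_left ((p : ℝ) * q))).mul_left t
  -- The left series has no constant term. Dropping it shifts the index, so both sides are compared
  -- at `t^(m+1)`, where `sCoeff_succ` applies.
  have hl' := (hasSum_nat_add_iff' 1).2 hl
  simp only [Finset.range_one, Finset.sum_singleton, Nat.cast_zero, zero_mul, mul_zero, add_zero,
    sub_zero] at hl'
  refine hl'.unique ?_
  refine hr.congr_fun fun m => ?_
  have := sCoeff_succ hn p q m
  push_cast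
  linear_combination t ^ (m + 1) * this

lemma gfun_differentiable_aux (hn : 1 ≤ n) (p q : ℕ) {t : ℝ} (ht : t ∈ Set.Ioo (0 : ℝ) 1) :
    DifferentiableAt ℝ (S n p q) t ∧
      DifferentiableAt ℝ (fun u => u * deriv (S n p q) u) t := by
  have habs : |t| < 1 := by rw [abs_of_pos ht.1]; exact ht.2
  have h := nonnegSeries_S hn p q
  exact ⟨(h.hasDerivAt habs).differentiableAt, (h.theta.hasDerivAt habs).differentiableAt⟩

lemma eulerOp_gfun (hn : 1 ≤ n) (p q : ℕ) {t : ℝ} (ht : t ∈ Set.Ioo (0 : ℝ) 1) :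
    eulerOp (gfun n p q) t =
      t ^ (((p : ℝ) + q) / 2) * ((p + q) * S n p q t + 2 * (t * deriv (S n p q) t)) := by
  refine (eulerOp_rpow_mul ht.1 (gfun_differentiable_aux hn p q ht).1).trans ?_
  ring

lemma eulerOp_eulerOp_gfun (hn : 1 ≤ n) (p q : ℕ) {t : ℝ} (ht : t ∈ Set.Ioo (0 : ℝ) 1) :
    eulerOp (eulerOp (gfun n p q)) t =
      t ^ (((p : ℝ) + q) / 2) * ((p + q) ^ 2 * S n p q t + 4 * (p + q) * (t * deriv (S n p q) t)
        + 4 * (t * deriv (fun u => u * deriv (S n p q) u) t)) := by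
  have hev : eulerOp (gfun n p q) =ᶠ[𝓝 t] fun u => u ^ (((p : ℝ) + q) / 2) *
      ((p + q) * S n p q u + 2 * (u * deriv (S n p q) u)) := by
    filter_upwards [isOpen_Ioo.mem_nhds ht] with u hu using eulerOp_gfun hn p q hu
  obtain ⟨d1, d2⟩ := gfun_differentiable_aux hn p q ht
  have hd : HasDerivAt (fun u => ((p : ℝ) + q) * S n p q u + 2 * (u * deriv (S n p q) u))
      (((p : ℝ) + q) * deriv (S n p q) t + 2 * deriv (fun u => u * deriv (S n p q) u) t) t :=
    (d1.hasDerivAt.const_mul _).add (d2.hasDerivAt.const_mul _)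
  rw [eulerOp_congr hev, eulerOp_rpow_mul ht.1 hd.differentiableAt, hd.deriv]
  ring

lemma gfun_pos (hn : 1 ≤ n) (p q : ℕ) {t : ℝ} (ht : t ∈ Set.Ioo (0 : ℝ) 1) :
    0 < gfun n p q t :=
  mul_pos (Real.rpow_pos_of_pos ht.1 _) (S_pos hn p q ht.1.le ht.2)

/-- This is `S_ode` after conjugation by `t^((p+q)/2)`, in terms of `2t d/dt`. It has exactly the
shape of `sphInt_ode` with `κ = 1`. -/
lemma gfun_ode (hn : 1 ≤ n) (p q : ℕ) {t : ℝ} (ht : t ∈ Set.Ioo (0 : ℝ) 1) :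
    (1 - t) * (eulerOp (eulerOp (gfun n p q)) t - (p - q) ^ 2 * gfun n p q t)
      + 2 * (n - 1) * eulerOp (gfun n p q) t
      - (4 * p * q + 2 * (n - 1) * (p + q)) * gfun n p q t = 0 := by
  rw [eulerOp_eulerOp_gfun hn p q ht, eulerOp_gfun hn p q ht, gfun]
  have := S_ode hn p q (t := t) (by rw [abs_of_pos ht.1]; exact ht.2)
  linear_combination 4 * t ^ (((p : ℝ) + q) / 2) * this

/-! ### Dilations -/

lemma lin_dilate (A : Cn n →L[ℝ] Cn n) (f : Cn n → ℂ) (r : ℝ) (z : Cn n) :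
    lin A (fun w => f (r • w)) z = lin A f (r • z) := by
  simp only [lin, fderiv_comp_smul, map_smul, smul_apply]

/-- Linear fields are invariant under dilations, so integral identities on the unit sphere apply to
every sphere of radius `√t`. -/
lemma opX_dilate (α : XIndex n) (f : Cn n → ℂ) (r : ℝ) :
    opX α (fun w => f (r • w)) = fun z => opX α f (r • z) := by
  obtain ⟨A, B, a, b, -, -, h⟩ := opX_eq_lin α
  ext z
  rw [h, h, lin_dilate, lin_dilate]

lemma contDiffAt_opN {k m : WithTop ℕ∞} {f : Cn n → ℂ} {z : Cn n} (hf : ContDiffAt ℝ m f z)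
    (hkm : k + 1 ≤ m) : ContDiffAt ℝ k (opN f) z := by
  have : opN f = fun w => fderiv ℝ f w w := funext fun w => opN_eq_lin f w
  rw [this]
  exact (hf.fderiv_right hkm).clm_apply contDiffAt_id

lemma contDiffAt_opX {k m : WithTop ℕ∞} {f : Cn n → ℂ} {z : Cn n} (hf : ContDiffAt ℝ m f z)
    (hkm : k + 1 ≤ m) (α : XIndex n) : ContDiffAt ℝ k (opX α f) z := by
  obtain ⟨A, B, a, b, -, -, h⟩ := opX_eq_lin α
  have : opX α f = fun z => a * lin A f z + b * lin B f z := funext fun z => h f z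
  rw [this]
  have hd := hf.fderiv_right hkm
  exact (contDiffAt_const.mul (hd.clm_apply A.contDiff.contDiffAt)).add
    (contDiffAt_const.mul (hd.clm_apply B.contDiff.contDiffAt))

lemma smoothNearSph_dilate {k : WithTop ℕ∞} {f : Cn n → ℂ}
    (hf : ∀ z ∈ unitBall n, ContDiffAt ℝ k f z) {t : ℝ} (ht : t ∈ Set.Ioo (0 : ℝ) 1) :
    SmoothNearSph k fun z => f (√t • z) := fun η =>
  (hf _ (smul_sph_mem_ball ht η)).comp (η : Cn n) (contDiff_const_smul (√t)).contDiffAt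

/-! ### Differentiation of spherical integrals in the radius -/

/-- In the variable `t = |z|²` the Euler field is `2t d/dt`; this is the source of the operator
`eulerOp`. -/
lemma hasDerivAt_radial {u : Cn n → ℂ} {t : ℝ} (ht : 0 < t) (η : Cn n)
    (hu : DifferentiableAt ℝ u (√t • η)) :
    HasDerivAt (fun t => u (√t • η)) (1 / (2 * t) * opN u (√t • η)) t := by
  have h1 : HasDerivAt (fun t : ℝ => √t • η) ((1 / (2 * √t)) • η) t :=
    (Real.hasDerivAt_sqrt ht.ne').smul_const η
  refine (hu.hasFDerivAt.comp_hasDerivAt t h1).congr_deriv ?_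
  rw [opN_eq_lin, lin]
  simp only [ContinuousLinearMap.id_apply, map_smul]
  have hs : (√t : ℂ) * √t = t := by exact_mod_cast Real.mul_self_sqrt ht.le
  have hs0 : (√t : ℂ) ≠ 0 := by exact_mod_cast (Real.sqrt_pos.2 ht).ne'
  have ht0 : (t : ℂ) ≠ 0 := by exact_mod_cast ht.ne'
  simp only [Complex.real_smul]
  push_cast
  field_simp
  rw [← hs]; ring

lemma continuous_sph_dilate {u : Cn n → ℂ} (hu : ContinuousOn u (unitBall n)) {t : ℝ}
    (ht : t ∈ Set.Ioo (0 : ℝ) 1) : Continuous fun η : Sph n => u (√t • (η : Cn n)) :=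
  hu.comp_continuous (by fun_prop) fun η => smul_sph_mem_ball ht η

lemma norm_smul_sph (t : ℝ) (η : Sph n) : ‖√t • (η : Cn n)‖ = √t := by
  rw [norm_smul, norm_sph, mul_one, Real.norm_of_nonneg (Real.sqrt_nonneg _)]

lemma exists_bound_closedBall {u : Cn n → ℂ} (hu : ContinuousOn u (unitBall n)) {b : ℝ}
    (hb : b < 1) : ∃ C, 0 ≤ C ∧ ∀ t ≤ b, ∀ η : Sph n, ‖u (√t • (η : Cn n))‖ ≤ C := by
  have hb' : √b < 1 := by rw [Real.sqrt_lt' one_pos]; simpa using hb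
  obtain ⟨C, hC⟩ := (isCompact_closedBall (0 : Cn n) (√b)).exists_bound_of_continuousOn
    (hu.mono (Metric.closedBall_subset_ball hb'))
  exact ⟨max C 0, le_max_right _ _, fun t ht η => (hC _ (by
    rw [mem_closedBall_zero_iff, norm_smul_sph]; exact Real.sqrt_le_sqrt ht)).trans
      (le_max_left _ _)⟩

lemma hasDerivAt_sphInt {u : Cn n → ℂ} (hu : ∀ z ∈ unitBall n, ContDiffAt ℝ 1 u z)
    {v : Sph n → ℂ} (hv : Continuous v) {t : ℝ} (ht : t ∈ Set.Ioo (0 : ℝ) 1) :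
    HasDerivAt (fun t => ∫ η : Sph n, u (√t • (η : Cn n)) * v η ∂(sigma n))
      (1 / (2 * t) * ∫ η : Sph n, opN u (√t • (η : Cn n)) * v η ∂(sigma n)) t := by
  have hc : ContinuousOn u (unitBall n) := fun z hz => (hu z hz).continuousAt.continuousWithinAt
  have hNc : ContinuousOn (opN u) (unitBall n) := fun z hz =>
    (contDiffAt_opN (k := 0) (hu z hz) (by norm_num)).continuousAt.continuousWithinAt
  obtain ⟨b, htb, hb1⟩ := exists_between ht.2
  obtain ⟨a, ha0, hat⟩ := exists_between ht.1
  obtain ⟨C, hC0, hC⟩ := exists_bound_closedBall hNc hb1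
  obtain ⟨D, hD⟩ := (isCompact_univ (X := Sph n)).exists_bound_of_continuousOn hv.continuousOn
  have hD0 : ∀ η, ‖v η‖ ≤ max D 0 := fun η => (hD η (Set.mem_univ _)).trans (le_max_left _ _)
  have hsub : Set.Ioo a b ⊆ Set.Ioo 0 1 := Set.Ioo_subset_Ioo ha0.le hb1.le
  let G : ℝ → Sph n → ℂ := fun t η => u (√t • (η : Cn n)) * v η
  let G' : ℝ → Sph n → ℂ := fun t η => 1 / (2 * t) * opN u (√t • (η : Cn n)) * v η
  have hG : ∀ᶠ x in 𝓝 t, AEStronglyMeasurable (G x) (sigma n) := by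
    filter_upwards [isOpen_Ioo.mem_nhds ht] with t' ht'
    exact ((continuous_sph_dilate hc ht').mul hv).aestronglyMeasurable
  have hGi : Integrable (G t) (sigma n) := sph_integrable ((continuous_sph_dilate hc ht).mul hv)
  have hG' : AEStronglyMeasurable (G' t) (sigma n) :=
    ((continuous_const.mul (continuous_sph_dilate hNc ht)).mul hv).aestronglyMeasurable
  have hbound : ∀ η, ∀ t' ∈ Set.Ioo a b, ‖G' t' η‖ ≤ 1 / (2 * a) * C * max D 0 := by
    intro η t' ht'
    have h1 : ‖(1 / (2 * t') : ℂ)‖ ≤ 1 / (2 * a) := by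
      have : (1 / (2 * t') : ℂ) = ((1 / (2 * t') : ℝ) : ℂ) := by push_cast; rfl
      rw [this, Complex.norm_real, Real.norm_of_nonneg (by have := ha0.trans ht'.1; positivity)]
      have := ht'.1
      gcongr
    have h2 := hC t' ht'.2.le η
    have h3 := hD0 η
    calc ‖G' t' η‖ = ‖(1 / (2 * t') : ℂ)‖ * ‖opN u (√t' • (η : Cn n))‖ * ‖v η‖ := by
          simp only [G', norm_mul]
      _ ≤ _ := by gcongr
  have hderiv : ∀ η, ∀ t' ∈ Set.Ioo a b, HasDerivAt (fun t => G t η) (G' t' η) t' := by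
    intro η t' ht'
    have h1 : DifferentiableAt ℝ u (√t' • (η : Cn n)) :=
      (hu _ (smul_sph_mem_ball (hsub ht') η)).differentiableAt one_ne_zero
    have h2 := hasDerivAt_radial (hsub ht').1 (η : Cn n) h1
    exact h2.mul_const (v η)
  have key := (hasDerivAt_integral_of_dominated_loc_of_deriv_le (isOpen_Ioo.mem_nhds ⟨hat, htb⟩)
    hG hGi hG' (Filter.Eventually.of_forall hbound) (integrable_const _)
    (Filter.Eventually.of_forall hderiv)).2
  refine key.congr_deriv ?_
  rw [← integral_const_mul]
  exact integral_congr_ae (Filter.Eventually.of_forall fun η => mul_assoc _ _ _)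

/-! ### The radial equation -/

lemma opR_comm_opN {f : Cn n → ℂ} {z : Cn n} (hf : ContDiffAt ℝ 2 f z) :
    opN (opR f) z = opR (opN f) z := by
  have h1 : opR f = fun w => -Complex.I * lin mulI f w := funext fun w => opR_eq_lin f w
  have h2 : opN f = lin (ContinuousLinearMap.id ℝ (Cn n)) f := funext fun w => opN_eq_lin f w
  rw [opN_eq_lin, opR_eq_lin, h1, h2, ← lin_comm_id hf]
  have hd : DifferentiableAt ℝ (lin mulI f) z :=
    ((hf.fderiv_right (m := 1) (by norm_num)).clm_apply
      mulI.contDiff.contDiffAt).differentiableAt one_ne_zero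
  change fderiv ℝ (fun w => -Complex.I * lin mulI f w) z z = _
  rw [fderiv_const_mul hd]
  rfl

/-- The Euler fields are `∑ z_j ∂_j = (N + R)/2` and `∑ z̄_j ∂̄_j = (N - R)/2`. Their product is
`rad2`, and `N`, `R` commute. -/
lemma four_rad2 {f : Cn n → ℂ} {z : Cn n} (hf : ContDiffAt ℝ 2 f z) :
    4 * rad2 f z = opN (opN f) z - opR (opR f) z := by
  have hN : DifferentiableAt ℝ (opN f) z :=
    (contDiffAt_opN (k := 1) hf (by norm_num)).differentiableAt one_ne_zero
  have hR : DifferentiableAt ℝ (opR f) z :=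
    (contDiffAt_opX (k := 1) hf (by norm_num) none).differentiableAt one_ne_zero
  have h1 : (fun w : Cn n => ∑ k, conj (w k) * dzbar k f w) =
      fun w => (1 / 2 : ℂ) * (opN f w - opR f w) := by
    ext w
    simp only [opN, opR, ← Finset.sum_sub_distrib]
    rw [Finset.mul_sum]
    exact Finset.sum_congr rfl fun k _ => by ring
  have h2 : ∀ j, dz j (fun w => (1 / 2 : ℂ) * (opN f w - opR f w)) z =
      1 / 2 * (dz j (opN f) z - dz j (opR f) z) := fun j => by
    have := wd_const_mul (i := Sum.inl j) (1 / 2 : ℂ) (hN.sub hR)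
    have h := wd_sub (i := Sum.inl j) hN hR
    rw [wd_inl] at this h
    rw [← h]; exact this
  have h3 : ∀ g : Cn n → ℂ, ∑ j, z j * dz j g z = 1 / 2 * (opN g z + opR g z) := fun g => by
    simp only [opN, opR, ← Finset.sum_add_distrib]
    rw [Finset.mul_sum]
    exact Finset.sum_congr rfl fun k _ => by ring
  rw [rad2_eq hf, h1]
  simp only [h2]
  have h4 : ∑ j, z j * (1 / 2 * (dz j (opN f) z - dz j (opR f) z)) =
      1 / 2 * (∑ j, z j * dz j (opN f) z - ∑ j, z j * dz j (opR f) z) := by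
    rw [← Finset.sum_sub_distrib, Finset.mul_sum]
    exact Finset.sum_congr rfl fun k _ => by ring
  rw [h4, h3, h3, opR_comm_opN hf]
  ring

/-- The ordinary differential equation satisfied by the spherical coefficients of a solution of
`∑ (δ_{jk} - κ z_j z̄_k) ∂_j ∂̄_k f = 0`. -/
lemma sphInt_ode {f : Cn n → ℂ} (hf : ∀ z ∈ unitBall n, ContDiffAt ℝ 2 f z) (κ : ℂ)
    (hpde : ∀ z ∈ unitBall n, lap f z = κ * rad2 f z) {e : ℤ × ℤ} {F : Cn n → ℂ} (hF : BH e F)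
    {t : ℝ} (ht : t ∈ Set.Ioo (0 : ℝ) 1) :
    (1 - κ * t) * ((∫ η : Sph n, opN (opN f) (√t • (η : Cn n)) * conj (F η) ∂(sigma n))
        - (e.1 - e.2) ^ 2 * ∫ η : Sph n, f (√t • (η : Cn n)) * conj (F η) ∂(sigma n))
      + 2 * (n - 1) * (∫ η : Sph n, opN f (√t • (η : Cn n)) * conj (F η) ∂(sigma n))
      - (4 * e.1 * e.2 + 2 * (n - 1) * (e.1 + e.2)) *
        ∫ η : Sph n, f (√t • (η : Cn n)) * conj (F η) ∂(sigma n) = 0 := by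
  have hft := smoothNearSph_dilate hf ht
  have hft1 : SmoothNearSph 1 fun z => f (√t • z) := fun η => (hft η).of_le (by norm_num)
  have hRt : SmoothNearSph 1 (opR fun z => f (√t • z)) := hft.opX (by norm_num) none
  have hFc : Continuous fun η : Sph n => conj (F η) :=
    (hF.smoothNearSph (k := 0) (by simp)).conj.continuous
  have i1 := integral_sum_opLbar_opL hft hF
  have i2 := integral_opR_mul_conj hft1 hF
  have i3 := integral_opR_mul_conj hRt hF
  rw [i2] at i3
  have hop : ∀ j k, opLbar j k (opL j k fun z => f (√t • z)) = fun z =>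
      opLbar j k (opL j k f) (√t • z) := fun j k => by
    have a := opX_dilate (some (Sum.inl (j, k))) f (√t)
    have b := opX_dilate (some (Sum.inr (j, k))) (opL j k f) (√t)
    simp only [opX] at a b
    rw [a, b]
  have hR1 : (opR fun z => f (√t • z)) = fun z => opR f (√t • z) := opX_dilate none f (√t)
  have hR2 : (opR fun z => opR f (√t • z)) = fun z => opR (opR f) (√t • z) :=
    opX_dilate none (opR f) (√t)
  simp only [hop] at i1
  rw [hR1] at i2 i3
  rw [hR2] at i3
  have cN : ContinuousOn (opN f) (unitBall n) := fun z hz =>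
    (contDiffAt_opN (k := 1) (hf z hz) (by norm_num)).continuousAt.continuousWithinAt
  have cNN : ContinuousOn (opN (opN f)) (unitBall n) := fun z hz =>
    (contDiffAt_opN (k := 0) (contDiffAt_opN (k := 1) (hf z hz) (by norm_num))
      (by norm_num)).continuousAt.continuousWithinAt
  have cR : ContinuousOn (opR f) (unitBall n) := fun z hz =>
    (contDiffAt_opX (k := 1) (hf z hz) (by norm_num) none).continuousAt.continuousWithinAt
  have cRR : ContinuousOn (opR (opR f)) (unitBall n) := fun z hz =>
    (contDiffAt_opX (k := 0) (contDiffAt_opX (k := 1) (hf z hz) (by norm_num) none)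
      (by norm_num) none).continuousAt.continuousWithinAt
  have hI : ∀ {u : Cn n → ℂ}, ContinuousOn u (unitBall n) →
      Integrable (fun η : Sph n => u (√t • (η : Cn n)) * conj (F η)) (sigma n) := fun hu =>
    sph_integrable ((continuous_sph_dilate hu ht).mul hFc)
  -- On `|z|² = t` the polar form and the equation for `f` give `∑ L̄ L f = -(n-1)(N + R) f - (1 -
  -- κt)/2 (N² - R²) f`. Paired with `F`, the left side and all occurrences of `R` become scalars,
  -- and only `N` survives.
  have hpt : ∀ η : Sph n, (∑ j, ∑ k, opLbar j k (opL j k f) (√t • (η : Cn n))) * conj (F η) =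
      -((n : ℂ) - 1) * (opN f (√t • (η : Cn n)) * conj (F η))
      + (-((n : ℂ) - 1) * (opR f (√t • (η : Cn n)) * conj (F η))
      + (-(1 - κ * t) / 2 * (opN (opN f) (√t • (η : Cn n)) * conj (F η))
      + (1 - κ * t) / 2 * (opR (opR f) (√t • (η : Cn n)) * conj (F η)))) := by
    intro η
    have hz := smul_sph_mem_ball ht η
    rw [sum_opLbar_opL (hf _ hz), hpde _ hz, nsq_eq, norm_smul_sph, Real.sq_sqrt ht.1.le]
    have h3 : ∑ j, (√t • (η : Cn n)) j * dz j f (√t • (η : Cn n)) =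
        1 / 2 * (opN f (√t • (η : Cn n)) + opR f (√t • (η : Cn n))) := by
      simp only [opN, opR, ← Finset.sum_add_distrib]
      rw [Finset.mul_sum]
      exact Finset.sum_congr rfl fun k _ => by ring
    rw [h3]
    linear_combination (-(1 - κ * t) / 2 * conj (F η)) * four_rad2 (hf _ hz)
  simp only [hpt] at i1
  have e4 := ((hI cRR).const_mul ((1 - κ * t) / 2))
  have e3 := ((hI cNN).const_mul (-(1 - κ * t) / 2))
  have e2 := ((hI cR).const_mul (-((n : ℂ) - 1)))
  have e1 := ((hI cN).const_mul (-((n : ℂ) - 1)))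
  have a1 := integral_add e1 (e2.add (e3.add e4))
  have a2 := integral_add e2 (e3.add e4)
  have a3 := integral_add e3 e4
  simp only [Pi.add_apply] at a1 a2 a3
  rw [a1, a2, a3, integral_const_mul, integral_const_mul, integral_const_mul,
    integral_const_mul, i2, i3] at i1
  linear_combination -2 * i1

/-! ### Uniqueness of bounded solutions of the radial equation -/

/-- Abel's identity: the Wronskian `φ g₁ - g ψ` times `(t / (1 - κt))^(n-1)` is constant. The weight
tends to zero at the origin because `n ≥ 2`, and the Wronskian stays bounded there, so both vanish
identically as a product and `φ / g` is constant. The functions `ψ`, `χ` and `g₁`, `g₂` stand for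
the iterates of `2t d/dt`. The value `κ = 1` is the M-harmonic case, `κ = 0` the Euclidean one. -/
lemma radial_ode_unique (hn : 2 ≤ n) {κ : ℝ} (hκ : κ = 0 ∨ κ = 1) {a b : ℂ}
    {φ ψ χ g g₁ g₂ : ℝ → ℂ}
    (hφ : ∀ t ∈ Set.Ioo (0 : ℝ) 1, HasDerivAt φ (1 / (2 * t) * ψ t) t)
    (hψ : ∀ t ∈ Set.Ioo (0 : ℝ) 1, HasDerivAt ψ (1 / (2 * t) * χ t) t)
    (hg : ∀ t ∈ Set.Ioo (0 : ℝ) 1, HasDerivAt g (1 / (2 * t) * g₁ t) t)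
    (hg₁ : ∀ t ∈ Set.Ioo (0 : ℝ) 1, HasDerivAt g₁ (1 / (2 * t) * g₂ t) t)
    (eφ : ∀ t ∈ Set.Ioo (0 : ℝ) 1, (1 - κ * t) * (χ t - a * φ t) + 2 * (n - 1) * ψ t
      - b * φ t = 0)
    (eg : ∀ t ∈ Set.Ioo (0 : ℝ) 1, (1 - κ * t) * (g₂ t - a * g t) + 2 * (n - 1) * g₁ t
      - b * g t = 0)
    (hg0 : ∀ t ∈ Set.Ioo (0 : ℝ) 1, g t ≠ 0)
    (hbd : ∃ M, ∀ t ∈ Set.Ioo (0 : ℝ) (1 / 2), ‖φ t‖ ≤ M ∧ ‖ψ t‖ ≤ M ∧ ‖g t‖ ≤ M ∧ ‖g₁ t‖ ≤ M) :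
    ∃ c : ℂ, ∀ t ∈ Set.Ioo (0 : ℝ) 1, φ t = c * g t := by
  have hκt : ∀ t ∈ Set.Ioo (0 : ℝ) 1, 0 < 1 - κ * t := by
    rintro t ⟨h1, h2⟩; rcases hκ with rfl | rfl <;> linarith
  let W : ℝ → ℂ := fun t => φ t * g₁ t - g t * ψ t
  let w : ℝ → ℂ := fun t => ((t / (1 - κ * t) : ℝ) : ℂ) ^ (n - 1)
  have hW : ∀ t ∈ Set.Ioo (0 : ℝ) 1, HasDerivAt W (1 / (2 * t) * (φ t * g₂ t - g t * χ t)) t := by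
    intro t ht
    refine (((hφ t ht).mul (hg₁ t ht)).sub ((hg t ht).mul (hψ t ht))).congr_deriv ?_
    ring
  have hw : ∀ t ∈ Set.Ioo (0 : ℝ) 1,
      HasDerivAt w ((n - 1) * w t / (t * (1 - κ * t))) t := by
    intro t ht
    have hpos := (hκt t ht).ne'
    have ht0 := ht.1.ne'
    have h1 : HasDerivAt (fun t : ℝ => t / (1 - κ * t)) (1 / (1 - κ * t) ^ 2) t := by
      have := (hasDerivAt_id t).div (((hasDerivAt_id t).const_mul κ).const_sub 1) hpos
      refine this.congr_deriv ?_
      simp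
      ring
    have h2 := (h1.ofReal_comp).pow (n - 1)
    refine h2.congr_deriv ?_
    obtain ⟨k, rfl⟩ : ∃ k, n = k + 2 := ⟨n - 2, by omega⟩
    have c1 : ((1 : ℂ) - κ * t) ≠ 0 := by exact_mod_cast hpos
    have c2 : (t : ℂ) ≠ 0 := by exact_mod_cast ht0
    simp only [w, show k + 2 - 1 = k + 1 by omega, Nat.add_sub_cancel]
    push_cast
    generalize (1 : ℂ) - κ * t = x at c1
    generalize (t : ℂ) = y at c2
    simp only [div_pow]
    field_simp
    ring
  have hzero : ∀ t ∈ Set.Ioo (0 : ℝ) 1, HasDerivAt (fun t => w t * W t) 0 t := by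
    intro t ht
    refine ((hw t ht).mul (hW t ht)).congr_deriv ?_
    have c1 : ((1 : ℂ) - κ * t) ≠ 0 := by exact_mod_cast (hκt t ht).ne'
    have c2 : (t : ℂ) ≠ 0 := by exact_mod_cast ht.1.ne'
    have e1 := eφ t ht
    have e2 := eg t ht
    simp only [W]
    generalize w t = y
    rw [show (↑n - 1) * y / (↑t * (1 - ↑κ * ↑t)) * (φ t * g₁ t - g t * ψ t) +
        y * (1 / (2 * ↑t) * (φ t * g₂ t - g t * χ t)) = y / (2 * t * (1 - κ * t)) *
        (2 * (n - 1) * (φ t * g₁ t - g t * ψ t) + (1 - κ * t) * (φ t * g₂ t - g t * χ t)) by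
      generalize (1 : ℂ) - κ * t = x at c1
      field_simp]
    refine mul_eq_zero_of_right _ ?_
    linear_combination φ t * e2 - g t * e1
  have hdiff : DifferentiableOn ℝ (fun t => w t * W t) (Set.Ioo 0 1) := fun t ht =>
    (hzero t ht).differentiableAt.differentiableWithinAt
  have hconst : ∀ t ∈ Set.Ioo (0 : ℝ) 1, ∀ t' ∈ Set.Ioo (0 : ℝ) 1, w t * W t = w t' * W t' :=
    fun t ht t' ht' => isOpen_Ioo.is_const_of_deriv_eq_zero isPreconnected_Ioo hdiff
      (fun x hx => (hzero x hx).deriv) ht ht'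
  obtain ⟨M, hM⟩ := hbd
  -- For `t < 1/2` the base of the weight is at most `2t < 1`, and its exponent `n - 1` is at least
  -- one.
  have hsmall : ∀ t ∈ Set.Ioo (0 : ℝ) (1 / 2), ‖w t * W t‖ ≤ 2 * t * (2 * M ^ 2) := by
    intro t ht
    obtain ⟨m1, m2, m3, m4⟩ := hM t ht
    have ht1 : t ∈ Set.Ioo (0 : ℝ) 1 := ⟨ht.1, by linarith [ht.2]⟩
    have hM0 : 0 ≤ M := (norm_nonneg _).trans m1
    have hκ2 : (1 / 2 : ℝ) ≤ 1 - κ * t := by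
      have := ht.1; have := ht.2
      rcases hκ with rfl | rfl <;> linarith
    have h0 : 0 ≤ t / (1 - κ * t) := div_nonneg ht.1.le (hκt t ht1).le
    have h2t : t / (1 - κ * t) ≤ 2 * t := by
      rw [div_le_iff₀ (hκt t ht1)]; nlinarith [ht.1]
    have hw1 : ‖w t‖ ≤ 2 * t := by
      simp only [w, norm_pow, Complex.norm_real, Real.norm_of_nonneg h0]
      calc (t / (1 - κ * t)) ^ (n - 1) ≤ (2 * t) ^ (n - 1) := by gcongr
        _ ≤ (2 * t) ^ 1 := pow_le_pow_of_le_one (by linarith [ht.1]) (by linarith [ht.2]) (by omega)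
        _ = 2 * t := pow_one _
    have hW1 : ‖W t‖ ≤ 2 * M ^ 2 := by
      calc ‖W t‖ ≤ ‖φ t * g₁ t‖ + ‖g t * ψ t‖ := norm_sub_le _ _
        _ ≤ M * M + M * M := by rw [norm_mul, norm_mul]; gcongr
        _ = 2 * M ^ 2 := by ring
    rw [norm_mul]
    have := ht.1
    gcongr
  have hwW : ∀ t ∈ Set.Ioo (0 : ℝ) 1, w t * W t = 0 := by
    intro t ht
    by_contra hne
    have hpos : 0 < ‖w t * W t‖ := norm_pos_iff.2 hne
    set c := ‖w t * W t‖
    have hD : 0 < 4 * M ^ 2 + 1 := by positivity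
    -- Chosen so that `4 M² t' ≤ c / 2`, which contradicts the bound `c ≤ 4 M² t'` coming from
    -- constancy.
    let t' := min (1 / 4) (c / (2 * (4 * M ^ 2 + 1)))
    have ht'0 : 0 < t' := lt_min (by norm_num) (by positivity)
    have ht'1 : t' ≤ 1 / 4 := min_le_left _ _
    have h1 := hsmall t' ⟨ht'0, by linarith⟩
    rw [← hconst t ht t' ⟨ht'0, by linarith⟩] at h1
    have h2 : t' ≤ c / (2 * (4 * M ^ 2 + 1)) := min_le_right _ _
    rw [le_div_iff₀ (by positivity)] at h2
    change c ≤ _ at h1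
    nlinarith
  have hW0 : ∀ t ∈ Set.Ioo (0 : ℝ) 1, W t = 0 := by
    intro t ht
    refine (mul_eq_zero.1 (hwW t ht)).resolve_left ?_
    refine pow_ne_zero _ ?_
    exact_mod_cast (div_pos ht.1 (hκt t ht)).ne'
  have hq : ∀ t ∈ Set.Ioo (0 : ℝ) 1, HasDerivAt (fun t => φ t / g t) 0 t := by
    intro t ht
    refine ((hφ t ht).div (hg t ht) (hg0 t ht)).congr_deriv ?_
    have c2 : (t : ℂ) ≠ 0 := by exact_mod_cast ht.1.ne'
    have := hW0 t ht
    simp only [W] at this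
    have h0 := hg0 t ht
    rw [div_eq_zero_iff]
    left
    linear_combination -(1 / (2 * (t : ℂ))) * this
  refine ⟨φ (1 / 2) / g (1 / 2), fun t ht => ?_⟩
  have hh : (1 / 2 : ℝ) ∈ Set.Ioo (0 : ℝ) 1 := by norm_num
  have := isOpen_Ioo.is_const_of_deriv_eq_zero isPreconnected_Ioo
    (fun x hx => (hq x hx).differentiableAt.differentiableWithinAt)
    (fun x hx => (hq x hx).deriv) ht hh
  rw [← this, div_mul_cancel₀ _ (hg0 t ht)]

lemma sphInt_eq_const_mul (hn : 2 ≤ n) {f : Cn n → ℂ}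
    (hf : ∀ z ∈ unitBall n, ContDiffAt ℝ 2 f z) {κ : ℝ} (hκ : κ = 0 ∨ κ = 1)
    (hpde : ∀ z ∈ unitBall n, lap f z = κ * rad2 f z) {e : ℤ × ℤ} {F : Cn n → ℂ} (hF : BH e F)
    {g g₁ g₂ : ℝ → ℂ}
    (hg : ∀ t ∈ Set.Ioo (0 : ℝ) 1, HasDerivAt g (1 / (2 * t) * g₁ t) t)
    (hg₁ : ∀ t ∈ Set.Ioo (0 : ℝ) 1, HasDerivAt g₁ (1 / (2 * t) * g₂ t) t)
    (eg : ∀ t ∈ Set.Ioo (0 : ℝ) 1, (1 - κ * t) * (g₂ t - (e.1 - e.2) ^ 2 * g t)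
      + 2 * (n - 1) * g₁ t - (4 * e.1 * e.2 + 2 * (n - 1) * (e.1 + e.2)) * g t = 0)
    (hg0 : ∀ t ∈ Set.Ioo (0 : ℝ) 1, g t ≠ 0)
    (hbd : ∃ M, ∀ t ∈ Set.Ioo (0 : ℝ) (1 / 2), ‖g t‖ ≤ M ∧ ‖g₁ t‖ ≤ M) :
    ∃ c : ℂ, ∀ t ∈ Set.Ioo (0 : ℝ) 1,
      ∫ η : Sph n, f (√t • (η : Cn n)) * conj (F η) ∂(sigma n) = c * g t := by
  have hFc : Continuous fun η : Sph n => conj (F η) :=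
    (hF.smoothNearSph (k := 0) (by simp)).conj.continuous
  have hf1 : ∀ z ∈ unitBall n, ContDiffAt ℝ 1 f z := fun z hz => (hf z hz).of_le (by norm_num)
  have hN1 : ∀ z ∈ unitBall n, ContDiffAt ℝ 1 (opN f) z := fun z hz =>
    contDiffAt_opN (hf z hz) (by norm_num)
  have bound : ∀ {u : Cn n → ℂ}, (∀ z ∈ unitBall n, ContDiffAt ℝ 1 u z) →
      ∃ M, ∀ t ∈ Set.Ioo (0 : ℝ) (1 / 2),
        ‖∫ η : Sph n, u (√t • (η : Cn n)) * conj (F η) ∂(sigma n)‖ ≤ M := by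
    intro u hu
    obtain ⟨C, hC0, hC⟩ := exists_bound_closedBall (b := 1 / 2)
      (fun z hz => (hu z hz).continuousAt.continuousWithinAt) (by norm_num)
    obtain ⟨D, hD⟩ := (isCompact_univ (X := Sph n)).exists_bound_of_continuousOn hFc.continuousOn
    refine ⟨C * D * (sigma n).real Set.univ, fun t ht => ?_⟩
    refine norm_integral_le_of_norm_le_const (Filter.Eventually.of_forall fun η => ?_)
    rw [norm_mul]
    have := hC t ht.2.le η
    have := hD η (Set.mem_univ _)
    gcongr
  obtain ⟨M₁, hM₁⟩ := bound hf1
  obtain ⟨M₂, hM₂⟩ := bound hN1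
  obtain ⟨M₃, hM₃⟩ := hbd
  refine radial_ode_unique hn hκ (fun t ht => hasDerivAt_sphInt hf1 hFc ht)
    (fun t ht => hasDerivAt_sphInt hN1 hFc ht) hg hg₁
    (fun t ht => sphInt_ode hf κ hpde hF ht) eg hg0
    ⟨max (max M₁ M₂) M₃, fun t ht => ⟨?_, ?_, ?_, ?_⟩⟩
  · exact (hM₁ t ht).trans ((le_max_left _ _).trans (le_max_left _ _))
  · exact (hM₂ t ht).trans ((le_max_right _ _).trans (le_max_left _ _))
  · exact (hM₃ t ht).1.trans (le_max_right _ _)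
  · exact (hM₃ t ht).2.trans (le_max_right _ _)

/-! ### Spherical coefficients of M-harmonic functions and the mean value property -/

lemma IsMHarmonic.contDiffAt {f : Cn n → ℂ} (hf : IsMHarmonic f) {z : Cn n}
    (hz : z ∈ unitBall n) : ContDiffAt ℝ 2 f z :=
  hf.1.contDiffAt (Metric.isOpen_ball.mem_nhds hz)

lemma IsMHarmonic.lap_eq {f : Cn n → ℂ} (hf : IsMHarmonic f) {z : Cn n}
    (hz : z ∈ unitBall n) : lap f z = rad2 f z := by
  have h := hf.2 z hz
  have hz1 : ‖z‖ < 1 := by simpa using hz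
  have h0 : (4 * (1 - (‖z‖ : ℂ) ^ 2)) ≠ 0 := by
    have : (4 * (1 - ‖z‖ ^ 2) : ℝ) ≠ 0 := by nlinarith [norm_nonneg z]
    exact_mod_cast this
  have h1 := (mul_eq_zero.1 h).resolve_left h0
  simp only [sub_mul, Finset.sum_sub_distrib, ite_mul, one_mul, zero_mul, Finset.sum_ite_eq,
    Finset.mem_univ, if_true] at h1
  exact sub_eq_zero.1 h1

lemma hasDerivAt_of_eulerOp {g : ℝ → ℝ} {t : ℝ} (ht : 0 < t) (hg : DifferentiableAt ℝ g t) :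
    HasDerivAt (fun t => (g t : ℂ)) (1 / (2 * t) * (eulerOp g t : ℂ)) t := by
  refine hg.hasDerivAt.ofReal_comp.congr_deriv ?_
  have : (t : ℂ) ≠ 0 := by exact_mod_cast ht.ne'
  rw [eulerOp]; push_cast; field_simp

lemma differentiableAt_gfun (hn : 1 ≤ n) (p q : ℕ) {t : ℝ} (ht : t ∈ Set.Ioo (0 : ℝ) 1) :
    DifferentiableAt ℝ (gfun n p q) t :=
  ((Real.hasDerivAt_rpow_const (Or.inl ht.1.ne')).differentiableAt).mul
    (gfun_differentiable_aux hn p q ht).1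

lemma differentiableAt_eulerOp_gfun (hn : 1 ≤ n) (p q : ℕ) {t : ℝ} (ht : t ∈ Set.Ioo (0 : ℝ) 1) :
    DifferentiableAt ℝ (eulerOp (gfun n p q)) t := by
  obtain ⟨h1, h2⟩ := gfun_differentiable_aux hn p q ht
  have h3 : DifferentiableAt ℝ (fun t => t ^ (((p : ℝ) + q) / 2) *
      ((p + q) * S n p q t + 2 * (t * deriv (S n p q) t))) t :=
    ((Real.hasDerivAt_rpow_const (Or.inl ht.1.ne')).differentiableAt).mul
      ((h1.const_mul _).add (h2.const_mul _))
  refine h3.congr_of_eventuallyEq ?_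
  filter_upwards [isOpen_Ioo.mem_nhds ht] with u hu using eulerOp_gfun hn p q hu

/-- The spherical coefficients of an M-harmonic function. -/
lemma IsMHarmonic.sphInt_eq (hn : 2 ≤ n) {f : Cn n → ℂ} (hf : IsMHarmonic f) {p q : ℕ}
    {F : Cn n → ℂ} (hF : BH (p, q) F) :
    ∃ c : ℂ, ∀ t ∈ Set.Ioo (0 : ℝ) 1,
      ∫ η : Sph n, f (√t • (η : Cn n)) * conj (F η) ∂(sigma n) = c * gfun n p q t := by
  have hn1 : 1 ≤ n := by omega
  have hS := nonnegSeries_S hn1 p q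
  refine sphInt_eq_const_mul hn (fun z hz => hf.contDiffAt hz) (Or.inr rfl)
    (fun z hz => by rw [hf.lap_eq hz]; simp) hF
    (fun t ht => hasDerivAt_of_eulerOp ht.1 (differentiableAt_gfun hn1 p q ht))
    (fun t ht => hasDerivAt_of_eulerOp ht.1 (differentiableAt_eulerOp_gfun hn1 p q ht))
    (fun t ht => ?_) (fun t ht => ?_) ⟨max (S n p q (1 / 2))
      ((p + q) * S n p q (1 / 2) + 2 * (1 * deriv (S n p q) (1 / 2))), fun t ht => ?_⟩
  · have := gfun_ode hn1 p q ht
    have h2 := congrArg ((↑) : ℝ → ℂ) this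
    push_cast at h2 ⊢
    linear_combination h2
  · exact_mod_cast (gfun_pos hn1 p q ht).ne'
  · have ht1 : t ∈ Set.Ioo (0 : ℝ) 1 := ⟨ht.1, by linarith [ht.2]⟩
    have hr : t ^ (((p : ℝ) + q) / 2) ≤ 1 := Real.rpow_le_one ht1.1.le ht1.2.le (by positivity)
    have hr0 : 0 ≤ t ^ (((p : ℝ) + q) / 2) := Real.rpow_nonneg ht1.1.le _
    have s1 := hS.mono ht1.1.le ht.2.le (by norm_num)
    have s2 := hS.deriv.mono ht1.1.le ht.2.le (by norm_num)
    have s3 := hS.eval_nonneg ht1.1.le ht1.2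
    have s4 := hS.deriv.eval_nonneg ht1.1.le ht1.2
    have := ht1.1.le
    have ht2 := ht1.2.le
    have hE : 0 ≤ eulerOp (gfun n p q) t := by rw [eulerOp_gfun hn1 p q ht1]; positivity
    rw [Complex.norm_real, Complex.norm_real, Real.norm_of_nonneg (gfun_pos hn1 p q ht1).le,
      Real.norm_of_nonneg hE]
    constructor
    · refine le_trans ?_ (le_max_left _ _)
      calc gfun n p q t ≤ 1 * S n p q t := mul_le_mul_of_nonneg_right hr s3
        _ ≤ _ := by linarith
    · refine le_trans ?_ (le_max_right _ _)
      rw [eulerOp_gfun hn1 p q ht1]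
      calc t ^ (((p : ℝ) + q) / 2) * ((p + q) * S n p q t + 2 * (t * deriv (S n p q) t)) ≤
          1 * ((p + q) * S n p q t + 2 * (t * deriv (S n p q) t)) :=
            mul_le_mul_of_nonneg_right hr (by positivity)
        _ = (p + q) * S n p q t + 2 * (t * deriv (S n p q) t) := one_mul _
        _ ≤ _ := by gcongr

/-- The mean value property is the case `κ = 0` and bidegree zero of the radial equation, with the
constant `1` as the reference solution. The value of the constant is found by letting the radius
tend to zero along `t = 1 / (k + 2)`. -/
lemma sphInt_harmonic (hn : 2 ≤ n) {G : Cn n → ℂ} (hG : ∀ z ∈ unitBall n, ContDiffAt ℝ 2 G z)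
    (hlap : ∀ z ∈ unitBall n, lap G z = 0) {t : ℝ} (ht : t ∈ Set.Ioo (0 : ℝ) 1) :
    ∫ η : Sph n, G (√t • (η : Cn n)) ∂(sigma n) = G 0 := by
  have hn1 : 1 ≤ n := by omega
  have : IsProbabilityMeasure (sigma n) := ⟨sigma_univ hn1⟩
  obtain ⟨c, hc⟩ := sphInt_eq_const_mul hn hG (Or.inl rfl) (by simpa using hlap)
    (BH.one (n := n)) (g := fun _ => 1) (g₁ := fun _ => 0) (g₂ := fun _ => 0)
    (fun t _ => by simpa using hasDerivAt_const t (1 : ℂ))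
    (fun t _ => by simpa using hasDerivAt_const t (0 : ℂ)) (fun t _ => by simp) (by simp)
    ⟨1, by simp⟩
  simp only [map_one, mul_one] at hc
  have hlim : Filter.Tendsto (fun k : ℕ => ∫ η : Sph n,
      G (√(1 / ((k : ℝ) + 2)) • (η : Cn n)) ∂(sigma n)) Filter.atTop (𝓝 (G 0)) := by
    have hGc : ContinuousOn G (unitBall n) := fun z hz =>
      (hG z hz).continuousAt.continuousWithinAt
    have hmem : ∀ k : ℕ, 1 / ((k : ℝ) + 2) ∈ Set.Ioo (0 : ℝ) 1 := fun k =>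
      ⟨by positivity, by rw [div_lt_one (by positivity)]; linarith [(Nat.cast_nonneg k : (0:ℝ) ≤ k)]⟩
    obtain ⟨C, hC0, hC⟩ := exists_bound_closedBall (b := 1 / 2) hGc (by norm_num)
    have key := tendsto_integral_of_dominated_convergence (μ := sigma n)
      (F := fun (k : ℕ) (η : Sph n) => G (√(1 / ((k : ℝ) + 2)) • (η : Cn n)))
      (f := fun _ => G 0) (fun _ => C)
      (fun k => (continuous_sph_dilate hGc (hmem k)).aestronglyMeasurable)
      (integrable_const _)
      (fun k => Filter.Eventually.of_forall fun η => hC _ (by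
        gcongr; linarith [(Nat.cast_nonneg k : (0:ℝ) ≤ k)]) η)
      (Filter.Eventually.of_forall fun η => by
        have h0 : ContinuousAt G ((0 : ℝ) • (η : Cn n)) := by
          rw [zero_smul]; exact (hG 0 (by simp)).continuousAt
        have h1 : Filter.Tendsto (fun k : ℕ => √(1 / ((k : ℝ) + 2))) Filter.atTop (𝓝 0) := by
          have := (Real.continuous_sqrt.tendsto 0).comp
            ((tendsto_one_div_add_atTop_nhds_zero_nat (𝕜 := ℝ)).comp (Filter.tendsto_add_atTop_nat 1))
          rw [Real.sqrt_zero] at this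
          refine this.congr fun k => ?_
          simp only [Function.comp]
          push_cast
          ring_nf
        have h2 := h0.tendsto.comp (h1.smul_const (η : Cn n))
        rwa [zero_smul] at h2)
    simpa using key
  have hconst : (fun k : ℕ => ∫ η : Sph n,
      G (√(1 / ((k : ℝ) + 2)) • (η : Cn n)) ∂(sigma n)) = fun _ => c := by
    ext k
    exact hc _ ⟨by positivity, by
      rw [div_lt_one (by positivity)]; linarith [(Nat.cast_nonneg k : (0:ℝ) ≤ k)]⟩
  rw [hconst] at hlim
  rw [hc t ht, tendsto_nhds_unique hlim tendsto_const_nhds]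

/-! ### The Cauchy-Schwarz inequality on the sphere -/

lemma norm_integral_mul_conj_sq_le {u v : Sph n → ℂ} (hu : Continuous u) (hv : Continuous v) :
    ‖∫ η, u η * conj (v η) ∂(sigma n)‖ ^ 2
      ≤ (∫ η, ‖u η‖ ^ 2 ∂(sigma n)) * ∫ η, ‖v η‖ ^ 2 ∂(sigma n) := by
  let U := ContinuousMap.toLp (E := ℂ) 2 (sigma n) ℂ ⟨u, hu⟩
  let V := ContinuousMap.toLp (E := ℂ) 2 (sigma n) ℂ ⟨v, hv⟩
  have e1 : inner ℂ V U = ∫ η, u η * conj (v η) ∂(sigma n) :=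
    ContinuousMap.inner_toLp (sigma n) ⟨v, hv⟩ ⟨u, hu⟩
  have e2 : ∀ {w : Sph n → ℂ} (hw : Continuous w),
      ‖ContinuousMap.toLp (E := ℂ) 2 (sigma n) ℂ ⟨w, hw⟩‖ ^ 2 = ∫ η, ‖w η‖ ^ 2 ∂(sigma n) := by
    intro w hw
    have h := ContinuousMap.inner_toLp (𝕜 := ℂ) (sigma n) ⟨w, hw⟩ ⟨w, hw⟩
    rw [inner_self_eq_norm_sq_to_K] at h
    have h2 : (∫ η, w η * conj (w η) ∂(sigma n)) = ((∫ η, ‖w η‖ ^ 2 ∂(sigma n) : ℝ) : ℂ) := by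
      rw [← integral_complex_ofReal]
      refine integral_congr_ae (Filter.Eventually.of_forall fun η => ?_)
      simp [Complex.mul_conj, Complex.normSq_eq_norm_sq]
    refine Complex.ofReal_injective ?_
    rw [Complex.ofReal_pow]
    exact h.trans h2
  rw [← e1, ← e2 hu, ← e2 hv, mul_comm (‖_‖ ^ 2), ← mul_pow]
  gcongr
  exact norm_inner_le_norm V U

/-! ### Sup bounds for bigraded harmonics -/

lemma lintegral_ball_comp_affine {h : Cn n → ℝ≥0∞} (hh : Measurable h) (a : Cn n) {R : ℝ}
    (hR : 0 < R) :
    ∫⁻ z in unitBall n, h (a + R • z) =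
      ENNReal.ofReal ((R ^ (2 * n))⁻¹) * ∫⁻ z in Metric.ball a R, h z := by
  have hm : Measurable ((Metric.ball a R).indicator h) := hh.indicator Metric.isOpen_ball.measurableSet
  have e1 : ∀ z, (unitBall n).indicator (fun z => h (a + R • z)) z =
      (Metric.ball a R).indicator h (a + R • z) := by
    intro z
    have : a + R • z ∈ Metric.ball a R ↔ z ∈ unitBall n := by
      rw [mem_ball_iff_norm, add_sub_cancel_left, norm_smul, Real.norm_of_nonneg hR.le,
        mem_ball_zero_iff]
      constructor
      · intro h; nlinarith
      · intro h; nlinarith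
    by_cases hz : z ∈ unitBall n
    · rw [Set.indicator_of_mem hz, Set.indicator_of_mem (this.2 hz)]
    · rw [Set.indicator_of_notMem hz, Set.indicator_of_notMem (fun h => hz (this.1 h))]
  rw [← lintegral_indicator Metric.isOpen_ball.measurableSet,
    ← lintegral_indicator Metric.isOpen_ball.measurableSet]
  simp only [e1]
  have e2 := lintegral_map (μ := (volume : Measure (Cn n)))
    (f := fun w => (Metric.ball a R).indicator h (a + w))
    (hm.comp (measurable_const_add a)) (measurable_const_smul R)
  rw [← e2, Measure.map_addHaar_smul volume hR.ne', finrank_Cn, lintegral_smul_measure,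
    abs_of_pos (by positivity), smul_eq_mul,
    lintegral_add_left_eq_self (fun w => (Metric.ball a R).indicator h w)]

lemma sqNorm_zero_eq (u : Cn n → ℂ) :
    sqNorm 0 u = ENNReal.ofReal ((ascPochhammer ℝ n).eval (0 + 1) / Real.pi ^ n) *
      ∫⁻ z in unitBall n, ‖u z‖ₑ ^ 2 := by
  simp only [sqNorm, mu, Real.rpow_zero, mul_one]
  rw [withDensity_const, lintegral_smul_measure, smul_eq_mul]

lemma sqNorm_zero_one_ne_zero : sqNorm 0 (fun _ : Cn n => (1 : ℂ)) ≠ 0 := by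
  rw [sqNorm_zero_eq]
  refine mul_ne_zero ?_ ?_
  · simpa using density_const_pos (n := n) (s := 0) (by norm_num)
  · simpa using (Metric.measure_ball_pos volume (0 : Cn n) one_pos).ne'

lemma sqNorm_zero_one_ne_top : sqNorm 0 (fun _ : Cn n => (1 : ℂ)) ≠ ⊤ := by
  rw [sqNorm_zero_eq]
  refine ENNReal.mul_ne_top ENNReal.ofReal_ne_top ?_
  simpa using measure_ball_lt_top.ne

lemma wd_affine (i : Fin n ⊕ Fin n) (F : Cn n → ℂ) (a : Cn n) (R : ℝ) :
    wd i (fun w => F (a + R • w)) = fun w => (R : ℂ) * wd i F (a + R • w) := by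
  ext w
  have h1 : fderiv ℝ (fun w => F (a + R • w)) w = R • fderiv ℝ F (a + R • w) := by
    have := fderiv_comp_smul (𝕜 := ℝ) (f := fun w => F (a + w)) (x := w) R
    rw [this, fderiv_comp_add_left]
  rw [wd_eq, wd_eq, h1, map_smul, Complex.real_smul]

lemma lap_affine {F : Cn n → ℂ} (hF : ContDiff ℝ ∞ F) (a : Cn n) (R : ℝ) (w : Cn n) :
    lap (fun w => F (a + R • w)) w = (R : ℂ) ^ 2 * lap F (a + R • w) := by
  simp only [lap, Finset.mul_sum]
  refine Finset.sum_congr rfl fun j _ => ?_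
  have h1 := wd_affine (Sum.inr j) F a R
  have h2 := wd_affine (Sum.inl j) (wd (Sum.inr j) F) a R
  have h3 : DifferentiableAt ℝ (fun w => wd (Sum.inr j) F (a + R • w)) w :=
    (((contDiff_wd hF (Sum.inr j)).comp (by fun_prop : ContDiff ℝ ∞ fun w : Cn n => a + R • w)).differentiable
      (by simp)).differentiableAt
  have h4 := wd_const_mul (i := Sum.inl j) (R : ℂ) h3
  rw [← h1, h2] at h4
  simp only [wd_inl, wd_inr] at h4
  rw [h4]; ring

/-- By the mean value property and Cauchy-Schwarz, `|F z|²` is at most the mean of `|F|²` over the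
ball of radius `ε` about `z`. This ball lies in the ball of radius `‖z‖ + ε` about the origin, where
homogeneity evaluates the scaling. The growth in the degree is exactly `(‖z‖ + ε)^(2(p+q))`, since
the other factor does not involve `p` and `q`. -/
lemma BH.norm_sq_le (hn : 2 ≤ n) {p q : ℕ} {F : Cn n → ℂ} (hF : BH (p, q) F) (z : Cn n) {ε : ℝ}
    (hε : 0 < ε) :
    ‖F z‖ ^ 2 ≤ ((‖z‖ + ε) / ε) ^ (2 * n) * (‖z‖ + ε) ^ (2 * (p + q)) * nrm2 F := by
  have hn1 : 1 ≤ n := by omega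
  have : IsProbabilityMeasure (sigma n) := ⟨sigma_univ hn1⟩
  set R := ‖z‖ + ε with hRdef
  have hR : 0 < R := by positivity
  have hFc : Continuous F := hF.contDiff.continuous
  let G : Cn n → ℂ := fun w => F (z + ε • w)
  have hGs : ContDiff ℝ ∞ G := hF.contDiff.comp (by fun_prop)
  have hGc : Continuous G := hGs.continuous
  have hmean : ∀ t ∈ Set.Ioo (0 : ℝ) 1, ‖F z‖ₑ ^ 2 ≤ sphereSqNorm fun w => G (√t • w) := by
    intro t ht
    have h1 := sphInt_harmonic hn (G := G)
      (fun w _ => hGs.contDiffAt.of_le two_le_smooth) (fun w _ => by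
        rw [lap_affine hF.contDiff, hF.2, mul_zero]) ht
    have hc : Continuous fun η : Sph n => G (√t • (η : Cn n)) := hGc.comp (by fun_prop)
    have h2 := norm_integral_mul_conj_sq_le hc (continuous_const (y := (1 : ℂ)))
    simp only [map_one, mul_one, norm_one, one_pow, integral_const, probReal_univ, smul_eq_mul] at h2
    rw [h1] at h2
    rw [sphereSqNorm_eq (F := fun w => G (√t • w)) hc, enorm_sq_eq]
    have h3 : G 0 = F z := by simp [G]
    rw [h3] at h2
    exact ENNReal.ofReal_le_ofReal h2
  have hle1 : ‖F z‖ₑ ^ 2 * sqNorm 0 (fun _ : Cn n => (1 : ℂ)) ≤ sqNorm 0 G := by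
    rw [sqNorm_polar hn1 (by norm_num) continuousOn_const,
      sqNorm_polar hn1 (by norm_num) hGc.continuousOn, mul_left_comm]
    refine mul_le_mul_right ?_ _
    rw [← lintegral_const_mul' _ _ (by simp [enorm_ne_top])]
    refine setLIntegral_mono' measurableSet_Ioo fun t ht => ?_
    have h1 := hmean t ht
    have h2 : sphereSqNorm (n := n) (fun _ => (1 : ℂ)) = 1 := by simp [sphereSqNorm]
    rw [h2, mul_one, mul_comm]
    exact mul_le_mul_right h1 _
  have hscale : ∀ {r : ℝ}, 0 ≤ r → ∀ w, ‖F (r • w)‖ₑ ^ 2 =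
      ENNReal.ofReal (r ^ (2 * (p + q))) * ‖F w‖ₑ ^ 2 := by
    intro r hr w
    rw [hF.1.real_smul_eq, enorm_sq_eq, enorm_sq_eq, ← ENNReal.ofReal_mul (by positivity)]
    congr 1
    rw [norm_mul, norm_pow, Complex.norm_real, Real.norm_of_nonneg hr]
    ring
  have hle2 : sqNorm 0 F ≤ ENNReal.ofReal (nrm2 F) * sqNorm 0 (fun _ : Cn n => (1 : ℂ)) := by
    rw [sqNorm_polar hn1 (by norm_num) continuousOn_const,
      sqNorm_polar hn1 (by norm_num) hFc.continuousOn, mul_left_comm]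
    refine mul_le_mul_right ?_ _
    rw [← lintegral_const_mul' _ _ ENNReal.ofReal_ne_top]
    refine setLIntegral_mono' measurableSet_Ioo fun t ht => ?_
    have h2 : sphereSqNorm (n := n) (fun _ => (1 : ℂ)) = 1 := by simp [sphereSqNorm]
    rw [h2, mul_one, mul_comm]
    refine mul_le_mul_left ?_ _
    rw [← sphereSqNorm_eq (hFc.comp continuous_subtype_val)]
    refine lintegral_mono fun η => ?_
    dsimp only
    rw [hscale (Real.sqrt_nonneg t)]
    refine mul_le_of_le_one_left' ?_
    rw [ENNReal.ofReal_le_one]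
    exact pow_le_one₀ (Real.sqrt_nonneg t) (Real.sqrt_le_one.2 ht.2.le)
  have hmF : Measurable fun w => ‖F w‖ₑ ^ 2 := (hFc.measurable.enorm).pow_const 2
  have hle3 : sqNorm 0 G ≤ ENNReal.ofReal ((ε ^ (2 * n))⁻¹) * (ENNReal.ofReal (R ^ (2 * n)) *
      (ENNReal.ofReal (R ^ (2 * (p + q))) * sqNorm 0 F)) := by
    rw [sqNorm_zero_eq, sqNorm_zero_eq]
    simp only [G]
    rw [lintegral_ball_comp_affine hmF z hε]
    have hsub : Metric.ball z ε ⊆ Metric.ball 0 R := by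
      refine Metric.ball_subset_ball' ?_
      rw [dist_zero_right, hRdef, add_comm]
    have hb := lintegral_ball_comp_affine hmF 0 hR
    simp only [zero_add, hscale hR.le] at hb
    rw [lintegral_const_mul' _ _ ENNReal.ofReal_ne_top] at hb
    have hb2 : ∫⁻ w in Metric.ball 0 R, ‖F w‖ₑ ^ 2 = ENNReal.ofReal (R ^ (2 * n)) *
        (ENNReal.ofReal (R ^ (2 * (p + q))) * ∫⁻ w in unitBall n, ‖F w‖ₑ ^ 2) := by
      rw [hb, ← mul_assoc, ← ENNReal.ofReal_mul (by positivity), mul_inv_cancel₀ (by positivity)]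
      simp
    have hb3 := (lintegral_mono_set (f := fun w => ‖F w‖ₑ ^ 2) (μ := volume) hsub).trans_eq hb2
    calc _ ≤ _ := mul_le_mul_right (mul_le_mul_right hb3 _) _
      _ = _ := by ring
  have hfin := hle1.trans (hle3.trans (mul_le_mul_right (mul_le_mul_right
    (mul_le_mul_right hle2 _) _) _))
  have hfin2 : ‖F z‖ₑ ^ 2 * sqNorm 0 (fun _ : Cn n => (1 : ℂ)) ≤ ENNReal.ofReal
      ((R / ε) ^ (2 * n) * R ^ (2 * (p + q)) * nrm2 F) * sqNorm 0 (fun _ : Cn n => (1 : ℂ)) := by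
    refine hfin.trans_eq ?_
    have := nrm2_nonneg F
    simp only [← mul_assoc]
    rw [← ENNReal.ofReal_mul (by positivity), ← ENNReal.ofReal_mul (by positivity),
      ← ENNReal.ofReal_mul (by positivity)]
    congr 2
    rw [div_pow]; ring
  have hfin3 := (ENNReal.mul_le_mul_iff_left sqNorm_zero_one_ne_zero sqNorm_zero_one_ne_top).1 hfin2
  rw [enorm_sq_eq] at hfin3
  have := nrm2_nonneg F
  exact (ENNReal.ofReal_le_ofReal_iff (by positivity)).1 hfin3

/-! ### Derivatives of bigraded harmonics -/

/-- Splits `|z|² ∂_j` into a tangential and a radial part. This identity and its conjugate recover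
all derivatives away from the origin. -/
lemma nsq_mul_dz (j : Fin n) (f : Cn n → ℂ) (z : Cn n) :
    nsq z * dz j f z = ∑ k, z k * opL k j f z + conj (z j) * ∑ k, z k * dz k f z := by
  simp only [nsq, opL, Finset.sum_mul, Finset.mul_sum, ← Finset.sum_add_distrib]
  exact Finset.sum_congr rfl fun k _ => by ring

lemma nsq_mul_dzbar (j : Fin n) (f : Cn n → ℂ) (z : Cn n) :
    nsq z * dzbar j f z = ∑ k, conj (z k) * opLbar k j f z + z j * ∑ k, conj (z k) * dzbar k f z := by
  simp only [nsq, opLbar, Finset.sum_mul, Finset.mul_sum, ← Finset.sum_add_distrib]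
  exact Finset.sum_congr rfl fun k _ => by ring

lemma nsq_sph (η : Sph n) : nsq (η : Cn n) = 1 := by rw [nsq_eq, norm_sph]; simp

lemma norm_coord_sph_le (η : Sph n) (k : Fin n) : ‖(η : Cn n) k‖ ≤ 1 :=
  (PiLp.norm_apply_le (η : Cn n) k).trans (norm_sph η).le

lemma norm_sum_add_sq_le {a : Fin n → ℂ} {b : ℂ} : ‖∑ k, a k + b‖ ^ 2 ≤
    (n + 1) * (∑ k, ‖a k‖ ^ 2 + ‖b‖ ^ 2) := by
  have h1 : ‖∑ k, a k + b‖ ≤ ∑ o : Option (Fin n), ‖Option.elim o b a‖ := by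
    rw [Fintype.sum_option, add_comm]
    exact (norm_add_le _ _).trans (add_le_add_right (norm_sum_le _ _) _)
  have h2 := sq_sum_le_card_mul_sum_sq (s := Finset.univ) (f := fun o : Option (Fin n) => ‖Option.elim o b a‖)
  rw [Fintype.sum_option (f := fun o : Option (Fin n) => ‖Option.elim o b a‖ ^ 2)] at h2
  simp only [Finset.card_univ, Fintype.card_option, Fintype.card_fin, Option.elim] at h2
  push_cast at h2
  calc _ ≤ _ := pow_le_pow_left₀ (norm_nonneg _) h1 2
    _ ≤ _ := h2
    _ = _ := by ring

/-- On the sphere the tangential part of a derivative is controlled by `BH.sum_nrm2_opX` and the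
radial part by Euler's identity. The factor `n + 1` is Cauchy-Schwarz for `n + 1` summands. One
derivative costs only a polynomial factor in the degree. -/
lemma BH.nrm2_wd_le (hn : 1 ≤ n) {p q : ℕ} {F : Cn n → ℂ} (hF : BH (p, q) F) (i : Fin n ⊕ Fin n) :
    nrm2 (MHarm.wd i F) ≤ 2 * n * (n + 1) * ((p + q : ℕ) + 1) ^ 2 * nrm2 F := by
  have hF1 : SmoothNearSph 1 F := hF.smoothNearSph (by simp)
  have hFc : Continuous fun η : Sph n => F η := hF1.continuous
  have hpt : ∀ η : Sph n, ‖MHarm.wd i F η‖ ^ 2 ≤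
      (n + 1) * (∑ α, ‖MHarm.opX α F η‖ ^ 2 + ((p + q : ℕ) : ℝ) ^ 2 * ‖F η‖ ^ 2) := by
    intro η
    rw [Fintype.sum_option, Fintype.sum_sum_type, Fintype.sum_prod_type, Fintype.sum_prod_type]
    cases i with
    | inl j =>
      have h := nsq_mul_dz j F η
      rw [nsq_sph, one_mul, hF.1.euler_z] at h
      rw [wd_inl, h]
      refine norm_sum_add_sq_le.trans ?_
      gcongr ?_ * ?_
      have a1 : ∑ k, ‖(η : Cn n) k * MHarm.opL k j F η‖ ^ 2 ≤
          ∑ x, ∑ y, ‖MHarm.opX (some (Sum.inl (x, y))) F η‖ ^ 2 := by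
        refine Finset.sum_le_sum fun k _ => ?_
        refine le_trans ?_ (Finset.single_le_sum (f := fun y => ‖MHarm.opX (some (Sum.inl (k, y))) F η‖ ^ 2)
          (fun _ _ => by positivity) (Finset.mem_univ j))
        rw [norm_mul, mul_pow]
        refine mul_le_of_le_one_left (by positivity) (pow_le_one₀ (norm_nonneg _) (norm_coord_sph_le η k))
      have a2 : ‖conj ((η : Cn n) j) * ((((p : ℤ), (q : ℤ)) : ℤ × ℤ).1 * F η)‖ ^ 2 ≤
          ((p + q : ℕ) : ℝ) ^ 2 * ‖F η‖ ^ 2 := by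
        rw [norm_mul, norm_mul, mul_pow, mul_pow, RCLike.norm_conj]
        have : ‖((p : ℤ) : ℂ)‖ ≤ ((p + q : ℕ) : ℝ) := by simp
        have h3 := norm_coord_sph_le η j
        calc _ ≤ 1 ^ 2 * (((p + q : ℕ) : ℝ) ^ 2 * ‖F η‖ ^ 2) := by gcongr
          _ = _ := by ring
      have a3 : (0 : ℝ) ≤ ∑ x, ∑ y, ‖MHarm.opX (some (Sum.inr (x, y))) F η‖ ^ 2 := by positivity
      have a4 : (0 : ℝ) ≤ ‖MHarm.opX none F η‖ ^ 2 := by positivity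
      linarith
    | inr j =>
      have h := nsq_mul_dzbar j F η
      rw [nsq_sph, one_mul, hF.1.euler_zbar] at h
      rw [wd_inr, h]
      refine norm_sum_add_sq_le.trans ?_
      gcongr ?_ * ?_
      have a1 : ∑ k, ‖conj ((η : Cn n) k) * MHarm.opLbar k j F η‖ ^ 2 ≤
          ∑ x, ∑ y, ‖MHarm.opX (some (Sum.inr (x, y))) F η‖ ^ 2 := by
        refine Finset.sum_le_sum fun k _ => ?_
        refine le_trans ?_ (Finset.single_le_sum (f := fun y => ‖MHarm.opX (some (Sum.inr (k, y))) F η‖ ^ 2)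
          (fun _ _ => by positivity) (Finset.mem_univ j))
        rw [norm_mul, mul_pow, RCLike.norm_conj]
        refine mul_le_of_le_one_left (by positivity) (pow_le_one₀ (norm_nonneg _) (norm_coord_sph_le η k))
      have a2 : ‖(η : Cn n) j * ((((p : ℤ), (q : ℤ)) : ℤ × ℤ).2 * F η)‖ ^ 2 ≤
          ((p + q : ℕ) : ℝ) ^ 2 * ‖F η‖ ^ 2 := by
        rw [norm_mul, norm_mul, mul_pow, mul_pow]
        have : ‖((q : ℤ) : ℂ)‖ ≤ ((p + q : ℕ) : ℝ) := by simp
        have h3 := norm_coord_sph_le η j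
        calc _ ≤ 1 ^ 2 * (((p + q : ℕ) : ℝ) ^ 2 * ‖F η‖ ^ 2) := by gcongr
          _ = _ := by ring
      have a3 : (0 : ℝ) ≤ ∑ x, ∑ y, ‖MHarm.opX (some (Sum.inl (x, y))) F η‖ ^ 2 := by positivity
      have a4 : (0 : ℝ) ≤ ‖MHarm.opX none F η‖ ^ 2 := by positivity
      linarith
  have hwc : Continuous fun η : Sph n => MHarm.wd i F η :=
    ((hF.wd i).smoothNearSph (k := 0) (by simp)).continuous
  have hXi : ∀ α, Integrable (fun η : Sph n => ‖MHarm.opX α F η‖ ^ 2) (sigma n) := fun α =>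
    sph_integrable ((hF1.continuous_opX α).norm.pow 2)
  have hFi : Integrable (fun η : Sph n => ((p + q : ℕ) : ℝ) ^ 2 * ‖F η‖ ^ 2) (sigma n) :=
    sph_integrable (continuous_const.mul (hFc.norm.pow 2))
  have h1 : nrm2 (MHarm.wd i F) ≤ (n + 1) * (∑ α, nrm2 (MHarm.opX α F) + ((p + q : ℕ) : ℝ) ^ 2 * nrm2 F) := by
    have e : (n + 1) * (∑ α, nrm2 (MHarm.opX α F) + ((p + q : ℕ) : ℝ) ^ 2 * nrm2 F) =
        ∫ η : Sph n, (n + 1) * (∑ α, ‖MHarm.opX α F η‖ ^ 2 + ((p + q : ℕ) : ℝ) ^ 2 * ‖F η‖ ^ 2) ∂(sigma n) := by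
      rw [integral_const_mul, integral_add (integrable_finsetSum _ fun α _ => hXi α) hFi,
        integral_finsetSum _ fun α _ => hXi α, integral_const_mul]
      rfl
    rw [e]
    exact integral_mono (sph_integrable (hwc.norm.pow 2))
      (((integrable_finsetSum _ fun α _ => hXi α).add hFi).const_mul _) hpt
  rw [hF.sum_nrm2_opX] at h1
  refine h1.trans ?_
  have e : ((((p : ℤ), (q : ℤ)) : ℤ × ℤ).1 + (((p : ℤ), (q : ℤ)) : ℤ × ℤ).2 : ℤ) = ((p + q : ℕ) : ℤ) := by
    push_cast; rfl
  rw [e, Int.cast_natCast]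
  have hd : (0 : ℝ) ≤ ((p + q : ℕ) : ℝ) := by positivity
  generalize ((p + q : ℕ) : ℝ) = d at hd
  have hn' : (1 : ℝ) ≤ n := by exact_mod_cast hn
  have h2 : d ^ 2 + 2 * (n - 1) * d + d ^ 2 ≤ 2 * n * (d + 1) ^ 2 := by
    nlinarith [mul_nonneg hd (by linarith : (0 : ℝ) ≤ n - 1), mul_nonneg (sq_nonneg d) (by linarith : (0 : ℝ) ≤ n - 1)]
  calc _ = (n + 1) * (d ^ 2 + 2 * (n - 1) * d + d ^ 2) * nrm2 F := by ring
    _ ≤ (n + 1) * (2 * n * (d + 1) ^ 2) * nrm2 F := by have := nrm2_nonneg F; gcongr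
    _ = _ := by ring

/-- Bernoulli's inequality for `y / x`. It pays for the polynomial loss per derivative by a slight
enlargement of the radius. -/
lemma exists_succ_mul_pow_le {x y : ℝ} (hx : 0 < x) (hxy : x < y) :
    ∃ C : ℝ, 0 ≤ C ∧ ∀ d : ℕ, ((d : ℝ) + 1) * x ^ d ≤ C * y ^ d := by
  have h1 : 0 < y / x - 1 := by rw [sub_pos, lt_div_iff₀ hx]; linarith
  refine ⟨1 + (y / x - 1)⁻¹, by positivity, fun d => ?_⟩
  have hy : 0 < y := hx.trans hxy
  have h2 : 1 + (d : ℝ) * (y / x - 1) ≤ (y / x) ^ d := by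
    have := one_add_mul_le_pow (a := y / x - 1) (by linarith) d
    simpa using this
  have h3 : (d : ℝ) + 1 ≤ (1 + (y / x - 1)⁻¹) * (y / x) ^ d := by
    have h4 : (d : ℝ) * (y / x - 1) ≤ (y / x) ^ d := by linarith
    have h5 : (d : ℝ) ≤ (y / x - 1)⁻¹ * (y / x) ^ d := by
      rw [inv_mul_eq_div, le_div_iff₀ h1]; exact h4
    have h6 : (1 : ℝ) ≤ (y / x) ^ d := by
      nlinarith [mul_nonneg (Nat.cast_nonneg d : (0 : ℝ) ≤ d) h1.le]
    linarith
  calc ((d : ℝ) + 1) * x ^ d ≤ (1 + (y / x - 1)⁻¹) * (y / x) ^ d * x ^ d := by gcongr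
    _ = _ := by rw [mul_assoc, ← mul_pow, div_mul_cancel₀ _ hx.ne']

lemma BH.eq_zero_of_neg {e : ℤ × ℤ} {F : Cn n → ℂ} (hF : BH e F) (he : e.1 < 0 ∨ e.2 < 0) :
    F = fun _ => 0 :=
  hF.1.eq_zero he

/-- Interior estimates for all derivatives of bigraded harmonics. -/
lemma BH.norm_iteratedFDeriv_le (hn : 2 ≤ n) (k : ℕ) : ∀ {ρ ρ₁ : ℝ}, 0 ≤ ρ → ρ < ρ₁ → ρ₁ ≤ 1 →
    ∃ C : ℝ, 0 ≤ C ∧ ∀ (e : ℤ × ℤ) (F : Cn n → ℂ), BH e F → ∀ z, ‖z‖ ≤ ρ →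
      ‖iteratedFDeriv ℝ k F z‖ ≤ C * ρ₁ ^ (e.1 + e.2).toNat * √(nrm2 F) := by
  induction k with
  | zero =>
    intro ρ ρ₁ h0 h1 h2
    refine ⟨(ρ₁ / (ρ₁ - ρ)) ^ n, pow_nonneg (div_nonneg (by linarith) (by linarith)) _,
      fun e F hF z hz => ?_⟩
    have hρ₁ : 0 < ρ₁ := by linarith
    have hε : 0 < ρ₁ - ρ := by linarith
    rw [norm_iteratedFDeriv_zero]
    by_cases he : e.1 < 0 ∨ e.2 < 0
    · rw [hF.eq_zero_of_neg he, norm_zero]; positivity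
    push Not at he
    obtain ⟨p, hp⟩ := Int.eq_ofNat_of_zero_le he.1
    obtain ⟨q, hq⟩ := Int.eq_ofNat_of_zero_le he.2
    obtain ⟨e1, e2⟩ := e
    simp only at hp hq
    subst hp hq
    have := hF.norm_sq_le hn z hε
    have h3 : ‖F z‖ ^ 2 ≤ ((ρ₁ / (ρ₁ - ρ)) ^ n * ρ₁ ^ (p + q) * √(nrm2 F)) ^ 2 := by
      rw [mul_pow, mul_pow, Real.sq_sqrt (nrm2_nonneg F), ← pow_mul, ← pow_mul, mul_comm n,
        mul_comm (p + q)]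
      refine this.trans ?_
      have := nrm2_nonneg F
      have h4 : ‖z‖ + (ρ₁ - ρ) ≤ ρ₁ := by linarith
      gcongr
    have h5 := abs_le_of_sq_le_sq' h3 (by positivity)
    have h6 : (((p : ℤ), (q : ℤ)) : ℤ × ℤ).1 + (((p : ℤ), (q : ℤ)) : ℤ × ℤ).2 = ((p + q : ℕ) : ℤ) := by
      push_cast; rfl
    rw [h6, Int.toNat_natCast]
    exact h5.2
  | succ k ih =>
    intro ρ ρ₁ h0 h1 h2
    obtain ⟨ρ₂, h3, h4⟩ := exists_between h1
    obtain ⟨C, hC0, hC⟩ := ih h0 h3 (by linarith)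
    obtain ⟨D, hD0, hD⟩ := exists_succ_mul_pow_le (by linarith : 0 < ρ₂) h4
    let A : ℝ := √(2 * n * (n + 1))
    let B : ℝ := ∑ i : Fin n ⊕ Fin n, ‖(ContinuousLinearMap.toSpanSingleton ℂ (zcL (n := n) i)).restrictScalars ℝ‖
    have hρ₂ : 0 < ρ₂ := by linarith
    have hρ₁ : 0 < ρ₁ := by linarith
    refine ⟨B * (C * (ρ₂⁻¹ * A) * D), by positivity, fun e F hF z hz => ?_⟩
    by_cases he : e.1 < 0 ∨ e.2 < 0
    · rw [hF.eq_zero_of_neg he]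
      have : iteratedFDeriv ℝ (k + 1) (fun _ : Cn n => (0 : ℂ)) z = 0 := by
        rw [iteratedFDeriv_succ_const]; rfl
      rw [this, norm_zero]; positivity
    push Not at he
    obtain ⟨p, hp⟩ := Int.eq_ofNat_of_zero_le he.1
    obtain ⟨q, hq⟩ := Int.eq_ofNat_of_zero_le he.2
    obtain ⟨e1, e2⟩ := e
    simp only at hp hq
    subst hp hq
    have h6 : (((p : ℤ), (q : ℤ)) : ℤ × ℤ).1 + (((p : ℤ), (q : ℤ)) : ℤ × ℤ).2 = ((p + q : ℕ) : ℤ) := by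
      push_cast; rfl
    rw [h6, Int.toNat_natCast, ← norm_iteratedFDeriv_fderiv]
    have hfd : fderiv ℝ F = fun z => ∑ i, MHarm.wd i F z • zcL i := funext fun z => fderiv_eq_sum F z
    have hcd : ∀ i, ContDiff ℝ ∞ (MHarm.wd i F) := fun i => (hF.wd i).contDiff
    have hcd2 : ∀ i, ContDiff ℝ ∞ fun z => MHarm.wd i F z • zcL (n := n) i := fun i =>
      ((ContinuousLinearMap.toSpanSingleton ℂ (zcL (n := n) i)).restrictScalars ℝ).contDiff.comp (hcd i)
    rw [hfd, iteratedFDeriv_fun_sum_apply fun i _ => (hcd2 i).contDiffAt.of_le (by exact_mod_cast le_top)]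
    refine (norm_sum_le _ _).trans ?_
    have hd : (0 : ℝ) < ((p + q : ℕ) : ℝ) + 1 := by positivity
    have key : ∀ i, ‖iteratedFDeriv ℝ k (fun z => MHarm.wd i F z • zcL (n := n) i) z‖ ≤
        ‖(ContinuousLinearMap.toSpanSingleton ℂ (zcL (n := n) i)).restrictScalars ℝ‖ *
        (C * (ρ₂⁻¹ * A) * D * ρ₁ ^ (p + q) * √(nrm2 F)) := by
      intro i
      have b1 := ((ContinuousLinearMap.toSpanSingleton ℂ (zcL (n := n) i)).restrictScalars ℝ).norm_iteratedFDeriv_comp_left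
        (f := MHarm.wd i F) (x := z) (n := k) ((hcd i).contDiffAt.of_le (n := (∞ : WithTop ℕ∞)) (m := k) (by exact_mod_cast le_top)) le_rfl
      refine b1.trans ?_
      refine mul_le_mul_of_nonneg_left ?_ (norm_nonneg _)
      refine (hC _ _ (hF.wd i) z hz).trans ?_
      have b2 : √(nrm2 (MHarm.wd i F)) ≤ A * (((p + q : ℕ) : ℝ) + 1) * √(nrm2 F) := by
        refine (Real.sqrt_le_sqrt (hF.nrm2_wd_le (by omega) i)).trans_eq ?_
        rw [Real.sqrt_mul (by positivity), Real.sqrt_mul (by positivity), Real.sqrt_sq hd.le]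
      -- A derivative has total degree `p + q - 1`, and the lost factor is compensated by `ρ₂⁻¹`.
      -- For `p + q = 0` truncation by `toNat` leaves exponent zero, and the inequality still holds
      -- since `ρ₂ ≤ 1`.
      have hdeg : ρ₂ ^ (((((p : ℤ), (q : ℤ)) : ℤ × ℤ) - bw i).1 + ((((p : ℤ), (q : ℤ)) : ℤ × ℤ) - bw i).2).toNat
          ≤ ρ₂⁻¹ * ρ₂ ^ (p + q) := by
        have e1 : ((((p : ℤ), (q : ℤ)) : ℤ × ℤ) - bw i).1 + ((((p : ℤ), (q : ℤ)) : ℤ × ℤ) - bw i).2 =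
            (p + q : ℕ) - 1 := by
          cases i <;> simp [bw] <;> ring
        rw [e1, inv_mul_eq_div, le_div_iff₀ hρ₂, ← pow_succ]
        exact pow_le_pow_of_le_one hρ₂.le (by linarith) (by omega)
      have hnn := nrm2_nonneg F
      calc _ ≤ C * (ρ₂⁻¹ * ρ₂ ^ (p + q)) * (A * (((p + q : ℕ) : ℝ) + 1) * √(nrm2 F)) := by gcongr
        _ = C * (ρ₂⁻¹ * A) * ((((p + q : ℕ) : ℝ) + 1) * ρ₂ ^ (p + q)) * √(nrm2 F) := by ring
        _ ≤ C * (ρ₂⁻¹ * A) * (D * ρ₁ ^ (p + q)) * √(nrm2 F) := by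
            have := hD (p + q)
            gcongr
        _ = _ := by ring
    refine (Finset.sum_le_sum fun i _ => key i).trans_eq ?_
    rw [← Finset.sum_mul]
    ring

/-- The solid harmonic with boundary values `F`. -/
def solid (n p q : ℕ) (F : Cn n → ℂ) (z : Cn n) : ℂ := (S n p q (‖z‖ ^ 2) : ℂ) * F z

lemma solid_eq_smul (p q : ℕ) (F : Cn n → ℂ) :
    solid n p q F = fun z => S n p q (‖z‖ ^ 2) • F z := by
  ext z; rw [Complex.real_smul]; rfl

lemma abs_norm_sq_lt_one {z : Cn n} (hz : z ∈ unitBall n) : |‖z‖ ^ 2| < 1 := by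
  have h : ‖z‖ < 1 := by simpa using hz
  rw [abs_of_nonneg (sq_nonneg _)]
  nlinarith [norm_nonneg z]

lemma contDiffOn_S_norm_sq (hn : 1 ≤ n) (p q : ℕ) :
    ContDiffOn ℝ ∞ (fun z : Cn n => S n p q (‖z‖ ^ 2)) (unitBall n) :=
  (nonnegSeries_S hn p q).contDiffOn.comp (contDiff_norm_sq ℝ).contDiffOn
    fun _ hz => abs_lt.1 (abs_norm_sq_lt_one hz)

lemma contDiffOn_solid (hn : 1 ≤ n) {p q : ℕ} {e : ℤ × ℤ} {F : Cn n → ℂ} (hF : BH e F) :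
    ContDiffOn ℝ ∞ (solid n p q F) (unitBall n) := by
  rw [solid_eq_smul]
  exact (contDiffOn_S_norm_sq hn p q).smul hF.contDiff.contDiffOn

/-- The chain rule for higher derivatives combined with `NonnegSeries.iteratedDeriv_le`. The point
is that all derivatives are measured by one value of `S_{pq}` itself, uniformly in `p` and `q`. -/
lemma norm_iteratedFDerivWithin_S_norm_sq_le (hn : 1 ≤ n) (k : ℕ) {ρ ρ₁ : ℝ} (h0 : 0 ≤ ρ)
    (h1 : ρ < ρ₁) (h2 : ρ₁ < 1) :
    ∃ C : ℝ, 0 ≤ C ∧ ∀ (p q : ℕ) (z : Cn n), ‖z‖ ≤ ρ →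
      ‖iteratedFDerivWithin ℝ k (fun z : Cn n => S n p q (‖z‖ ^ 2)) (unitBall n) z‖ ≤
        C * S n p q (ρ₁ ^ 2) := by
  have hlt : ρ ^ 2 < ρ₁ ^ 2 := by nlinarith
  have hlt1 : ρ₁ ^ 2 < 1 := by nlinarith
  choose c hc0 hc using fun i : ℕ =>
    NonnegSeries.iteratedDeriv_le i (sq_nonneg ρ) hlt hlt1
  have hD : ∀ i : ℕ, ∃ D : ℝ, ∀ z : Cn n, ‖z‖ ≤ ρ →
      ‖iteratedFDeriv ℝ i (fun z : Cn n => ‖z‖ ^ 2) z‖ ≤ D := fun i => by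
    obtain ⟨D, hD⟩ := (isCompact_closedBall (0 : Cn n) ρ).exists_bound_of_continuousOn
      (((contDiff_norm_sq ℝ (n := (∞ : WithTop ℕ∞)) (E := Cn n)).continuous_iteratedFDeriv (m := i)
        (by exact_mod_cast le_top)).continuousOn)
    exact ⟨D, fun z hz => hD z (by simpa using hz)⟩
  choose D hD using hD
  let c' : ℝ := ∑ i ∈ Finset.range (k + 1), c i
  -- Made at least one so that `|D i| ≤ D' ≤ D'^i` for `i ≥ 1`, the form required by the estimate
  -- for compositions.
  let D' : ℝ := 1 + ∑ i ∈ Finset.range (k + 1), |D i|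
  have hc' : 0 ≤ c' := Finset.sum_nonneg fun i _ => hc0 i
  have hD' : 1 ≤ D' := le_add_of_nonneg_right (Finset.sum_nonneg fun i _ => abs_nonneg _)
  refine ⟨k.factorial * c' * D' ^ k, by positivity, fun p q z hz => ?_⟩
  have hzb : z ∈ unitBall n := by simp; linarith
  have hS := nonnegSeries_S hn p q
  have hSp : 0 ≤ S n p q (ρ₁ ^ 2) := hS.eval_nonneg (sq_nonneg _) hlt1
  have key := norm_iteratedFDerivWithin_comp_le (𝕜 := ℝ) (n := k) (N := (∞ : WithTop ℕ∞))
    (g := S n p q) (f := fun z : Cn n => ‖z‖ ^ 2) (s := unitBall n) (t := Set.Ioo (-1) 1) (x := z)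
    hS.contDiffOn (contDiff_norm_sq ℝ).contDiffOn (by exact_mod_cast le_top)
    isOpen_Ioo.uniqueDiffOn Metric.isOpen_ball.uniqueDiffOn
    (fun _ hz => abs_lt.1 (abs_norm_sq_lt_one hz)) hzb
    (C := c' * S n p q (ρ₁ ^ 2)) (D := D') ?_ ?_
  · refine key.trans_eq ?_
    ring
  · intro i hi
    have hz2 : ‖z‖ ^ 2 ≤ ρ ^ 2 := by gcongr
    have hmem := abs_lt.1 (abs_norm_sq_lt_one hzb)
    rw [norm_iteratedFDerivWithin_eq_norm_iteratedDerivWithin, iteratedDerivWithin_of_isOpen isOpen_Ioo hmem]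
    obtain ⟨b', hb'⟩ := hS.iteratedDeriv i
    rw [Real.norm_of_nonneg (hb'.eval_nonneg (sq_nonneg _) hmem.2)]
    refine (hc i _ _ hS _ (sq_nonneg _) hz2).trans ?_
    gcongr
    exact Finset.single_le_sum (f := c) (fun i _ => hc0 i) (Finset.mem_range.2 (by omega))
  · intro i hi1 hi
    rw [iteratedFDerivWithin_of_isOpen i Metric.isOpen_ball hzb]
    refine (hD i z hz).trans ((le_abs_self _).trans ?_)
    have : |D i| ≤ D' := (Finset.single_le_sum (f := fun i => |D i|) (fun i _ => abs_nonneg _)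
      (Finset.mem_range.2 (by omega : i < k + 1))).trans (le_add_of_nonneg_left zero_le_one)
    exact this.trans (le_self_pow₀ hD' (by omega))

/-- The derivatives of the solid harmonics on a smaller ball are exponentially small in the degree,
relative to the spherical `L²` norm on a larger sphere. -/
lemma norm_iteratedFDeriv_solid_le (hn : 2 ≤ n) (k : ℕ) {ρ : ℝ} (h0 : 0 ≤ ρ) (h1 : ρ < 1) :
    ∃ t₁ ∈ Set.Ioo (0 : ℝ) 1, ∃ θ ∈ Set.Ioo (0 : ℝ) 1, ∃ C : ℝ, 0 ≤ C ∧
      ∀ (p q : ℕ) (F : Cn n → ℂ), BH (p, q) F → ∀ z, ‖z‖ ≤ ρ →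
        ‖iteratedFDeriv ℝ k (solid n p q F) z‖ ≤
          C * θ ^ (p + q) * (gfun n p q t₁ * √(nrm2 F)) := by
  have hn1 : 1 ≤ n := by omega
  obtain ⟨ρ₂, h3, h4⟩ := exists_between h1
  obtain ⟨ρ₁, h5, h6⟩ := exists_between h4
  have hρ₂ : 0 < ρ₂ := by linarith
  have hρ₁ : 0 < ρ₁ := by linarith
  choose A hA0 hA using fun i : ℕ =>
    norm_iteratedFDerivWithin_S_norm_sq_le hn1 i h0 (h3.trans h5) h6
  choose B hB0 hB using fun i : ℕ => BH.norm_iteratedFDeriv_le hn i h0 h3 h4.le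
  -- Derivatives of `F` on `‖z‖ ≤ ρ` are of size `ρ₂^(p+q)`, whereas `gfun n p q (ρ₁²) = ρ₁^(p+q)
  -- S_{pq}(ρ₁²)`. The ratio `θ = ρ₂ / ρ₁` is the geometric gain.
  refine ⟨ρ₁ ^ 2, ⟨by positivity, by nlinarith⟩, ρ₂ / ρ₁, ⟨by positivity, by
    rwa [div_lt_one hρ₁]⟩, ∑ i ∈ Finset.range (k + 1), (k.choose i : ℝ) * A i * B (k - i),
    Finset.sum_nonneg fun i _ => mul_nonneg (mul_nonneg (by positivity) (hA0 i)) (hB0 _),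
    fun p q F hF z hz => ?_⟩
  have hzb : z ∈ unitBall n := by simp; linarith
  rw [← iteratedFDerivWithin_of_isOpen k Metric.isOpen_ball hzb, solid_eq_smul]
  refine (norm_iteratedFDerivWithin_smul_le (N := (∞ : WithTop ℕ∞)) (contDiffOn_S_norm_sq hn1 p q)
    hF.contDiff.contDiffOn Metric.isOpen_ball.uniqueDiffOn hzb (by exact_mod_cast le_top)).trans ?_
  rw [Finset.sum_mul, Finset.sum_mul]
  refine Finset.sum_le_sum fun i _ => ?_
  have a1 := hA i p q z hz
  have a2 := hB (k - i) _ F hF z hz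
  rw [← iteratedFDerivWithin_of_isOpen (k - i) Metric.isOpen_ball hzb] at a2
  have e1 : ((((p : ℤ), (q : ℤ)) : ℤ × ℤ).1 + (((p : ℤ), (q : ℤ)) : ℤ × ℤ).2).toNat = p + q := by
    simp; omega
  rw [e1] at a2
  have hg : gfun n p q (ρ₁ ^ 2) = ρ₁ ^ (p + q) * S n p q (ρ₁ ^ 2) := by
    rw [gfun, ← Real.rpow_natCast ρ₁ 2, ← Real.rpow_mul hρ₁.le, ← Real.rpow_natCast ρ₁ (p + q)]
    congr 2
    push_cast; ring
  have hSp : 0 ≤ S n p q (ρ₁ ^ 2) := (S_pos hn1 p q (sq_nonneg _) (by nlinarith)).le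
  calc _ ≤ (k.choose i : ℝ) * (A i * S n p q (ρ₁ ^ 2)) * (B (k - i) * ρ₂ ^ (p + q) * √(nrm2 F)) := by
        have := hA0 i
        gcongr
    _ = _ := by
        rw [hg, div_pow]
        field_simp

/-! ### Completeness of the bigraded harmonics on the sphere -/

lemma continuous_sph_mul_conj {u v : Sph n → ℂ} (hu : Continuous u) (hv : Continuous v) :
    Continuous fun η => u η * conj (v η) :=
  hu.mul (Complex.continuous_conj.comp hv)

lemma BH.continuous_sph {e : ℤ × ℤ} {F : Cn n → ℂ} (hF : BH e F) :
    Continuous fun η : Sph n => F η :=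
  hF.contDiff.continuous.comp continuous_subtype_val

/-- Restriction of bigraded harmonics to the sphere, as elements of `L²`. -/
def bhLp (n : ℕ) (e : ℤ × ℤ) : bhSub n e →ₗ[ℂ] Lp ℂ 2 (sigma n) :=
  (ContinuousMap.toLp (E := ℂ) 2 (sigma n) ℂ).toLinearMap ∘ₗ
    { toFun := fun H => ⟨fun η : Sph n => H.1 η, BH.continuous_sph (e := e) (mem_bhSub.1 H.2)⟩
      map_add' := fun _ _ => rfl
      map_smul' := fun _ _ => rfl }

/-- Orthogonal projection in `L²` onto the finite-dimensional space of restrictions; the projection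
is again represented by a harmonic polynomial. -/
lemma exists_sphProj (e : ℤ × ℤ) {u : Sph n → ℂ} (hu : Continuous u) :
    ∃ H : Cn n → ℂ, BH e H ∧ ∀ G : Cn n → ℂ, BH e G →
      ∫ η, u η * conj (G η) ∂(sigma n) = ∫ η : Sph n, H η * conj (G η) ∂(sigma n) := by
  let U := ContinuousMap.toLp (E := ℂ) 2 (sigma n) ℂ ⟨u, hu⟩
  let K := LinearMap.range (bhLp n e)
  obtain ⟨H, hH⟩ := LinearMap.mem_range.1 (K.starProjection_apply_mem U)
  refine ⟨H.1, mem_bhSub.1 H.2, fun G hG => ?_⟩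
  have h1 : inner ℂ (bhLp n e ⟨G, mem_bhSub.2 hG⟩) (U - bhLp n e H) = 0 := by
    rw [hH]
    exact K.inner_right_of_mem_orthogonal ⟨_, rfl⟩ (K.sub_starProjection_mem_orthogonal U)
  rw [inner_sub_right, sub_eq_zero] at h1
  have h2 := ContinuousMap.inner_toLp (𝕜 := ℂ) (sigma n) ⟨fun η : Sph n => G η, hG.continuous_sph⟩ ⟨u, hu⟩
  have h3 := ContinuousMap.inner_toLp (𝕜 := ℂ) (sigma n) ⟨fun η : Sph n => G η, hG.continuous_sph⟩
    ⟨fun η : Sph n => H.1 η, BH.continuous_sph (e := e) (mem_bhSub.1 H.2)⟩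
  exact (h2.symm.trans h1).trans h3

/-- The restriction of a coordinate function to the sphere. -/
def sphCoord (i : Fin n ⊕ Fin n) : C(Sph n, ℂ) :=
  ⟨fun η => zc i η, by
    rw [zc_eq]; exact (zcL i).continuous.comp continuous_subtype_val⟩

lemma star_sphCoord (i : Fin n ⊕ Fin n) : star (sphCoord i) = sphCoord i.swap := by
  ext η; cases i <;> simp [sphCoord]

/-- Polynomial functions on the sphere. -/
def sphPoly (n : ℕ) : StarSubalgebra ℂ C(Sph n, ℂ) :=
  { Algebra.adjoin ℂ (Set.range sphCoord) with
    star_mem' := by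
      intro a ha
      induction ha using Algebra.adjoin_induction with
      | mem x hx =>
        obtain ⟨i, rfl⟩ := hx
        exact Algebra.subset_adjoin ⟨i.swap, (star_sphCoord i).symm⟩
      | algebraMap r =>
        rw [← algebraMap_star_comm]
        exact Subalgebra.algebraMap_mem _ _
      | add x y _ _ hx hy => rw [star_add]; exact Subalgebra.add_mem _ hx hy
      | mul x y _ _ hx hy => rw [star_mul]; exact Subalgebra.mul_mem _ hy hx }

/-- Stone-Weierstrass; the coordinates `z_j` already separate the points of the sphere. -/
lemma sphPoly_dense : (sphPoly n).topologicalClosure = ⊤ := by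
  refine ContinuousMap.starSubalgebra_topologicalClosure_eq_top_of_separatesPoints _ ?_
  intro x y hxy
  have : ∃ j, (x : Cn n) j ≠ (y : Cn n) j := by
    by_contra! h
    exact hxy (Subtype.ext (PiLp.ext h))
  obtain ⟨j, hj⟩ := this
  exact ⟨_, ⟨sphCoord (Sum.inl j), Algebra.subset_adjoin ⟨_, rfl⟩, rfl⟩, hj⟩

lemma exists_isPoly_of_mem_closure {g : C(Sph n, ℂ)}
    (hg : g ∈ Submonoid.closure (Set.range (sphCoord (n := n)))) :
    ∃ (e : ℤ × ℤ) (F : Cn n → ℂ), IsPoly e F ∧ ∀ η : Sph n, g η = F η := by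
  induction hg using Submonoid.closure_induction with
  | mem x hx => obtain ⟨i, rfl⟩ := hx; exact ⟨_, _, IsPoly.zc i, fun _ => rfl⟩
  | one => exact ⟨_, _, IsPoly.const 1, fun _ => rfl⟩
  | mul x y _ _ hx hy =>
    obtain ⟨e, F, hF, h1⟩ := hx
    obtain ⟨e', F', hF', h2⟩ := hy
    exact ⟨_, _, hF.mul hF', fun η => by rw [ContinuousMap.mul_apply, h1, h2]⟩

/-- On the sphere `|z|² = 1`, so `IsPoly.exists_decomp` makes every monomial a sum of bigraded
harmonics. Hence `h` is orthogonal to all polynomials, by density to all continuous functions, and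
in particular to itself. -/
lemma eq_zero_of_forall_orthogonal (hn : 1 ≤ n) {h : Sph n → ℂ} (hc : Continuous h)
    (horth : ∀ (p q : ℕ) (G : Cn n → ℂ), BH (p, q) G →
      ∫ η : Sph n, h η * conj (G η) ∂(sigma n) = 0) : h = 0 := by
  have horth' : ∀ (e : ℤ × ℤ) (G : Cn n → ℂ), BH e G →
      ∫ η : Sph n, h η * conj (G η) ∂(sigma n) = 0 := by
    intro e G hG
    by_cases he : e.1 < 0 ∨ e.2 < 0
    · rw [hG.eq_zero_of_neg he]; simp
    push Not at he
    obtain ⟨p, hp⟩ := Int.eq_ofNat_of_zero_le he.1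
    obtain ⟨q, hq⟩ := Int.eq_ofNat_of_zero_le he.2
    exact horth p q G (hG.congr (Prod.ext hp hq))
  let hC : C(Sph n, ℂ) := ⟨h, hc⟩
  let U := ContinuousMap.toLp (E := ℂ) 2 (sigma n) ℂ hC
  let Z : Set C(Sph n, ℂ) := {g | inner ℂ (ContinuousMap.toLp (E := ℂ) 2 (sigma n) ℂ g) U = 0}
  have hZ : IsClosed Z := isClosed_eq (by fun_prop) continuous_const
  have hin : ∀ g : C(Sph n, ℂ), inner ℂ (ContinuousMap.toLp (E := ℂ) 2 (sigma n) ℂ g) U =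
      ∫ η, h η * conj (g η) ∂(sigma n) := fun g => ContinuousMap.inner_toLp (sigma n) g hC
  have hsub : (sphPoly n : Set C(Sph n, ℂ)) ⊆ Z := by
    intro g hg
    have hg' : g ∈ Submodule.span ℂ (Submonoid.closure (Set.range (sphCoord (n := n))) :
        Set C(Sph n, ℂ)) := by
      rw [← Algebra.adjoin_eq_span]; exact hg
    induction hg' using Submodule.span_induction with
    | mem g hm =>
      obtain ⟨e, F, hF, hgF⟩ := exists_isPoly_of_mem_closure hm
      obtain ⟨H, hH, hd⟩ := hF.exists_decomp hn (e.1.toNat + 1) (by omega)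
      change inner ℂ _ _ = _
      rw [hin]
      have e1 : ∀ η : Sph n, h η * conj (g η) =
          ∑ j ∈ Finset.range (e.1.toNat + 1), h η * conj (H j η) := fun η => by
        rw [hgF, hd, map_sum, Finset.mul_sum]
        refine Finset.sum_congr rfl fun j _ => ?_
        rw [nsq_sph, one_pow, one_mul]
      simp only [e1]
      rw [integral_finsetSum _ fun j _ =>
        sph_integrable (continuous_sph_mul_conj hc (hH j).continuous_sph)]
      exact Finset.sum_eq_zero fun j _ => horth' _ _ (hH j)
    | zero => simp [Z]
    | add x y hx hy h1 h2 =>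
      have a := h1 (by change x ∈ Algebra.adjoin ℂ _; rwa [← Subalgebra.mem_toSubmodule, Algebra.adjoin_eq_span])
      have b := h2 (by change y ∈ Algebra.adjoin ℂ _; rwa [← Subalgebra.mem_toSubmodule, Algebra.adjoin_eq_span])
      change inner ℂ _ _ = _ at a b ⊢
      rw [map_add, inner_add_left, a, b, add_zero]
    | smul c x hx h1 =>
      have a := h1 (by change x ∈ Algebra.adjoin ℂ _; rwa [← Subalgebra.mem_toSubmodule, Algebra.adjoin_eq_span])
      change inner ℂ _ _ = _ at a ⊢
      rw [map_smul, inner_smul_left, a, mul_zero]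
  have hmem : hC ∈ Z := by
    have h1 : hC ∈ (sphPoly n).topologicalClosure := by rw [sphPoly_dense]; trivial
    exact closure_minimal hsub hZ h1
  have hU : U = 0 := inner_self_eq_zero.1 hmem
  have h0 : hC = 0 := ContinuousMap.toLp_injective (E := ℂ) (p := 2) (𝕜 := ℂ) (sigma n)
    (hU.trans (map_zero _).symm)
  exact congrArg (fun g : C(Sph n, ℂ) => (g : Sph n → ℂ)) h0

/-! ### The Peter-Weyl decomposition -/

lemma gfun_eq {p q : ℕ} {t : ℝ} (ht : 0 ≤ t) : gfun n p q t = √t ^ (p + q) * S n p q t := by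
  rw [gfun, Real.sqrt_eq_rpow, ← Real.rpow_natCast (t ^ (1 / 2 : ℝ)), ← Real.rpow_mul ht]
  congr 2
  push_cast; ring

lemma solid_sph {p q : ℕ} {F : Cn n → ℂ} (hF : BH (p, q) F) {t : ℝ} (ht : 0 ≤ t) (η : Sph n) :
    solid n p q F (√t • (η : Cn n)) = gfun n p q t * F η := by
  rw [solid, norm_smul_sph, Real.sq_sqrt ht, hF.1.real_smul_eq, gfun_eq ht]
  push_cast; ring

/-- `F` collects the spherical coefficients of `f`. -/
def IsCoeff (f : Cn n → ℂ) (F : ℕ → ℕ → Cn n → ℂ) : Prop :=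
  (∀ p q : ℕ, BH (p, q) (F p q)) ∧ ∀ (p q : ℕ) (G : Cn n → ℂ), BH (p, q) G → ∀ t ∈ Set.Ioo (0 : ℝ) 1,
    ∫ η : Sph n, f (√t • (η : Cn n)) * conj (G η) ∂(sigma n) =
      gfun n p q t * ∫ η : Sph n, F p q η * conj (G η) ∂(sigma n)

/-- Each spherical coefficient is a constant times `gfun`, so a single slice determines it for all
`t`. The slice `t = 1/4` is projected and divided by the positive number `gfun n p q (1/4)`. -/
lemma IsMHarmonic.exists_isCoeff (hn : 2 ≤ n) {f : Cn n → ℂ} (hf : IsMHarmonic f) :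
    ∃ F, IsCoeff f F := by
  have hn1 : 1 ≤ n := by omega
  have ht₀ : (1 / 4 : ℝ) ∈ Set.Ioo (0 : ℝ) 1 := by norm_num
  have hfc : ContinuousOn f (unitBall n) := hf.1.continuousOn
  choose H hH hHp using fun a : ℕ × ℕ =>
    exists_sphProj (n := n) ((a.1 : ℤ), (a.2 : ℤ)) (continuous_sph_dilate hfc ht₀)
  refine ⟨fun p q z => (gfun n p q (1 / 4) : ℂ)⁻¹ * H (p, q) z,
    fun p q => (hH (p, q)).const_mul _, fun p q G hG t ht => ?_⟩
  obtain ⟨c, hc⟩ := hf.sphInt_eq hn hG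
  have h1 := hHp (p, q) G hG
  rw [hc _ ht₀] at h1
  have h2 : (gfun n p q (1 / 4) : ℂ) ≠ 0 := by exact_mod_cast (gfun_pos hn1 p q ht₀).ne'
  simp only [mul_assoc]
  rw [hc t ht, integral_const_mul, ← h1]
  field_simp

lemma nrm2_eq_zero_of_orthogonal {F : Cn n → ℂ}
    (h : ∫ η : Sph n, F η * conj (F η) ∂(sigma n) = 0) : nrm2 F = 0 := by
  rw [← ofReal_nrm2] at h; exact_mod_cast h

lemma BH.eq_zero_of_nrm2 (hn : 2 ≤ n) {p q : ℕ} {F : Cn n → ℂ} (hF : BH (p, q) F)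
    (h : nrm2 F = 0) : F = 0 := by
  ext z
  have := hF.norm_sq_le hn z one_pos
  rw [h, mul_zero] at this
  have h1 : ‖F z‖ ^ 2 = 0 := le_antisymm this (sq_nonneg _)
  simpa using h1

lemma IsCoeff.unique (hn : 2 ≤ n) {f : Cn n → ℂ} {F F' : ℕ → ℕ → Cn n → ℂ} (h : IsCoeff f F)
    (h' : IsCoeff f F') : F = F' := by
  have hn1 : 1 ≤ n := by omega
  funext p q
  have hD := (h.1 p q).sub (h'.1 p q)
  have ht₀ : (1 / 4 : ℝ) ∈ Set.Ioo (0 : ℝ) 1 := by norm_num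
  have e1 := h.2 p q _ hD _ ht₀
  rw [h'.2 p q _ hD _ ht₀] at e1
  have h2 : (gfun n p q (1 / 4) : ℂ) ≠ 0 := by exact_mod_cast (gfun_pos hn1 p q ht₀).ne'
  have e2 := mul_left_cancel₀ h2 e1
  have e3 : nrm2 (fun z => F p q z - F' p q z) = 0 := by
    refine nrm2_eq_zero_of_orthogonal ?_
    have i1 := sph_integrable (continuous_sph_mul_conj (h.1 p q).continuous_sph hD.continuous_sph)
    have i2 := sph_integrable (continuous_sph_mul_conj (h'.1 p q).continuous_sph hD.continuous_sph)
    have e4 := integral_sub i1 i2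
    rw [e2, sub_self] at e4
    rw [← e4]
    exact integral_congr_ae (Filter.Eventually.of_forall fun η => sub_mul _ _ _)
  have e5 := hD.eq_zero_of_nrm2 hn e3
  funext z
  exact sub_eq_zero.1 (congrFun e5 z)

/-- Boundary data whose series of solid harmonics converges. -/
def Admissible (F : ℕ → ℕ → Cn n → ℂ) : Prop :=
  (∀ p q : ℕ, BH (p, q) (F p q)) ∧
    ∀ t ∈ Set.Ioo (0 : ℝ) 1, ∃ M, 0 ≤ M ∧ ∀ p q, gfun n p q t * √(nrm2 (F p q)) ≤ M

/-- Bessel's inequality for one component, obtained by testing the slice against `F p q` itself. -/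
lemma gfun_sq_mul_nrm2_le (hn : 1 ≤ n) {f : Cn n → ℂ} (hf : ContinuousOn f (unitBall n))
    {F : ℕ → ℕ → Cn n → ℂ} (h : IsCoeff f F) {t : ℝ} (ht : t ∈ Set.Ioo (0 : ℝ) 1) (p q : ℕ) :
    gfun n p q t ^ 2 * nrm2 (F p q) ≤ nrm2 fun z => f (√t • z) := by
  have h1 := norm_integral_mul_conj_sq_le (continuous_sph_dilate hf ht) (h.1 p q).continuous_sph
  have h2 := h.2 p q _ (h.1 p q) t ht
  rw [← ofReal_nrm2, ← Complex.ofReal_mul] at h2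
  rw [h2, Complex.norm_real, Real.norm_eq_abs, sq_abs] at h1
  change _ ≤ (nrm2 fun z => f (√t • z)) * nrm2 (F p q) at h1
  rcases (nrm2_nonneg (F p q)).eq_or_lt with h0 | h0
  · rw [← h0, mul_zero]; exact nrm2_nonneg _
  · refine le_of_mul_le_mul_right ?_ h0
    calc _ = (gfun n p q t * nrm2 (F p q)) ^ 2 := by ring
      _ ≤ _ := h1

lemma IsCoeff.admissible (hn : 1 ≤ n) {f : Cn n → ℂ} (hf : ContinuousOn f (unitBall n))
    {F : ℕ → ℕ → Cn n → ℂ} (h : IsCoeff f F) : Admissible F := by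
  refine ⟨h.1, fun t ht => ⟨√(nrm2 fun z => f (√t • z)), Real.sqrt_nonneg _, fun p q => ?_⟩⟩
  refine Real.le_sqrt_of_sq_le ?_
  rw [mul_pow, Real.sq_sqrt (nrm2_nonneg _)]
  exact gfun_sq_mul_nrm2_le hn hf h ht p q

lemma summable_pow_add {θ : ℝ} (h0 : 0 ≤ θ) (h1 : θ < 1) :
    Summable fun a : ℕ × ℕ => θ ^ (a.1 + a.2) := by
  have hs := summable_geometric_of_lt_one h0 h1
  simp only [pow_add]
  exact hs.mul_of_nonneg hs (fun _ => by positivity) fun _ => by positivity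

/-- Admissibility at the one radius supplied by `norm_iteratedFDeriv_solid_le` suffices, because the
factor `θ^(p+q)` is summable over pairs. -/
lemma Admissible.exists_bound (hn : 2 ≤ n) {F : ℕ → ℕ → Cn n → ℂ} (h : Admissible F) (k : ℕ)
    {ρ : ℝ} (h0 : 0 ≤ ρ) (h1 : ρ < 1) : ∃ v : ℕ × ℕ → ℝ, Summable v ∧ ∀ a z, ‖z‖ ≤ ρ →
      ‖iteratedFDeriv ℝ k (solid n a.1 a.2 (F a.1 a.2)) z‖ ≤ v a := by
  obtain ⟨t₁, ht₁, θ, hθ, C, hC0, hC⟩ := norm_iteratedFDeriv_solid_le hn k h0 h1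
  obtain ⟨M, hM0, hM⟩ := h.2 t₁ ht₁
  refine ⟨fun a => C * M * θ ^ (a.1 + a.2),
    (summable_pow_add hθ.1.le hθ.2).mul_left _, fun a z hz => ?_⟩
  refine (hC a.1 a.2 _ (h.1 _ _) z hz).trans ?_
  have := hM a.1 a.2
  have := hθ.1.le
  calc _ ≤ C * θ ^ (a.1 + a.2) * M := by gcongr
    _ = _ := by ring

/-- The sum of the series of solid harmonics. -/
def solidSum (F : ℕ → ℕ → Cn n → ℂ) (z : Cn n) : ℂ :=
  ∑' a : ℕ × ℕ, solid n a.1 a.2 (F a.1 a.2) z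

lemma Admissible.hasSumUniformlyOn (hn : 2 ≤ n) {F : ℕ → ℕ → Cn n → ℂ} (h : Admissible F)
    {ρ : ℝ} (h0 : 0 ≤ ρ) (h1 : ρ < 1) :
    TendstoUniformlyOn (fun (s : Finset (ℕ × ℕ)) z => ∑ a ∈ s, solid n a.1 a.2 (F a.1 a.2) z)
      (solidSum F) Filter.atTop (Metric.closedBall 0 ρ) := by
  obtain ⟨v, hv, hb⟩ := h.exists_bound hn 0 h0 h1
  exact tendstoUniformlyOn_tsum hv fun a z hz => by
    have := hb a z (by simpa using hz)
    rwa [norm_iteratedFDeriv_zero] at this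

lemma Admissible.hasSumLocallyUniformlyOn (hn : 2 ≤ n) {F : ℕ → ℕ → Cn n → ℂ}
    (h : Admissible F) :
    HasSumLocallyUniformlyOn (fun (a : ℕ × ℕ) z => solid n a.1 a.2 (F a.1 a.2) z)
      (solidSum F) (unitBall n) := by
  rw [hasSumLocallyUniformlyOn_iff_tendstoLocallyUniformlyOn,
    tendstoLocallyUniformlyOn_iff_forall_isCompact Metric.isOpen_ball]
  intro K hK hKc
  obtain ⟨ρ, h0, h1, hρ⟩ : ∃ ρ, 0 ≤ ρ ∧ ρ < 1 ∧ K ⊆ Metric.closedBall 0 ρ := by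
    rcases K.eq_empty_or_nonempty with rfl | hne
    · exact ⟨0, le_rfl, one_pos, Set.empty_subset _⟩
    · obtain ⟨z, hz, hmax⟩ := hKc.exists_isMaxOn hne continuous_norm.continuousOn
      exact ⟨‖z‖, norm_nonneg z, by simpa using hK hz, fun w hw => by simpa using hmax hw⟩
  exact (h.hasSumUniformlyOn hn h0 h1).mono hρ

lemma Admissible.continuousOn_solidSum (hn : 2 ≤ n) {F : ℕ → ℕ → Cn n → ℂ} (h : Admissible F) :
    ContinuousOn (solidSum F) (unitBall n) := by
  refine ((hasSumLocallyUniformlyOn_iff_tendstoLocallyUniformlyOn.1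
    (h.hasSumLocallyUniformlyOn hn))).continuousOn (Filter.Frequently.of_forall fun s => ?_)
  exact continuousOn_finsetSum _ fun a _ => (contDiffOn_solid (by omega) (h.1 a.1 a.2)).continuousOn

/-- Locally uniform sums of solid harmonics have the expected spherical coefficients. -/
lemma isCoeff_of_hasSum (hn : 2 ≤ n) {f : Cn n → ℂ} {F : ℕ → ℕ → Cn n → ℂ}
    (hF : ∀ p q : ℕ, BH (p, q) (F p q))
    (hs : HasSumLocallyUniformlyOn (fun (a : ℕ × ℕ) z => solid n a.1 a.2 (F a.1 a.2) z) f
      (unitBall n)) : IsCoeff f F := by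
  refine ⟨hF, fun p q G hG t ht => ?_⟩
  have hn1 : 1 ≤ n := by omega
  rw [hasSumLocallyUniformlyOn_iff_tendstoLocallyUniformlyOn,
    tendstoLocallyUniformlyOn_iff_forall_isCompact Metric.isOpen_ball] at hs
  have hcomp : IsCompact (Set.range fun η : Sph n => √t • (η : Cn n)) :=
    isCompact_range (by fun_prop)
  have hu := hs _ (Set.range_subset_iff.2 fun η => smul_sph_mem_ball ht η) hcomp
  obtain ⟨D, hD⟩ := (isCompact_univ (X := Sph n)).exists_bound_of_continuousOn
    hG.continuous_sph.continuousOn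
  have hterm : ∀ s : Finset (ℕ × ℕ), Continuous fun η : Sph n =>
      ∑ a ∈ s, solid n a.1 a.2 (F a.1 a.2) (√t • (η : Cn n)) := fun s =>
    continuous_finsetSum _ fun a _ =>
      continuous_sph_dilate (contDiffOn_solid hn1 (hF a.1 a.2)).continuousOn ht
  have hfc : Continuous fun η : Sph n => f (√t • (η : Cn n)) := by
    have h2 : TendstoUniformly (fun (s : Finset (ℕ × ℕ)) (η : Sph n) =>
        ∑ a ∈ s, solid n a.1 a.2 (F a.1 a.2) (√t • (η : Cn n)))
        (fun η => f (√t • (η : Cn n))) Filter.atTop := by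
      rw [Metric.tendstoUniformly_iff]
      rw [Metric.tendstoUniformlyOn_iff] at hu
      intro ε hε
      filter_upwards [hu ε hε] with s hs' η using by simpa using hs' _ ⟨η, rfl⟩
    exact h2.continuous (Filter.Frequently.of_forall hterm)
  have hsolid : ∀ a : ℕ × ℕ, ∫ η : Sph n,
      solid n a.1 a.2 (F a.1 a.2) (√t • (η : Cn n)) * conj (G η) ∂(sigma n) =
      if a = (p, q) then gfun n p q t * ∫ η : Sph n, F p q η * conj (G η) ∂(sigma n) else 0 := by
    intro a
    simp only [solid_sph (hF a.1 a.2) ht.1.le, mul_assoc]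
    rw [integral_const_mul]
    split_ifs with h
    · rw [h]
    · rw [(hF a.1 a.2).orthogonal hn hG, mul_zero]
      intro h'
      simp only [Prod.mk.injEq, Nat.cast_inj] at h'
      exact h (Prod.ext h'.1 h'.2)
  have hlim : Filter.Tendsto (fun s : Finset (ℕ × ℕ) => ∫ η : Sph n,
      (∑ a ∈ s, solid n a.1 a.2 (F a.1 a.2) (√t • (η : Cn n))) * conj (G η) ∂(sigma n))
      Filter.atTop (𝓝 (∫ η : Sph n, f (√t • (η : Cn n)) * conj (G η) ∂(sigma n))) := by
    rw [Metric.tendsto_nhds]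
    intro ε hε
    have : IsProbabilityMeasure (sigma n) := ⟨sigma_univ hn1⟩
    rw [Metric.tendstoUniformlyOn_iff] at hu
    have hD' : 0 < |D| + 1 := by positivity
    filter_upwards [hu (ε / 2 / (|D| + 1)) (by positivity)] with s hs'
    rw [dist_eq_norm, ← integral_sub
      (sph_integrable (continuous_sph_mul_conj (hterm s) hG.continuous_sph))
      (sph_integrable (continuous_sph_mul_conj hfc hG.continuous_sph))]
    refine lt_of_le_of_lt (norm_integral_le_of_norm_le_const (C := ε / 2)
      (Filter.Eventually.of_forall fun η => ?_)) (by simpa using hε)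
    rw [← sub_mul, norm_mul, RCLike.norm_conj, ← dist_eq_norm, dist_comm]
    have h1 := (hs' _ ⟨η, rfl⟩).le
    have h2 : ‖G η‖ ≤ |D| + 1 := (hD η trivial).trans ((le_abs_self D).trans (by linarith))
    calc _ ≤ ε / 2 / (|D| + 1) * (|D| + 1) := by gcongr
      _ = ε / 2 := div_mul_cancel₀ _ hD'.ne'
  have hev : (fun s : Finset (ℕ × ℕ) => ∫ η : Sph n,
      (∑ a ∈ s, solid n a.1 a.2 (F a.1 a.2) (√t • (η : Cn n))) * conj (G η) ∂(sigma n))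
      =ᶠ[Filter.atTop] fun _ => gfun n p q t * ∫ η : Sph n, F p q η * conj (G η) ∂(sigma n) := by
    -- By orthogonality the integral of a partial sum is already equal to the limit once the finite
    -- set contains `(p, q)`.
    filter_upwards [Filter.eventually_ge_atTop {(p, q)}] with s hs'
    simp only [Finset.sum_mul]
    rw [integral_finsetSum _ fun a _ => sph_integrable (continuous_sph_mul_conj
      (continuous_sph_dilate (contDiffOn_solid hn1 (hF a.1 a.2)).continuousOn ht)
      hG.continuous_sph)]
    simp only [hsolid]
    rw [Finset.sum_ite_eq', if_pos (hs' (Finset.mem_singleton_self _))]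
  exact tendsto_nhds_unique hlim (tendsto_const_nhds.congr' hev.symm)

/-- On the sphere through `z` both functions have the same coefficients against all bigraded
harmonics, so completeness identifies them. The origin lies on no such sphere and is reached by
continuity in `IsCoeff.eqOn_solidSum`. -/
lemma IsCoeff.eq_solidSum (hn : 2 ≤ n) {f : Cn n → ℂ} (hf : ContinuousOn f (unitBall n))
    {F : ℕ → ℕ → Cn n → ℂ} (h : IsCoeff f F) {z : Cn n} (hz : z ∈ unitBall n) (hz0 : z ≠ 0) :
    f z = solidSum F z := by
  have hn1 : 1 ≤ n := by omega
  have hA := h.admissible hn1 hf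
  have hg := isCoeff_of_hasSum hn h.1 (hA.hasSumLocallyUniformlyOn hn)
  have hgc := hA.continuousOn_solidSum hn
  have hzn : 0 < ‖z‖ := norm_pos_iff.2 hz0
  have hz1 : ‖z‖ < 1 := by simpa using hz
  have ht : ‖z‖ ^ 2 ∈ Set.Ioo (0 : ℝ) 1 := ⟨by positivity, by nlinarith⟩
  have c1 := continuous_sph_dilate hf ht
  have c2 := continuous_sph_dilate hgc ht
  have h0 := eq_zero_of_forall_orthogonal hn1 (c1.sub c2) (fun p q G hG => by
    have i1 := sph_integrable (continuous_sph_mul_conj c1 hG.continuous_sph)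
    have i2 := sph_integrable (continuous_sph_mul_conj c2 hG.continuous_sph)
    have e4 := integral_sub i1 i2
    rw [h.2 p q G hG _ ht, hg.2 p q G hG _ ht, sub_self] at e4
    rw [← e4]
    exact integral_congr_ae (Filter.Eventually.of_forall fun η => sub_mul _ _ _))
  have h1 := congrFun h0 ⟨‖z‖⁻¹ • z, by
    rw [mem_sphere_zero_iff_norm, norm_smul, norm_inv, norm_norm, inv_mul_cancel₀ hzn.ne']⟩
  simp only [Pi.sub_apply, Real.sqrt_sq hzn.le, smul_smul, mul_inv_cancel₀ hzn.ne', one_smul,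
    Pi.zero_apply] at h1
  exact sub_eq_zero.1 h1

lemma IsCoeff.eqOn_solidSum (hn : 2 ≤ n) {f : Cn n → ℂ} (hf : ContinuousOn f (unitBall n))
    {F : ℕ → ℕ → Cn n → ℂ} (h : IsCoeff f F) : Set.EqOn f (solidSum F) (unitBall n) := by
  have hn1 : 1 ≤ n := by omega
  intro z hz
  by_cases hz0 : z = 0
  · subst hz0
    have hc1 := hf.continuousAt (Metric.isOpen_ball.mem_nhds hz)
    have hc2 := ((h.admissible hn1 hf).continuousOn_solidSum hn).continuousAt
      (Metric.isOpen_ball.mem_nhds hz)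
    have : Nontrivial (Cn n) := by
      have : Nonempty (Fin n) := ⟨⟨0, by omega⟩⟩
      infer_instance
    have hev : f =ᶠ[𝓝[≠] 0] solidSum F := by
      filter_upwards [self_mem_nhdsWithin,
        nhdsWithin_le_nhds (Metric.isOpen_ball.mem_nhds hz)] with w hw hwb
      exact h.eq_solidSum hn hf hwb hw
    have : (𝓝[≠] (0 : Cn n)).NeBot := Module.punctured_nhds_neBot ℝ (Cn n) 0
    exact tendsto_nhds_unique (hc1.mono_left nhdsWithin_le_nhds)
      ((hc2.mono_left nhdsWithin_le_nhds).congr' hev.symm)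
  · exact h.eq_solidSum hn hf hz hz0

/-- Replaces the convergence statement by integral conditions. Uniqueness, smoothness and Parseval
are then all derived from `IsCoeff`. -/
lemma isPeterWeyl_iff (hn : 2 ≤ n) {f : Cn n → ℂ} (hf : ContinuousOn f (unitBall n))
    (F : ℕ → ℕ → Cn n → ℂ) : IsPeterWeyl f F ↔ IsCoeff f F := by
  constructor
  · intro h
    exact isCoeff_of_hasSum hn (fun p q => (isBigradedHarmonic_iff p q _).1 (h.1 p q)) h.2
  · intro h
    refine ⟨fun p q => (isBigradedHarmonic_iff p q _).2 (h.1 p q), ?_⟩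
    have := (h.admissible (by omega) hf).hasSumLocallyUniformlyOn hn
    rw [hasSumLocallyUniformlyOn_iff_tendstoLocallyUniformlyOn] at this ⊢
    exact this.congr_right fun z hz => (h.eqOn_solidSum hn hf hz).symm

lemma IsMHarmonic.existsUnique_isPeterWeyl (hn : 2 ≤ n) {f : Cn n → ℂ} (hf : IsMHarmonic f) :
    ∃! F, IsPeterWeyl f F := by
  have hfc := hf.1.continuousOn
  obtain ⟨F, hF⟩ := hf.exists_isCoeff hn
  exact ⟨F, (isPeterWeyl_iff hn hfc F).2 hF, fun F' hF' =>
    ((isPeterWeyl_iff hn hfc F').1 hF').unique hn hF⟩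

/-! ### First order operators with smooth coefficients -/

/-- A homogeneous first order differential operator with smooth coefficients. -/
def FirstOrder (T : (Cn n → ℂ) → Cn n → ℂ) : Prop :=
  ∃ M : Cn n → (Cn n →L[ℝ] ℂ) →L[ℝ] ℂ, ContDiff ℝ ∞ M ∧ ∀ f z, T f z = M z (fderiv ℝ f z)

/-- Evaluation of linear forms at a point. -/
def evalL (n : ℕ) : Cn n →L[ℝ] (Cn n →L[ℝ] ℂ) →L[ℝ] ℂ :=
  (ContinuousLinearMap.id ℝ (Cn n →L[ℝ] ℂ)).flip

lemma firstOrder_opN : FirstOrder (opN (n := n)) :=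
  ⟨evalL n, by fun_prop, fun f z => opN_eq_lin f z⟩

lemma firstOrder_opX (α : XIndex n) : FirstOrder (opX (n := n) α) := by
  obtain ⟨A, B, a, b, -, -, h⟩ := opX_eq_lin α
  have hA : ∀ L : Cn n →L[ℝ] Cn n, ContDiff ℝ ∞ fun z => evalL n (L z) := fun L => by
    fun_prop
  exact ⟨fun z => a • evalL n (A z) + b • evalL n (B z),
    ((hA A).const_smul a).add ((hA B).const_smul b), fun f z => h f z⟩

lemma firstOrder_wd (i : Fin n ⊕ Fin n) : FirstOrder (wd (n := n) i) :=
  ⟨fun _ => wl i, contDiff_const, fun f z => wd_eq i f z⟩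

/-- The size of the `k`-jet of `f` at `z`. -/
def jet {E : Type*} [NormedAddCommGroup E] [NormedSpace ℝ E] (k : ℕ) (f : Cn n → E)
    (z : Cn n) : ℝ :=
  ∑ i ∈ Finset.range (k + 1), ‖iteratedFDeriv ℝ i f z‖

lemma norm_iteratedFDeriv_le_jet {i k : ℕ} (hi : i ≤ k) (f : Cn n → ℂ) (z : Cn n) :
    ‖iteratedFDeriv ℝ i f z‖ ≤ jet k f z :=
  Finset.single_le_sum (f := fun i => ‖iteratedFDeriv ℝ i f z‖) (fun _ _ => norm_nonneg _)
    (Finset.mem_range.2 (by omega))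

lemma jet_mono {i k : ℕ} (hi : i ≤ k) (f : Cn n → ℂ) (z : Cn n) : jet i f z ≤ jet k f z :=
  Finset.sum_le_sum_of_subset_of_nonneg (Finset.range_mono (by omega)) fun _ _ _ => norm_nonneg _

lemma norm_le_jet (k : ℕ) (f : Cn n → ℂ) (z : Cn n) : ‖f z‖ ≤ jet k f z := by
  have := norm_iteratedFDeriv_le_jet (Nat.zero_le k) f z
  rwa [norm_iteratedFDeriv_zero] at this

lemma contDiffOn_fderiv_ball {E : Type*} [NormedAddCommGroup E] [NormedSpace ℝ E] {f : Cn n → E}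
    (hf : ContDiffOn ℝ ∞ f (unitBall n)) : ContDiffOn ℝ ∞ (fderiv ℝ f) (unitBall n) :=
  ((contDiffOn_infty_iff_fderiv_of_isOpen Metric.isOpen_ball).1 hf).2

lemma FirstOrder.contDiffOn {T : (Cn n → ℂ) → Cn n → ℂ} (hT : FirstOrder T) {f : Cn n → ℂ}
    (hf : ContDiffOn ℝ ∞ f (unitBall n)) : ContDiffOn ℝ ∞ (T f) (unitBall n) := by
  obtain ⟨M, hM, h⟩ := hT
  rw [show T f = fun z => M z (fderiv ℝ f z) from funext (h f)]
  exact hM.contDiffOn.clm_apply (contDiffOn_fderiv_ball hf)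

lemma FirstOrder.eqOn {T : (Cn n → ℂ) → Cn n → ℂ} (hT : FirstOrder T) {f g : Cn n → ℂ}
    (h : Set.EqOn f g (unitBall n)) : Set.EqOn (T f) (T g) (unitBall n) := by
  obtain ⟨M, -, hM⟩ := hT
  intro z hz
  rw [hM, hM, (h.eventuallyEq_of_mem (Metric.isOpen_ball.mem_nhds hz)).fderiv_eq]

/-- Leibniz' rule. The coefficient map is smooth on the whole space, so its derivatives are bounded
on the closed ball and the constant is uniform up to the boundary. -/
lemma FirstOrder.exists_jet_le {T : (Cn n → ℂ) → Cn n → ℂ} (hT : FirstOrder T) (k : ℕ) :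
    ∃ C : ℝ, 0 ≤ C ∧ ∀ f, ContDiffOn ℝ ∞ f (unitBall n) → ∀ z ∈ unitBall n,
      jet k (T f) z ≤ C * jet (k + 1) f z := by
  obtain ⟨M, hM, h⟩ := hT
  have hD : ∀ i : ℕ, ∃ D : ℝ, ∀ z ∈ unitBall n, ‖iteratedFDeriv ℝ i M z‖ ≤ D := fun i => by
    obtain ⟨D, hD⟩ := (isCompact_closedBall (0 : Cn n) 1).exists_bound_of_continuousOn
      ((hM.continuous_iteratedFDeriv (m := i) (by exact_mod_cast le_top)).continuousOn)
    exact ⟨D, fun z hz => hD z (Metric.ball_subset_closedBall hz)⟩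
  choose D hD using hD
  refine ⟨∑ j ∈ Finset.range (k + 1), ∑ i ∈ Finset.range (j + 1), (j.choose i : ℝ) * |D i|,
    by positivity, fun f hf z hz => ?_⟩
  rw [show T f = fun z => M z (fderiv ℝ f z) from funext (h f), jet, Finset.sum_mul]
  refine Finset.sum_le_sum fun j hj => ?_
  rw [← iteratedFDerivWithin_of_isOpen j Metric.isOpen_ball hz]
  refine (norm_iteratedFDerivWithin_clm_apply (N := (∞ : WithTop ℕ∞)) hM.contDiffOn
    (contDiffOn_fderiv_ball hf)
    Metric.isOpen_ball.uniqueDiffOn hz (by exact_mod_cast le_top)).trans ?_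
  rw [Finset.sum_mul]
  refine Finset.sum_le_sum fun i hi => ?_
  rw [iteratedFDerivWithin_of_isOpen _ Metric.isOpen_ball hz,
    iteratedFDerivWithin_of_isOpen _ Metric.isOpen_ball hz, norm_iteratedFDeriv_fderiv]
  have hj' := Finset.mem_range.1 hj
  have h1 := norm_iteratedFDeriv_le_jet (show j - i + 1 ≤ k + 1 by omega) f z
  have h2 := (hD i z hz).trans (le_abs_self _)
  gcongr

lemma contDiffOn_iterX {r : ℕ} (J : Fin r → XIndex n) {f : Cn n → ℂ}
    (hf : ContDiffOn ℝ ∞ f (unitBall n)) : ContDiffOn ℝ ∞ (iterX J f) (unitBall n) := by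
  induction r with
  | zero => rwa [iterX_zero]
  | succ r ih =>
    rw [← Fin.cons_self_tail J, iterX_cons]
    exact (firstOrder_opX _).contDiffOn (ih _)

lemma contDiffOn_opN_iterate (k : ℕ) {f : Cn n → ℂ}
    (hf : ContDiffOn ℝ ∞ f (unitBall n)) : ContDiffOn ℝ ∞ (opN^[k] f) (unitBall n) := by
  induction k with
  | zero => exact hf
  | succ k ih => rw [Function.iterate_succ_apply']; exact firstOrder_opN.contDiffOn ih

lemma eqOn_iterX {r : ℕ} (J : Fin r → XIndex n) {f g : Cn n → ℂ}
    (h : Set.EqOn f g (unitBall n)) : Set.EqOn (iterX J f) (iterX J g) (unitBall n) := by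
  induction r with
  | zero => rwa [iterX_zero, iterX_zero]
  | succ r ih =>
    rw [← Fin.cons_self_tail J, iterX_cons, iterX_cons]
    exact (firstOrder_opX _).eqOn (ih _)

lemma eqOn_opN_iterate (k : ℕ) {f g : Cn n → ℂ}
    (h : Set.EqOn f g (unitBall n)) : Set.EqOn (opN^[k] f) (opN^[k] g) (unitBall n) := by
  induction k with
  | zero => exact h
  | succ k ih =>
    rw [Function.iterate_succ_apply', Function.iterate_succ_apply']
    exact firstOrder_opN.eqOn ih

lemma exists_jet_iterX_le {r : ℕ} (J : Fin r → XIndex n) : ∀ k : ℕ,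
    ∃ C : ℝ, 0 ≤ C ∧ ∀ f, ContDiffOn ℝ ∞ f (unitBall n) → ∀ z ∈ unitBall n,
      jet k (iterX J f) z ≤ C * jet (k + r) f z := by
  induction r with
  | zero => exact fun k => ⟨1, zero_le_one, fun f _ z _ => by rw [iterX_zero, one_mul, add_zero]⟩
  | succ r ih =>
    intro k
    obtain ⟨C₁, h₁, hC₁⟩ := (firstOrder_opX (J 0)).exists_jet_le k
    obtain ⟨C₂, h₂, hC₂⟩ := ih (Fin.tail J) (k + 1)
    refine ⟨C₁ * C₂, by positivity, fun f hf z hz => ?_⟩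
    rw [← Fin.cons_self_tail J, iterX_cons]
    refine (hC₁ _ (contDiffOn_iterX _ hf) z hz).trans ?_
    have := hC₂ f hf z hz
    rw [mul_assoc, show k + (r + 1) = k + 1 + r by omega]
    gcongr

lemma exists_jet_opN_iterate_le (l : ℕ) : ∀ k : ℕ,
    ∃ C : ℝ, 0 ≤ C ∧ ∀ f : Cn n → ℂ, ContDiffOn ℝ ∞ f (unitBall n) → ∀ z ∈ unitBall n,
      jet k (opN^[l] f) z ≤ C * jet (k + l) f z := by
  induction l with
  | zero => exact fun k => ⟨1, zero_le_one, fun f _ z _ => by simp⟩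
  | succ l ih =>
    intro k
    obtain ⟨C₁, h₁, hC₁⟩ := firstOrder_opN.exists_jet_le (n := n) k
    obtain ⟨C₂, h₂, hC₂⟩ := ih (k + 1)
    refine ⟨C₁ * C₂, by positivity, fun f hf z hz => ?_⟩
    rw [Function.iterate_succ_apply']
    refine (hC₁ _ (contDiffOn_opN_iterate _ hf) z hz).trans ?_
    have := hC₂ f hf z hz
    rw [mul_assoc, show k + (l + 1) = k + 1 + l by omega]
    gcongr

/-! ### Termwise differentiation -/

/-- A series of smooth functions all of whose derivatives are normally convergent on smaller
balls. -/
def SmoothSeries {E : Type} [NormedAddCommGroup E] [NormedSpace ℝ E] (u : ℕ × ℕ → Cn n → E) :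
    Prop :=
  (∀ a, ContDiffOn ℝ ∞ (u a) (unitBall n)) ∧ ∀ (k : ℕ) (ρ : ℝ), 0 ≤ ρ → ρ < 1 →
    ∃ v : ℕ × ℕ → ℝ, Summable v ∧ ∀ a z, ‖z‖ ≤ ρ → ‖iteratedFDeriv ℝ k (u a) z‖ ≤ v a

section

variable {E : Type} [NormedAddCommGroup E] [NormedSpace ℝ E] {u : ℕ × ℕ → Cn n → E}

lemma SmoothSeries.fderiv (h : SmoothSeries u) : SmoothSeries fun a => fderiv ℝ (u a) := by
  refine ⟨fun a => contDiffOn_fderiv_ball (h.1 a), fun k ρ h0 h1 => ?_⟩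
  obtain ⟨v, hv, hb⟩ := h.2 (k + 1) ρ h0 h1
  refine ⟨v, hv, fun a z hz => ?_⟩
  rw [norm_iteratedFDeriv_fderiv]
  exact hb a z hz

variable [CompleteSpace E]

lemma SmoothSeries.summable (h : SmoothSeries u) {z : Cn n} (hz : z ∈ unitBall n) :
    Summable fun a => u a z := by
  obtain ⟨v, hv, hb⟩ := h.2 0 ‖z‖ (norm_nonneg z) (by simpa using hz)
  refine .of_norm_bounded hv fun a => ?_
  have := hb a z le_rfl
  rwa [norm_iteratedFDeriv_zero] at this

lemma SmoothSeries.hasFDerivAt (h : SmoothSeries u) {z : Cn n} (hz : z ∈ unitBall n) :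
    HasFDerivAt (fun y => ∑' a, u a y) (∑' a, _root_.fderiv ℝ (u a) z) z := by
  have hz1 : ‖z‖ < 1 := by simpa using hz
  obtain ⟨ρ, h0, h1⟩ := exists_between hz1
  obtain ⟨v, hv, hb⟩ := h.fderiv.2 0 ρ ((norm_nonneg z).trans h0.le) h1
  have hzρ : z ∈ Metric.ball (0 : Cn n) ρ := by simpa using h0
  refine hasFDerivAt_tsum_of_isPreconnected hv Metric.isOpen_ball
    (convex_ball (0 : Cn n) ρ).isPreconnected (fun a w hw => ?_) (fun a w hw => ?_) hzρ
    (h.summable hz) hzρ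
  · have hw1 : w ∈ unitBall n := Metric.ball_subset_ball h1.le hw
    exact (((h.1 a).contDiffAt (Metric.isOpen_ball.mem_nhds hw1)).differentiableAt
      (by simp)).hasFDerivAt
  · have := hb a w (by simpa using (mem_ball_zero_iff.1 hw).le)
    rwa [norm_iteratedFDeriv_zero] at this

end

/-- The induction passes from the series to the series of its Fréchet derivatives, so the target
space changes at each step and must be quantified inside. -/
lemma SmoothSeries.contDiffOn_nat (k : ℕ) : ∀ {E : Type} [NormedAddCommGroup E] [NormedSpace ℝ E]
    [CompleteSpace E] {u : ℕ × ℕ → Cn n → E}, SmoothSeries u →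
    ContDiffOn ℝ k (fun y => ∑' a, u a y) (unitBall n) := by
  induction k with
  | zero =>
    intro E _ _ _ u h
    exact contDiffOn_zero.2 fun z hz => (h.hasFDerivAt hz).continuousAt.continuousWithinAt
  | succ k ih =>
    intro E _ _ _ u h
    push_cast
    rw [contDiffOn_succ_iff_fderiv_of_isOpen Metric.isOpen_ball]
    refine ⟨fun z hz => (h.hasFDerivAt hz).differentiableAt.differentiableWithinAt, by simp, ?_⟩
    exact (ih h.fderiv).congr fun z hz => (h.hasFDerivAt hz).fderiv

lemma SmoothSeries.contDiffOn {u : ℕ × ℕ → Cn n → ℂ} (h : SmoothSeries u) :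
    ContDiffOn ℝ ∞ (fun y => ∑' a, u a y) (unitBall n) :=
  contDiffOn_infty.2 fun k => SmoothSeries.contDiffOn_nat k h

lemma FirstOrder.smoothSeries {T : (Cn n → ℂ) → Cn n → ℂ} (hT : FirstOrder T)
    {u : ℕ × ℕ → Cn n → ℂ} (h : SmoothSeries u) : SmoothSeries fun a => T (u a) := by
  refine ⟨fun a => hT.contDiffOn (h.1 a), fun k ρ h0 h1 => ?_⟩
  obtain ⟨C, hC0, hC⟩ := hT.exists_jet_le k
  choose v hv hb using fun i : ℕ => h.2 i ρ h0 h1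
  refine ⟨fun a => C * ∑ i ∈ Finset.range (k + 1 + 1), v i a,
    (summable_sum fun i _ => hv i).mul_left C, fun a z hz => ?_⟩
  have hzb : z ∈ unitBall n := by simp; linarith
  refine (norm_iteratedFDeriv_le_jet le_rfl _ z).trans ((hC _ (h.1 a) z hzb).trans ?_)
  exact mul_le_mul_of_nonneg_left (Finset.sum_le_sum fun i _ => hb i a z hz) hC0

lemma FirstOrder.tsum {T : (Cn n → ℂ) → Cn n → ℂ} (hT : FirstOrder T)
    {u : ℕ × ℕ → Cn n → ℂ} (h : SmoothSeries u) :
    Set.EqOn (T fun y => ∑' a, u a y) (fun y => ∑' a, T (u a) y) (unitBall n) := by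
  obtain ⟨M, -, hM⟩ := hT
  intro z hz
  simp only [hM]
  rw [(h.hasFDerivAt hz).fderiv]
  exact (M z).map_tsum (h.fderiv.summable hz)

lemma SmoothSeries.iterX {u : ℕ × ℕ → Cn n → ℂ} (h : SmoothSeries u) {r : ℕ}
    (J : Fin r → XIndex n) : SmoothSeries (fun a => iterX J (u a)) ∧
      Set.EqOn (iterX J fun y => ∑' a, u a y) (fun y => ∑' a, MHarm.iterX J (u a) y) (unitBall n) := by
  induction r with
  | zero => simp only [iterX_zero]; exact ⟨h, fun _ _ => rfl⟩
  | succ r ih =>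
    rw [← Fin.cons_self_tail J]
    simp only [iterX_cons]
    obtain ⟨h1, h2⟩ := ih (Fin.tail J)
    exact ⟨(firstOrder_opX _).smoothSeries h1,
      ((firstOrder_opX _).eqOn h2).trans ((firstOrder_opX _).tsum h1)⟩

lemma SmoothSeries.opN_iterate {u : ℕ × ℕ → Cn n → ℂ} (h : SmoothSeries u) (k : ℕ) :
    SmoothSeries (fun a => opN^[k] (u a)) ∧
      Set.EqOn (opN^[k] fun y => ∑' a, u a y) (fun y => ∑' a, opN^[k] (u a) y) (unitBall n) := by
  induction k with
  | zero => exact ⟨h, fun _ _ => rfl⟩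
  | succ k ih =>
    simp only [Function.iterate_succ_apply']
    obtain ⟨h1, h2⟩ := ih
    exact ⟨firstOrder_opN.smoothSeries h1, (firstOrder_opN.eqOn h2).trans (firstOrder_opN.tsum h1)⟩

lemma Admissible.smoothSeries (hn : 2 ≤ n) {F : ℕ → ℕ → Cn n → ℂ} (h : Admissible F) :
    SmoothSeries fun a : ℕ × ℕ => solid n a.1 a.2 (F a.1 a.2) :=
  ⟨fun a => contDiffOn_solid (by omega) (h.1 a.1 a.2), fun k _ h0 h1 => h.exists_bound hn k h0 h1⟩

lemma IsCoeff.contDiffOn (hn : 2 ≤ n) {f : Cn n → ℂ} (hf : ContinuousOn f (unitBall n))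
    {F : ℕ → ℕ → Cn n → ℂ} (h : IsCoeff f F) : ContDiffOn ℝ ∞ f (unitBall n) :=
  ((h.admissible (by omega) hf).smoothSeries hn).contDiffOn.congr (h.eqOn_solidSum hn hf)

/-! ### Normal and tangential derivatives of solid harmonics -/

/-- The real fields composing `X` are orthogonal to `z`, hence annihilate functions of `‖z‖²`. -/
lemma opX_S_norm_sq (hn : 1 ≤ n) (p q : ℕ) (α : XIndex n) {z : Cn n} (hz : z ∈ unitBall n) :
    opX α (fun z => (S n p q (‖z‖ ^ 2) : ℂ)) z = 0 := by
  obtain ⟨A, B, a, b, hA, hB, h⟩ := opX_eq_lin α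
  have h1 := ((nonnegSeries_S hn p q).hasDerivAt (abs_norm_sq_lt_one hz)).comp_hasFDerivAt z
    (hasStrictFDerivAt_norm_sq z).hasFDerivAt
  have h2 := (Complex.ofRealCLM.hasFDerivAt.comp z h1).fderiv
  have key : ∀ L : Cn n →L[ℝ] Cn n, (∀ z, inner ℝ (L z) z = 0) →
      lin L (fun z => (S n p q (‖z‖ ^ 2) : ℂ)) z = 0 := by
    intro L hL
    rw [lin]
    have : fderiv ℝ (fun z : Cn n => (S n p q (‖z‖ ^ 2) : ℂ)) z = _ := h2
    rw [this]
    have h0 : inner ℝ z (L z) = 0 := by rw [real_inner_comm, hL]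
    simp [h0]
  rw [h, key A hA, key B hB]
  simp

lemma opX_solid (hn : 1 ≤ n) (p q : ℕ) (α : XIndex n) {e : ℤ × ℤ} {G : Cn n → ℂ} (hG : BH e G) :
    Set.EqOn (opX α (solid n p q G)) (solid n p q (opX α G)) (unitBall n) := by
  intro z hz
  have hS : DifferentiableAt ℝ (fun z : Cn n => (S n p q (‖z‖ ^ 2) : ℂ)) z :=
    Complex.ofRealCLM.differentiableAt.comp z
      (((contDiffOn_S_norm_sq hn p q).contDiffAt (Metric.isOpen_ball.mem_nhds hz)).differentiableAt
        (by simp))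
  have := opX_mul α hS hG.1.differentiable.differentiableAt
  rw [opX_S_norm_sq hn p q α hz, zero_mul, zero_add] at this
  exact this

lemma iterX_solid (hn : 1 ≤ n) (p q : ℕ) {r : ℕ} (J : Fin r → XIndex n) {e : ℤ × ℤ}
    {G : Cn n → ℂ} (hG : BH e G) :
    Set.EqOn (iterX J (solid n p q G)) (solid n p q (iterX J G)) (unitBall n) := by
  induction r with
  | zero => simp only [iterX_zero]; exact fun _ _ => rfl
  | succ r ih =>
    rw [← Fin.cons_self_tail J, iterX_cons, iterX_cons]
    exact ((firstOrder_opX _).eqOn (ih _)).trans (opX_solid hn p q _ (hG.iterX _))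

lemma BH.real_smul_eq_of_add_eq {e : ℤ × ℤ} {G : Cn n → ℂ} (hG : BH e G) {d : ℕ}
    (he : e.1 + e.2 = d) (r : ℝ) (z : Cn n) : G (r • z) = (r : ℂ) ^ d * G z := by
  by_cases hneg : e.1 < 0 ∨ e.2 < 0
  · rw [hG.eq_zero_of_neg hneg, mul_zero]
  push Not at hneg
  obtain ⟨p, hp⟩ := Int.eq_ofNat_of_zero_le hneg.1
  obtain ⟨q, hq⟩ := Int.eq_ofNat_of_zero_le hneg.2
  have hpq : d = p + q := by omega
  rw [hpq]
  exact (hG.congr (Prod.ext hp hq)).1.real_smul_eq r z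

lemma xshift_sum_total {r : ℕ} (J : Fin r → XIndex n) :
    (∑ i, xshift (J i)).1 + (∑ i, xshift (J i)).2 = 0 := by
  rw [Prod.fst_sum, Prod.snd_sum, ← Finset.sum_add_distrib]
  exact Finset.sum_eq_zero fun i _ => xshift_sum (J i)

lemma contDiffOn_gfun (hn : 1 ≤ n) (p q : ℕ) :
    ContDiffOn ℝ ∞ (gfun n p q) (Set.Ioo 0 1) := by
  refine ContDiffOn.mul (fun t ht => ?_) fun t ht => ?_
  · exact (Real.contDiffAt_rpow_const_of_ne ht.1.ne').contDiffWithinAt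
  · exact ((nonnegSeries_S hn p q).contDiffAt (by
      rw [abs_of_pos ht.1]; exact ht.2)).contDiffWithinAt

lemma contDiffOn_eulerOp_iterate {g : ℝ → ℝ} (hg : ContDiffOn ℝ ∞ g (Set.Ioo 0 1)) (k : ℕ) :
    ContDiffOn ℝ ∞ (eulerOp^[k] g) (Set.Ioo 0 1) := by
  induction k with
  | zero => exact hg
  | succ k ih =>
    rw [Function.iterate_succ_apply']
    exact (contDiff_const.mul contDiff_id).contDiffOn.mul
      ((contDiffOn_infty_iff_deriv_of_isOpen isOpen_Ioo).1 ih).2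

/-- Along a fixed ray both sides are differentiated in `t`, and `hasDerivAt_radial` and
`hasDerivAt_of_eulerOp` carry the same factor `1 / (2t)`, which cancels. -/
lemma opN_iterate_sph {u : Cn n → ℂ} (hu : ContDiffOn ℝ ∞ u (unitBall n)) {g : ℝ → ℝ}
    (hg : ContDiffOn ℝ ∞ g (Set.Ioo 0 1)) {η : Sph n} {c : ℂ}
    (h : ∀ t ∈ Set.Ioo (0 : ℝ) 1, u (√t • (η : Cn n)) = g t * c) (k : ℕ) :
    ∀ t ∈ Set.Ioo (0 : ℝ) 1, opN^[k] u (√t • (η : Cn n)) = (eulerOp^[k] g t : ℝ) * c := by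
  induction k with
  | zero => exact h
  | succ k ih =>
    intro t ht
    rw [Function.iterate_succ_apply', Function.iterate_succ_apply']
    have h1 := hasDerivAt_radial ht.1 (η : Cn n)
      (((contDiffOn_opN_iterate k hu).contDiffAt (Metric.isOpen_ball.mem_nhds
        (smul_sph_mem_ball ht η))).differentiableAt (by simp))
    have h2 := hasDerivAt_of_eulerOp ht.1 (((contDiffOn_eulerOp_iterate hg k).contDiffAt
      (isOpen_Ioo.mem_nhds ht)).differentiableAt (by simp))
    have hev : (fun t => opN^[k] u (√t • (η : Cn n))) =ᶠ[𝓝 t]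
        fun t => ((eulerOp^[k] g t : ℝ) : ℂ) * c := by
      filter_upwards [isOpen_Ioo.mem_nhds ht] with x hx using ih x hx
    have h3 := (h2.mul_const c).congr_of_eventuallyEq hev
    have h4 := h1.unique h3
    have ht0 : (t : ℂ) ≠ 0 := by exact_mod_cast ht.1.ne'
    rw [mul_assoc] at h4
    exact mul_left_cancel₀ (by simpa using ht0) h4

/-! ### Parseval's identity -/

lemma hasSum_integral_mul_conj {v : ℕ × ℕ → Sph n → ℂ} (hv : ∀ a, Continuous (v a))
    {w : ℕ × ℕ → ℝ} (hw : Summable w) (hvw : ∀ a η, ‖v a η‖ ≤ w a) {G : Sph n → ℂ}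
    (hG : Continuous G) :
    HasSum (fun a => ∫ η, v a η * conj (G η) ∂(sigma n))
      (∫ η, (∑' a, v a η) * conj (G η) ∂(sigma n)) := by
  obtain ⟨D, hD⟩ := (isCompact_univ (X := Sph n)).exists_bound_of_continuousOn hG.continuousOn
  have hi : ∀ a, Integrable (fun η => v a η * conj (G η)) (sigma n) := fun a =>
    sph_integrable (continuous_sph_mul_conj (hv a) hG)
  have hs : Summable fun a => ∫ η, ‖v a η * conj (G η)‖ ∂(sigma n) := by
    refine .of_nonneg_of_le (fun a => integral_nonneg fun η => norm_nonneg _) (fun a => ?_)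
      (hw.mul_right (|D| * (sigma n).real Set.univ))
    calc ∫ η, ‖v a η * conj (G η)‖ ∂(sigma n) ≤ ∫ _, w a * |D| ∂(sigma n) := by
          refine integral_mono (hi a).norm (integrable_const _) fun η => ?_
          dsimp only
          rw [norm_mul, RCLike.norm_conj]
          have h1 := hvw a η
          have h2 := (hD η trivial).trans (le_abs_self D)
          have h3 := (norm_nonneg _).trans h1
          gcongr
      _ = _ := by rw [integral_const, smul_eq_mul]; ring
  have := hasSum_integral_of_summable_integral_norm hi hs
  simpa only [tsum_mul_right] using this

/-- Uniform summability allows the sum to be integrated against its own conjugate term by term, and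
then each term to be paired with the sum again. Bidegrees enter through an arbitrary injective
labelling because the `X` shift them. -/
lemma parseval (hn : 2 ≤ n) {e : ℕ × ℕ → ℤ × ℤ} (he : Function.Injective e)
    {v : ℕ × ℕ → Cn n → ℂ} (hv : ∀ a, BH (e a) (v a)) (c : ℕ × ℕ → ℝ) {w : ℕ × ℕ → ℝ}
    (hw : Summable w) (hvw : ∀ a (η : Sph n), ‖c a * v a η‖ ≤ w a) :
    ∫⁻ η : Sph n, ‖∑' a, c a * v a η‖ₑ ^ 2 ∂(sigma n) =
      ∑' a, ENNReal.ofReal (c a ^ 2 * nrm2 (v a)) := by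
  let V : ℕ × ℕ → Sph n → ℂ := fun a η => c a * v a η
  have hVc : ∀ a, Continuous (V a) := fun a => continuous_const.mul (hv a).continuous_sph
  let h : Sph n → ℂ := fun η => ∑' a, V a η
  have hc : Continuous h := continuous_tsum hVc hw hvw
  have h1 := hasSum_integral_mul_conj hVc hw hvw hc
  have h2 : ∀ a, ∫ η, V a η * conj (h η) ∂(sigma n) = ((c a ^ 2 * nrm2 (v a) : ℝ) : ℂ) := by
    intro a
    have h3 := hasSum_integral_mul_conj hVc hw hvw (hVc a)
    have h4 : ∀ b, ∫ η, V b η * conj (V a η) ∂(sigma n) =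
        if b = a then ((c a ^ 2 * nrm2 (v a) : ℝ) : ℂ) else 0 := by
      intro b
      have e1 : ∀ η, V b η * conj (V a η) = (c b * c a) * (v b η * conj (v a η)) := fun η => by
        simp only [V, map_mul, Complex.conj_ofReal]; ring
      simp only [e1]
      rw [integral_const_mul]
      split_ifs with hba
      · subst hba; rw [← ofReal_nrm2]; push_cast; ring
      · rw [(hv b).orthogonal hn (hv a) fun h => hba (he h), mul_zero]
    simp only [h4] at h3
    have h5 := h3.unique (hasSum_ite_eq a _)
    rw [← Complex.conj_ofReal, ← h5, ← integral_conj]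
    refine integral_congr_ae (Filter.Eventually.of_forall fun η => ?_)
    dsimp only
    rw [map_mul, Complex.conj_conj, mul_comm]
  simp only [h2] at h1
  have h6 : ∫ η, h η * conj (h η) ∂(sigma n) = ((∫ η, ‖h η‖ ^ 2 ∂(sigma n) : ℝ) : ℂ) := by
    rw [← integral_complex_ofReal]
    refine integral_congr_ae (Filter.Eventually.of_forall fun η => ?_)
    simp [Complex.mul_conj, Complex.normSq_eq_norm_sq]
  have h7 : HasSum (fun a => c a ^ 2 * nrm2 (v a)) (∫ η, ‖h η‖ ^ 2 ∂(sigma n)) := by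
    rw [← Complex.hasSum_ofReal, ← h6]; exact h1
  have h8 : ∀ a, 0 ≤ c a ^ 2 * nrm2 (v a) := fun a => mul_nonneg (sq_nonneg _) (nrm2_nonneg _)
  rw [← ENNReal.ofReal_tsum_of_nonneg h8 h7.summable, h7.tsum_eq,
    ofReal_integral_eq_lintegral_ofReal (sph_integrable (g := fun η => ‖h η‖ ^ 2) (hc.norm.pow 2))
      (Filter.Eventually.of_forall fun η => sq_nonneg _)]
  exact lintegral_congr fun η => enorm_sq_eq _

lemma IsCoeff.sphereSqNorm_eq (hn : 2 ≤ n) {f : Cn n → ℂ} (hf : ContinuousOn f (unitBall n))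
    {F : ℕ → ℕ → Cn n → ℂ} (h : IsCoeff f F) (k : ℕ) {r : ℕ} (J : Fin r → XIndex n)
    {t : ℝ} (ht : t ∈ Set.Ioo (0 : ℝ) 1) :
    sphereSqNorm (fun z => opN^[k] (iterX J f) (√t • z)) =
      ∑' a : ℕ × ℕ, ENNReal.ofReal ((eulerOp^[k] (gfun n a.1 a.2) t) ^ 2 *
        nrm2 (iterX J (F a.1 a.2))) := by
  have hn1 : 1 ≤ n := by omega
  have hSS := (h.admissible hn1 hf).smoothSeries hn
  obtain ⟨s1, e1⟩ := hSS.iterX J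
  obtain ⟨s2, e2⟩ := s1.opN_iterate k
  have e3 : Set.EqOn (opN^[k] (iterX J f)) _ (unitBall n) :=
    (eqOn_opN_iterate k ((eqOn_iterX J (h.eqOn_solidSum hn hf)).trans e1)).trans e2
  have hterm : ∀ (a : ℕ × ℕ) (η : Sph n),
      opN^[k] (iterX J (solid n a.1 a.2 (F a.1 a.2))) (√t • (η : Cn n)) =
        ((eulerOp^[k] (gfun n a.1 a.2) t : ℝ) : ℂ) * iterX J (F a.1 a.2) η := by
    intro a η
    refine opN_iterate_sph (s1.1 a) (contDiffOn_gfun hn1 a.1 a.2) (fun t' ht' => ?_) k t ht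
    dsimp only
    rw [iterX_solid hn1 a.1 a.2 J (h.1 a.1 a.2) (smul_sph_mem_ball ht' η), solid, norm_smul_sph,
      Real.sq_sqrt ht'.1.le, ((h.1 a.1 a.2).iterX J).real_smul_eq_of_add_eq (d := a.1 + a.2) (by
        have := xshift_sum_total J
        simp only [Prod.fst_add, Prod.snd_add]
        push_cast
        linarith), gfun_eq ht'.1.le]
    push_cast
    ring
  obtain ⟨w, hw, hb⟩ := s2.2 0 (√t) (Real.sqrt_nonneg t) (by
    rw [Real.sqrt_lt' one_pos]; simpa using ht.2)
  -- Applying a word `J` translates all bidegrees by one vector depending on `J` alone, so distinct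
  -- components stay distinct and orthogonal.
  have hP := parseval hn (e := fun a : ℕ × ℕ => (((a.1 : ℤ), (a.2 : ℤ)) : ℤ × ℤ) + ∑ i, xshift (J i))
    (fun a b hab => by
      have := add_right_cancel hab
      simp only [Prod.mk.injEq, Nat.cast_inj] at this
      exact Prod.ext this.1 this.2)
    (v := fun a => iterX J (F a.1 a.2)) (fun a => (h.1 a.1 a.2).iterX J)
    (fun a => eulerOp^[k] (gfun n a.1 a.2) t) hw (fun a η => by
      rw [← hterm]
      have := hb a (√t • (η : Cn n)) (norm_smul_sph t η).le
      rwa [norm_iteratedFDeriv_zero] at this)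
  rw [← hP]
  refine lintegral_congr fun η => ?_
  dsimp only
  rw [e3 (smul_sph_mem_ball ht η)]
  simp only [hterm]

/-- Diagonalization of the norms: Parseval on each sphere, then Tonelli in `t`. The remaining radial
integral is exactly `coeff`, and since all terms are nonnegative no finiteness is required. -/
lemma IsCoeff.sqNorm_eq (hn : 2 ≤ n) {s : ℝ} (hs : -1 < s) {f : Cn n → ℂ}
    (hf : ContinuousOn f (unitBall n))
    {F : ℕ → ℕ → Cn n → ℂ} (h : IsCoeff f F) (k : ℕ) {r : ℕ} (J : Fin r → XIndex n) :
    sqNorm s (opN^[k] (iterX J f)) = polarConst n s *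
      ∑' a : ℕ × ℕ, coeff n a.1 a.2 k s * ENNReal.ofReal (nrm2 (iterX J (F a.1 a.2))) := by
  have hn1 : 1 ≤ n := by omega
  rw [sqNorm_polar hn1 hs (contDiffOn_opN_iterate k
    (contDiffOn_iterX J (h.contDiffOn hn hf))).continuousOn]
  congr 1
  have e1 : ∀ t ∈ Set.Ioo (0 : ℝ) 1, ENNReal.ofReal (t ^ (n - 1) * (1 - t) ^ s) *
      sphereSqNorm (fun z => opN^[k] (iterX J f) (√t • z)) =
      ∑' a : ℕ × ℕ, ENNReal.ofReal (t ^ (n - 1) * (1 - t) ^ s *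
        (eulerOp^[k] (gfun n a.1 a.2) t) ^ 2) * ENNReal.ofReal (nrm2 (iterX J (F a.1 a.2))) := by
    intro t ht
    rw [h.sphereSqNorm_eq hn hf k J ht, ← ENNReal.tsum_mul_left]
    refine tsum_congr fun a => ?_
    have h1 : 0 ≤ t ^ (n - 1) * (1 - t) ^ s :=
      mul_nonneg (pow_nonneg ht.1.le _) (Real.rpow_nonneg (by linarith [ht.2]) _)
    rw [← ENNReal.ofReal_mul h1, ← ENNReal.ofReal_mul (mul_nonneg h1 (sq_nonneg _))]
    congr 1
    ring
  rw [setLIntegral_congr_fun measurableSet_Ioo e1, lintegral_tsum fun a => ?_]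
  · refine tsum_congr fun a => ?_
    rw [lintegral_mul_const' _ _ ENNReal.ofReal_ne_top]
    rfl
  · refine AEMeasurable.mul_const (ENNReal.measurable_ofReal.comp_aemeasurable ?_) _
    refine ContinuousOn.aemeasurable ?_ measurableSet_Ioo
    refine ContinuousOn.mul (ContinuousOn.mul (by fun_prop) fun t ht => ?_)
      ((contDiffOn_eulerOp_iterate (contDiffOn_gfun hn1 a.1 a.2) k).continuousOn.pow 2)
    exact (((continuous_const.sub continuous_id).continuousAt (x := t)).rpow_const
      (Or.inl (by simp only [id, Pi.sub_apply]; linarith [ht.2]))).continuousWithinAt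

lemma IsCoeff.sum_sqNorm_eq (hn : 2 ≤ n) {s : ℝ} (hs : -1 < s) {f : Cn n → ℂ}
    (hf : ContinuousOn f (unitBall n))
    {F : ℕ → ℕ → Cn n → ℂ} (h : IsCoeff f F) (k r : ℕ) :
    ∑ J : Fin r → XIndex n, sqNorm s (opN^[k] (iterX J f)) = polarConst n s *
      ∑' a : ℕ × ℕ, coeff n a.1 a.2 k s * ENNReal.ofReal
        ((((a.1 + a.2 : ℕ) : ℝ) ^ 2 + 2 * (n - 1) * ((a.1 + a.2 : ℕ) : ℝ)) ^ r *
          nrm2 (F a.1 a.2)) := by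
  simp only [h.sqNorm_eq hn hs hf k]
  rw [← Finset.mul_sum, ← Summable.tsum_finsetSum fun _ _ => ENNReal.summable]
  congr 1
  refine tsum_congr fun a => ?_
  rw [← Finset.mul_sum, ← ENNReal.ofReal_sum_of_nonneg fun _ _ => nrm2_nonneg _,
    (h.1 a.1 a.2).sum_nrm2_iterX r]
  push_cast
  rfl

/-- The eigenvalue `d² + 2(n - 1)d` is at least `d²`. -/
lemma IsCoeff.coeffSum_le (hn : 2 ≤ n) {s : ℝ} (hs : -1 < s) {f : Cn n → ℂ}
    (hf : ContinuousOn f (unitBall n)) {F : ℕ → ℕ → Cn n → ℂ} (h : IsCoeff f F) (m : ℕ) :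
    polarConst n s * coeffSum m s F ≤ normalTangentialSum m s f := by
  rw [coeffSum, normalTangentialSum, Finset.mul_sum]
  refine Finset.sum_le_sum fun l _ => ?_
  rw [Finset.mul_sum]
  refine Finset.sum_le_sum fun k _ => ?_
  rw [h.sum_sqNorm_eq hn hs hf]
  refine mul_le_mul_right (ENNReal.tsum_le_tsum fun a => ?_) _
  rw [MHarm.sphereSqNorm_eq (h.1 a.1 a.2).continuous_sph, mul_comm (_ ^ _), mul_assoc]
  refine mul_le_mul_right ?_ _
  have hd : (0 : ℝ) ≤ ((a.1 + a.2 : ℕ) : ℝ) := Nat.cast_nonneg _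
  have hn' : (2 : ℝ) ≤ n := by exact_mod_cast hn
  rw [← ENNReal.ofReal_natCast, ← ENNReal.ofReal_pow hd, ← ENNReal.ofReal_mul (by positivity)]
  refine ENNReal.ofReal_le_ofReal (mul_le_mul_of_nonneg_right ?_ (nrm2_nonneg _))
  rw [pow_mul]
  gcongr
  nlinarith

lemma IsCoeff.normalTangentialSum_le (hn : 2 ≤ n) {s : ℝ} (hs : -1 < s) {f : Cn n → ℂ}
    (hf : ContinuousOn f (unitBall n)) {F : ℕ → ℕ → Cn n → ℂ} (h : IsCoeff f F) (m : ℕ) :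
    normalTangentialSum m s f ≤ polarConst n s * (2 * n) ^ m * coeffSum m s F := by
  rw [coeffSum, normalTangentialSum, Finset.mul_sum]
  refine Finset.sum_le_sum fun l hl => ?_
  rw [Finset.mul_sum]
  refine Finset.sum_le_sum fun k hk => ?_
  rw [h.sum_sqNorm_eq hn hs hf, mul_assoc]
  refine mul_le_mul_right ?_ _
  rw [← ENNReal.tsum_mul_left]
  refine ENNReal.tsum_le_tsum fun a => ?_
  rw [MHarm.sphereSqNorm_eq (h.1 a.1 a.2).continuous_sph]
  have hd : (0 : ℝ) ≤ ((a.1 + a.2 : ℕ) : ℝ) := Nat.cast_nonneg _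
  have hn' : (2 : ℝ) ≤ n := by exact_mod_cast hn
  have key : ENNReal.ofReal ((((a.1 + a.2 : ℕ) : ℝ) ^ 2 + 2 * (n - 1) * ((a.1 + a.2 : ℕ) : ℝ)) ^ (l - k) *
      nrm2 (F a.1 a.2)) ≤ (2 * n) ^ m * (((a.1 + a.2 : ℕ) : ℝ≥0∞) ^ (2 * (l - k)) *
        ENNReal.ofReal (nrm2 (F a.1 a.2))) := by
    have e1 : (2 * (n : ℝ≥0∞)) ^ m = ENNReal.ofReal ((2 * n) ^ m) := by
      rw [ENNReal.ofReal_pow (by positivity), ENNReal.ofReal_mul (by positivity)]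
      simp
    rw [e1, ← ENNReal.ofReal_natCast, ← ENNReal.ofReal_pow hd, ← ENNReal.ofReal_mul (by positivity),
      ← ENNReal.ofReal_mul (by positivity)]
    refine ENNReal.ofReal_le_ofReal ?_
    rw [← mul_assoc, pow_mul]
    refine mul_le_mul_of_nonneg_right ?_ (nrm2_nonneg _)
    -- The degree is a natural number, so `d ≤ d²`; this bounds the linear part of the eigenvalue
    -- and gives the factor `2n` per letter.
    have hd1 : ((a.1 + a.2 : ℕ) : ℝ) ≤ ((a.1 + a.2 : ℕ) : ℝ) ^ 2 := by
      exact_mod_cast Nat.le_self_pow two_ne_zero _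
    generalize ((a.1 + a.2 : ℕ) : ℝ) = d at hd hd1
    have h2 : d ^ 2 + 2 * (n - 1) * d ≤ 2 * n * d ^ 2 := by nlinarith
    calc (d ^ 2 + 2 * (n - 1) * d) ^ (l - k) ≤ (2 * n * d ^ 2) ^ (l - k) := by
          have : 0 ≤ d ^ 2 + 2 * (n - 1) * d := by
            have : (0 : ℝ) ≤ n - 1 := by linarith
            positivity
          gcongr
      _ = (2 * n : ℝ) ^ (l - k) * (d ^ 2) ^ (l - k) := mul_pow _ _ _
      _ ≤ (2 * n : ℝ) ^ m * (d ^ 2) ^ (l - k) := by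
          have h3 := Finset.mem_range.1 hl
          gcongr
          · linarith
          · omega
  calc _ ≤ coeff n a.1 a.2 k s * _ := mul_le_mul_right key _
    _ = _ := by ring

/-! ### Words in the Wirtinger derivatives -/

/-- Composition of Wirtinger derivatives along a word. -/
def wds (w : List (Fin n ⊕ Fin n)) (f : Cn n → ℂ) : Cn n → ℂ := w.foldr wd f

lemma wds_cons (i : Fin n ⊕ Fin n) (w : List (Fin n ⊕ Fin n)) (f : Cn n → ℂ) :
    wds (i :: w) f = wd i (wds w f) := rfl

lemma wds_append (w w' : List (Fin n ⊕ Fin n)) (f : Cn n → ℂ) :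
    wds (w ++ w') f = wds w (wds w' f) := List.foldr_append

lemma wds_replicate (k : ℕ) (i : Fin n ⊕ Fin n) (f : Cn n → ℂ) :
    wds (List.replicate k i) f = (wd i)^[k] f := by
  induction k with
  | zero => rfl
  | succ k ih => rw [List.replicate_succ, wds_cons, ih, Function.iterate_succ_apply']

/-- The word of a multi-index. -/
def gword (γ : Fin n ⊕ Fin n → ℕ) : List (Fin n ⊕ Fin n) :=
  (List.finRange n).flatMap fun j =>
    List.replicate (γ (Sum.inl j)) (Sum.inl j) ++ List.replicate (γ (Sum.inr j)) (Sum.inr j)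

lemma mixedDeriv_eq_wds (γ : Fin n ⊕ Fin n → ℕ) (f : Cn n → ℂ) :
    mixedDeriv γ f = wds (gword γ) f := by
  rw [mixedDeriv, gword]
  induction List.finRange n with
  | nil => rfl
  | cons j l ih =>
    rw [List.foldr_cons, List.flatMap_cons, wds_append, wds_append, wds_replicate, wds_replicate, ih]
    rfl

lemma length_gword (γ : Fin n ⊕ Fin n → ℕ) : (gword γ).length = ∑ i, γ i := by
  rw [gword, List.length_flatMap, Fintype.sum_sum_type, ← Finset.sum_add_distrib, Fin.sum_univ_def]
  simp

lemma count_gword (γ : Fin n ⊕ Fin n → ℕ) (i : Fin n ⊕ Fin n) : (gword γ : Multiset (Fin n ⊕ Fin n)).count i = γ i := by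
  rw [Multiset.coe_count, gword, @List.count_flatMap _ _ instBEqOfDecidableEq, ← Fin.sum_univ_def]
  cases i with
  | inl j => simp [List.count_replicate]
  | inr j => simp [List.count_replicate]

lemma contDiffOn_wds (w : List (Fin n ⊕ Fin n)) {f : Cn n → ℂ}
    (hf : ContDiffOn ℝ ∞ f (unitBall n)) : ContDiffOn ℝ ∞ (wds w f) (unitBall n) := by
  induction w with
  | nil => exact hf
  | cons i w ih => exact (firstOrder_wd i).contDiffOn ih

lemma wds_perm {w w' : List (Fin n ⊕ Fin n)} (h : w.Perm w') {f : Cn n → ℂ}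
    (hf : ContDiffOn ℝ ∞ f (unitBall n)) : Set.EqOn (wds w f) (wds w' f) (unitBall n) := by
  induction h with
  | nil => exact fun _ _ => rfl
  | cons i _ ih => exact (firstOrder_wd i).eqOn ih
  | swap i j w =>
    intro z hz
    exact wd_comm (((contDiffOn_wds w hf).contDiffAt (Metric.isOpen_ball.mem_nhds hz)).of_le
      two_le_smooth) _ _
  | trans _ _ h1 h2 => exact h1.trans h2

lemma wds_eqOn_mixedDeriv (w : List (Fin n ⊕ Fin n)) {f : Cn n → ℂ}
    (hf : ContDiffOn ℝ ∞ f (unitBall n)) :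
    Set.EqOn (wds w f) (mixedDeriv (fun i => (w : Multiset (Fin n ⊕ Fin n)).count i) f) (unitBall n) := by
  rw [mixedDeriv_eq_wds]
  refine wds_perm (Multiset.coe_eq_coe.1 (Multiset.ext.2 fun i => ?_)) hf
  rw [count_gword]

lemma sum_count (w : List (Fin n ⊕ Fin n)) :
    ∑ i, (w : Multiset (Fin n ⊕ Fin n)).count i = w.length := by
  rw [Multiset.sum_count_eq_card fun i _ => Finset.mem_univ i, Multiset.coe_card]

/-- The sum of the moduli of all Wirtinger derivatives of order `i`. -/
def wsum : ℕ → (Cn n → ℂ) → Cn n → ℝ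
  | 0, f, z => ‖f z‖
  | i + 1, f, z => ∑ j, wsum i (wd j f) z

lemma norm_iteratedFDeriv_succ_le (k : ℕ) : ∃ B : ℝ, 0 ≤ B ∧ ∀ f : Cn n → ℂ,
    ContDiffOn ℝ ∞ f (unitBall n) → ∀ z ∈ unitBall n,
    ‖iteratedFDeriv ℝ (k + 1) f z‖ ≤ B * ∑ i, ‖iteratedFDeriv ℝ k (wd i f) z‖ := by
  let L : Fin n ⊕ Fin n → ℂ →L[ℝ] (Cn n →L[ℝ] ℂ) := fun i =>
    (ContinuousLinearMap.toSpanSingleton ℂ (zcL (n := n) i)).restrictScalars ℝ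
  refine ⟨∑ i, ‖L i‖, by positivity, fun f hf z hz => ?_⟩
  have hfd : fderiv ℝ f = fun z => ∑ i, wd i f z • zcL i := funext fun z => fderiv_eq_sum f z
  have hcd : ∀ i, ContDiffAt ℝ k (wd i f) z := fun i =>
    (((firstOrder_wd i).contDiffOn hf).contDiffAt (Metric.isOpen_ball.mem_nhds hz)).of_le
      (by exact_mod_cast le_top)
  have hcd2 : ∀ i, ContDiffAt ℝ k (fun z => wd i f z • zcL (n := n) i) z := fun i =>
    (L i).contDiff.contDiffAt.comp z (hcd i)
  rw [← norm_iteratedFDeriv_fderiv, hfd, iteratedFDeriv_fun_sum_apply fun i _ => hcd2 i,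
    Finset.sum_mul_sum]
  refine (norm_sum_le _ _).trans (Finset.sum_le_sum fun i _ => ?_)
  refine ((L i).norm_iteratedFDeriv_comp_left (f := wd i f) (hcd i) le_rfl).trans ?_
  exact Finset.single_le_sum (f := fun j => ‖L i‖ * ‖iteratedFDeriv ℝ k (wd j f) z‖)
    (fun _ _ => by positivity) (Finset.mem_univ i)

lemma norm_iteratedFDeriv_le_wsum (k : ℕ) : ∃ B : ℝ, 0 ≤ B ∧ ∀ f : Cn n → ℂ,
    ContDiffOn ℝ ∞ f (unitBall n) → ∀ z ∈ unitBall n,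
    ‖iteratedFDeriv ℝ k f z‖ ≤ B * wsum k f z := by
  induction k with
  | zero => exact ⟨1, zero_le_one, fun f _ z _ => by rw [norm_iteratedFDeriv_zero, one_mul]; rfl⟩
  | succ k ih =>
    obtain ⟨B, hB0, hB⟩ := ih
    obtain ⟨B', hB0', hB'⟩ := norm_iteratedFDeriv_succ_le (n := n) k
    refine ⟨B' * B, by positivity, fun f hf z hz => (hB' f hf z hz).trans ?_⟩
    refine (mul_le_mul_of_nonneg_left (Finset.sum_le_sum fun i _ =>
      hB _ ((firstOrder_wd i).contDiffOn hf) z hz) hB0').trans_eq ?_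
    rw [← Finset.mul_sum, wsum, mul_assoc]

/-- The sum of the moduli of the mixed derivatives of order at most `m`. -/
def msum (m : ℕ) (f : Cn n → ℂ) (z : Cn n) : ℝ :=
  ∑ l ∈ Finset.range (m + 1), ∑ γ ∈ Finset.piAntidiag (Finset.univ : Finset (Fin n ⊕ Fin n)) l,
    ‖mixedDeriv γ f z‖

lemma mem_piAntidiag_univ {γ : Fin n ⊕ Fin n → ℕ} {l : ℕ} :
    γ ∈ Finset.piAntidiag (Finset.univ : Finset (Fin n ⊕ Fin n)) l ↔ ∑ i, γ i = l := by
  simp [Finset.mem_piAntidiag]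

lemma norm_mixedDeriv_le_msum {γ : Fin n ⊕ Fin n → ℕ} {m : ℕ} (hγ : ∑ i, γ i ≤ m)
    (f : Cn n → ℂ) (z : Cn n) : ‖mixedDeriv γ f z‖ ≤ msum m f z :=
  (Finset.single_le_sum (f := fun γ => ‖mixedDeriv γ f z‖) (fun _ _ => norm_nonneg _)
    (mem_piAntidiag_univ.2 rfl)).trans (Finset.single_le_sum
      (f := fun l => ∑ γ ∈ Finset.piAntidiag (Finset.univ : Finset (Fin n ⊕ Fin n)) l,
        ‖mixedDeriv γ f z‖) (fun _ _ => Finset.sum_nonneg fun _ _ => norm_nonneg _)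
      (Finset.mem_range.2 (by omega)))

lemma wsum_wds_le {f : Cn n → ℂ} (hf : ContDiffOn ℝ ∞ f (unitBall n)) {z : Cn n}
    (hz : z ∈ unitBall n) {m : ℕ} (i : ℕ) : ∀ w : List (Fin n ⊕ Fin n), i + w.length ≤ m →
    wsum i (wds w f) z ≤ (2 * n) ^ i * msum m f z := by
  induction i with
  | zero =>
    intro w hw
    rw [wsum, pow_zero, one_mul, wds_eqOn_mixedDeriv w hf hz]
    refine norm_mixedDeriv_le_msum ?_ f z
    rw [sum_count]; omega
  | succ i ih =>
    intro w hw
    rw [wsum]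
    refine (Finset.sum_le_sum fun j _ => ih (j :: w) (by rw [List.length_cons]; omega)).trans_eq ?_
    rw [Finset.sum_const, Finset.card_univ, Fintype.card_sum, Fintype.card_fin, nsmul_eq_mul]
    push_cast
    ring

/-- Jets are stable under first-order operators, whereas the Sobolev norm is built from mixed
derivatives. Words in the Wirtinger derivatives mediate, and their letters may be sorted into a
multi-index because the derivatives commute. -/
lemma jet_le_msum (m : ℕ) : ∃ B : ℝ, 0 ≤ B ∧ ∀ f : Cn n → ℂ,
    ContDiffOn ℝ ∞ f (unitBall n) → ∀ z ∈ unitBall n, jet m f z ≤ B * msum m f z := by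
  choose B hB0 hB using fun k : ℕ => norm_iteratedFDeriv_le_wsum (n := n) k
  refine ⟨∑ k ∈ Finset.range (m + 1), B k * (2 * n) ^ k,
    Finset.sum_nonneg fun k _ => mul_nonneg (hB0 k) (by positivity), fun f hf z hz => ?_⟩
  rw [jet, Finset.sum_mul]
  refine Finset.sum_le_sum fun k hk => (hB k f hf z hz).trans ?_
  have := wsum_wds_le hf hz k [] (m := m) (by have := Finset.mem_range.1 hk; simp; omega)
  rw [mul_assoc]
  exact mul_le_mul_of_nonneg_left this (hB0 k)

/-! ### Comparison of weighted norms -/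

lemma mu_absolutelyContinuous (s : ℝ) : mu n s ≪ volume.restrict (unitBall n) :=
  withDensity_absolutelyContinuous _ _

lemma aemeasurable_enorm_sq {s : ℝ} {u : Cn n → ℂ} (hu : ContinuousOn u (unitBall n)) :
    AEMeasurable (fun z => ‖u z‖ₑ ^ 2) (mu n s) :=
  ((hu.aemeasurable Metric.isOpen_ball.measurableSet).mono_ac
    (mu_absolutelyContinuous s)).enorm.pow_const 2

lemma enorm_sq_le_of_norm_le {ι : Type*} (S : Finset ι) {a : ι → ℂ} {b : ℂ} {C : ℝ} (hC : 0 ≤ C)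
    (h : ‖b‖ ≤ C * ∑ i ∈ S, ‖a i‖) :
    ‖b‖ₑ ^ 2 ≤ ENNReal.ofReal (C ^ 2 * S.card) * ∑ i ∈ S, ‖a i‖ₑ ^ 2 := by
  simp only [enorm_sq_eq]
  rw [← ENNReal.ofReal_sum_of_nonneg fun _ _ => sq_nonneg _, ← ENNReal.ofReal_mul (by positivity)]
  refine ENNReal.ofReal_le_ofReal ?_
  calc ‖b‖ ^ 2 ≤ (C * ∑ i ∈ S, ‖a i‖) ^ 2 := pow_le_pow_left₀ (norm_nonneg _) h 2
    _ = C ^ 2 * (∑ i ∈ S, ‖a i‖) ^ 2 := mul_pow _ _ _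
    _ ≤ C ^ 2 * (S.card * ∑ i ∈ S, ‖a i‖ ^ 2) := by gcongr; exact sq_sum_le_card_mul_sum_sq
    _ = _ := by ring

lemma sqNorm_le_sum {ι : Type*} (S : Finset ι) {s : ℝ} {u : ι → Cn n → ℂ} {v : Cn n → ℂ} {C : ℝ}
    (hC : 0 ≤ C) (hu : ∀ i ∈ S, ContinuousOn (u i) (unitBall n))
    (h : ∀ z ∈ unitBall n, ‖v z‖ ≤ C * ∑ i ∈ S, ‖u i z‖) :
    sqNorm s v ≤ ENNReal.ofReal (C ^ 2 * S.card) * ∑ i ∈ S, sqNorm s (u i) := by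
  simp only [sqNorm]
  rw [← lintegral_finsetSum' _ fun i hi => aemeasurable_enorm_sq (hu i hi),
    ← lintegral_const_mul' _ _ ENNReal.ofReal_ne_top]
  refine lintegral_mono_ae ?_
  filter_upwards [ae_mu_mem_ball s] with z hz using enorm_sq_le_of_norm_le S hC (h z hz)

/-- The sum of the squared norms of the classical derivatives. -/
def classicalSqNorm (m : ℕ) (s : ℝ) (f : Cn n → ℂ) : ℝ≥0∞ :=
  ∑ l ∈ Finset.range (m + 1), ∑ γ ∈ Finset.piAntidiag (Finset.univ : Finset (Fin n ⊕ Fin n)) l,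
    sqNorm s (mixedDeriv γ f)

/-- The multi-indices of order at most `m`. -/
def multiIdx (n m : ℕ) : Finset ((_ : ℕ) × (Fin n ⊕ Fin n → ℕ)) :=
  (Finset.range (m + 1)).sigma fun l => Finset.piAntidiag Finset.univ l

lemma contDiffOn_mixedDeriv (γ : Fin n ⊕ Fin n → ℕ) {f : Cn n → ℂ}
    (hf : ContDiffOn ℝ ∞ f (unitBall n)) : ContDiffOn ℝ ∞ (mixedDeriv γ f) (unitBall n) := by
  rw [mixedDeriv_eq_wds]; exact contDiffOn_wds _ hf

/-- The bound of (a) by (c) is pointwise: a word in `N` and the `X` of length at most `m` is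
controlled by the `m`-jet up to the boundary. -/
lemma exists_sqNorm_opN_iterX_le (s : ℝ) {m : ℕ} (k : ℕ) {r : ℕ} (hkr : k + r ≤ m)
    (J : Fin r → XIndex n) : ∃ C : ℝ≥0∞, C ≠ ⊤ ∧ ∀ f : Cn n → ℂ, ContDiffOn ℝ ∞ f (unitBall n) →
      sqNorm s (opN^[k] (iterX J f)) ≤ C * classicalSqNorm m s f := by
  obtain ⟨C₁, h₁, hC₁⟩ := exists_jet_opN_iterate_le (n := n) k 0
  obtain ⟨C₂, h₂, hC₂⟩ := exists_jet_iterX_le J (0 + k)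
  obtain ⟨B, hB0, hB⟩ := jet_le_msum (n := n) m
  refine ⟨ENNReal.ofReal ((C₁ * (C₂ * B)) ^ 2 * (multiIdx n m).card), ENNReal.ofReal_ne_top,
    fun f hf => ?_⟩
  have h := sqNorm_le_sum (multiIdx n m) (s := s) (u := fun x => mixedDeriv x.2 f)
    (v := opN^[k] (iterX J f)) (C := C₁ * (C₂ * B)) (by positivity)
    (fun x _ => (contDiffOn_mixedDeriv x.2 hf).continuousOn) (fun z hz => by
      rw [multiIdx, Finset.sum_sigma]
      change _ ≤ _ * msum m f z
      calc ‖opN^[k] (iterX J f) z‖ ≤ jet 0 (opN^[k] (iterX J f)) z := norm_le_jet 0 _ z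
        _ ≤ C₁ * jet (0 + k) (iterX J f) z := hC₁ _ (contDiffOn_iterX J hf) z hz
        _ ≤ C₁ * (C₂ * jet (0 + k + r) f z) := by gcongr; exact hC₂ f hf z hz
        _ ≤ C₁ * (C₂ * jet m f z) := by gcongr; exact jet_mono (by omega) f z
        _ ≤ C₁ * (C₂ * (B * msum m f z)) := by gcongr; exact hB f hf z hz
        _ = _ := by ring)
  rwa [multiIdx, Finset.sum_sigma] at h

lemma exists_normalTangentialSum_le (m : ℕ) (s : ℝ) : ∃ C : ℝ≥0∞, C ≠ ⊤ ∧ ∀ f : Cn n → ℂ,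
    ContDiffOn ℝ ∞ f (unitBall n) → normalTangentialSum m s f ≤ C * classicalSqNorm m s f := by
  have key : ∀ (l k : ℕ) (J : Fin (l - k) → XIndex n), ∃ C : ℝ≥0∞, C ≠ ⊤ ∧
      (l ∈ Finset.range (m + 1) → k ∈ Finset.range (l + 1) → ∀ f : Cn n → ℂ,
        ContDiffOn ℝ ∞ f (unitBall n) →
        sqNorm s (opN^[k] (iterX J f)) ≤ C * classicalSqNorm m s f) := by
    intro l k J
    by_cases h : k + (l - k) ≤ m
    · obtain ⟨C, hC, h2⟩ := exists_sqNorm_opN_iterX_le s k h J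
      exact ⟨C, hC, fun _ _ => h2⟩
    · refine ⟨0, ENNReal.zero_ne_top, fun h1 h2 => ?_⟩
      rw [Finset.mem_range] at h1 h2
      omega
  choose C hC hle using key
  refine ⟨∑ l ∈ Finset.range (m + 1), ∑ k ∈ Finset.range (l + 1), ∑ J : Fin (l - k) → XIndex n,
    C l k J, ?_, fun f hf => ?_⟩
  · refine ENNReal.sum_ne_top.2 fun l _ => ENNReal.sum_ne_top.2 fun k _ =>
      ENNReal.sum_ne_top.2 fun J _ => hC l k J
  · rw [normalTangentialSum, Finset.sum_mul]
    refine Finset.sum_le_sum fun l hl => ?_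
    rw [Finset.sum_mul]
    refine Finset.sum_le_sum fun k hk => ?_
    rw [Finset.sum_mul]
    exact Finset.sum_le_sum fun J _ => hle l k J hl hk f hf

/-! ### Recovering all derivatives away from the origin -/

/-- The Euler field commutes with linear fields. Consequently any word in `N` and the `X` can be
brought to the form `N^k X_J` that occurs in (a). -/
lemma opN_opX_comm (α : XIndex n) {f : Cn n → ℂ} {z : Cn n} (hf : ContDiffAt ℝ 2 f z) :
    opN (opX α f) z = opX α (opN f) z := by
  obtain ⟨A, B, a, b, -, -, h⟩ := opX_eq_lin α
  have hd : ∀ L : Cn n →L[ℝ] Cn n, DifferentiableAt ℝ (lin L f) z := fun L =>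
    ((hf.fderiv_right (m := 1) (by norm_num)).clm_apply
      L.contDiff.contDiffAt).differentiableAt one_ne_zero
  have h1 : opX α f = fun z => a * lin A f z + b * lin B f z := funext fun z => h f z
  have h2 : opN f = lin (ContinuousLinearMap.id ℝ (Cn n)) f := funext fun w => opN_eq_lin f w
  rw [opN_eq_lin, h, h1, h2, ← lin_comm_id hf, ← lin_comm_id hf]
  change fderiv ℝ (fun z => a * lin A f z + b * lin B f z) z z = _
  rw [fderiv_fun_add ((hd A).const_mul a) ((hd B).const_mul b), fderiv_const_mul (hd A),
    fderiv_const_mul (hd B)]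
  rfl

lemma iterX_opN {r : ℕ} (J : Fin r → XIndex n) {f : Cn n → ℂ}
    (hf : ContDiffOn ℝ ∞ f (unitBall n)) :
    Set.EqOn (iterX J (opN f)) (opN (iterX J f)) (unitBall n) := by
  induction r with
  | zero => simp only [iterX_zero]; exact fun _ _ => rfl
  | succ r ih =>
    rw [← Fin.cons_self_tail J, iterX_cons, iterX_cons]
    refine ((firstOrder_opX _).eqOn (ih _)).trans fun z hz => ?_
    exact (opN_opX_comm _ (((contDiffOn_iterX _ hf).contDiffAt
      (Metric.isOpen_ball.mem_nhds hz)).of_le two_le_smooth)).symm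

lemma iterX_opX {r : ℕ} (J : Fin r → XIndex n) (α : XIndex n) (f : Cn n → ℂ) :
    iterX J (opX α f) = iterX (Fin.snoc J α : Fin (r + 1) → XIndex n) f := by
  rw [iterX, iterX, List.ofFn_succ']
  simp [List.concat_eq_append]

/-- The sum of the moduli of the derivatives entering `normalTangentialSum`. -/
def ntsum (m : ℕ) (f : Cn n → ℂ) (z : Cn n) : ℝ :=
  ∑ l ∈ Finset.range (m + 1), ∑ k ∈ Finset.range (l + 1),
    ∑ J : Fin (l - k) → XIndex n, ‖opN^[k] (iterX J f) z‖

lemma norm_le_ntsum {m k r : ℕ} (h : k + r ≤ m) (J : Fin r → XIndex n) (f : Cn n → ℂ) (z : Cn n) :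
    ‖opN^[k] (iterX J f) z‖ ≤ ntsum m f z := by
  -- The type of `J` depends on `l - k`, so `l` is kept general until `r` has been replaced by that
  -- difference.
  have key : ∀ (l : ℕ) (hl : l ≤ m) (hk : k ≤ l) (hr : r = l - k),
      ‖opN^[k] (iterX J f) z‖ ≤ ntsum m f z := by
    intro l hl hk hr
    subst hr
    refine (Finset.single_le_sum (f := fun J : Fin (l - k) → XIndex n => ‖opN^[k] (iterX J f) z‖)
      (fun _ _ => norm_nonneg _) (Finset.mem_univ J)).trans ?_
    refine (Finset.single_le_sum (f := fun k => ∑ J : Fin (l - k) → XIndex n,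
      ‖opN^[k] (iterX J f) z‖) (fun _ _ => Finset.sum_nonneg fun _ _ => norm_nonneg _)
      (Finset.mem_range.2 (by omega : k < l + 1))).trans ?_
    exact Finset.single_le_sum (f := fun l => ∑ k ∈ Finset.range (l + 1),
      ∑ J : Fin (l - k) → XIndex n, ‖opN^[k] (iterX J f) z‖)
      (fun _ _ => Finset.sum_nonneg fun _ _ => Finset.sum_nonneg fun _ _ => norm_nonneg _)
      (Finset.mem_range.2 (by omega : l < m + 1))
  exact key (k + r) h (by omega) (by omega)

lemma ntsum_mono {m m' : ℕ} (h : m ≤ m') (f : Cn n → ℂ) (z : Cn n) : ntsum m f z ≤ ntsum m' f z :=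
  Finset.sum_le_sum_of_subset_of_nonneg (Finset.range_mono (by omega)) fun _ _ _ =>
    Finset.sum_nonneg fun _ _ => Finset.sum_nonneg fun _ _ => norm_nonneg _

/-- The number of terms in `ntsum`. -/
def ntcard (n m : ℕ) : ℝ :=
  ∑ l ∈ Finset.range (m + 1), ∑ k ∈ Finset.range (l + 1), ∑ _J : Fin (l - k) → XIndex n, 1

lemma ntcard_nonneg (n m : ℕ) : 0 ≤ ntcard n m :=
  Finset.sum_nonneg fun _ _ => Finset.sum_nonneg fun _ _ => Finset.sum_nonneg fun _ _ => zero_le_one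

lemma ntsum_le {m : ℕ} {g : Cn n → ℂ} {z : Cn n} {b : ℝ}
    (h : ∀ (k r : ℕ), k + r ≤ m → ∀ J : Fin r → XIndex n, ‖opN^[k] (iterX J g) z‖ ≤ b) :
    ntsum m g z ≤ ntcard n m * b := by
  rw [ntsum, ntcard, Finset.sum_mul]
  refine Finset.sum_le_sum fun l hl => ?_
  rw [Finset.sum_mul]
  refine Finset.sum_le_sum fun k hk => ?_
  rw [Finset.sum_mul]
  rw [Finset.mem_range] at hl hk
  exact Finset.sum_le_sum fun J _ => by rw [one_mul]; exact h k (l - k) (by omega) J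

/-- The radial derivative together with the operators `X_j`. -/
def opT : Option (XIndex n) → (Cn n → ℂ) → Cn n → ℂ
  | none => opN
  | some α => opX α

lemma firstOrder_opT (T : Option (XIndex n)) : FirstOrder (opT (n := n) T) := by
  cases T with
  | none => exact firstOrder_opN
  | some α => exact firstOrder_opX α

lemma ntsum_opT_le (m : ℕ) (T : Option (XIndex n)) {f : Cn n → ℂ}
    (hf : ContDiffOn ℝ ∞ f (unitBall n)) {z : Cn n} (hz : z ∈ unitBall n) :
    ntsum m (opT T f) z ≤ ntcard n m * ntsum (m + 1) f z := by
  refine ntsum_le fun k r hkr J => ?_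
  cases T with
  | none =>
    have h1 : opN^[k] (iterX J (opN f)) z = opN^[k + 1] (iterX J f) z := by
      rw [Function.iterate_succ_apply]
      exact eqOn_opN_iterate k (iterX_opN J hf) hz
    rw [opT, h1]
    exact norm_le_ntsum (by omega) J f z
  | some α =>
    rw [opT, iterX_opX]
    exact norm_le_ntsum (by omega) _ f z

lemma contDiffOn_zc_div_nsq (c : ℂ) (i : Fin n ⊕ Fin n) :
    ContDiffOn ℝ ∞ (fun z : Cn n => c * (zc i z / nsq z)) {0}ᶜ := by
  simp only [div_eq_mul_inv]
  refine contDiffOn_const.mul ((contDiff_zc i).contDiffOn.mul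
    (isPoly_nsq.contDiff.contDiffOn.inv fun z hz => ?_))
  rw [nsq_eq]
  have : ‖z‖ ≠ 0 := norm_ne_zero_iff.2 hz
  exact_mod_cast pow_ne_zero 2 this

/-- Solves `nsq_mul_dz` and `nsq_mul_dzbar` for the derivative, with the complex Euler fields
written as `(N ± R)/2`. The coefficients are singular only at the origin. -/
lemma exists_wd_eq_sum_opT (i : Fin n ⊕ Fin n) : ∃ c : Option (XIndex n) → Cn n → ℂ,
    (∀ T, ContDiffOn ℝ ∞ (c T) {0}ᶜ) ∧
      ∀ f z, z ≠ 0 → wd i f z = ∑ T, c T z * opT T f z := by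
  have hz2 : ∀ z : Cn n, z ≠ 0 → nsq z ≠ 0 := fun z hz => by
    rw [nsq_eq]
    exact_mod_cast pow_ne_zero 2 (norm_ne_zero_iff.2 hz)
  cases i with
  | inl j =>
    refine ⟨fun T z => match T with
      | none => (1 / 2) * (zc (Sum.inr j) z / nsq z)
      | some none => (1 / 2) * (zc (Sum.inr j) z / nsq z)
      | some (some (Sum.inl (k, j'))) => (if j' = j then 1 else 0) * (zc (Sum.inl k) z / nsq z)
      | some (some (Sum.inr _)) => 0, ?_, fun f z hz => ?_⟩
    · rintro (_ | _ | ⟨k, j'⟩ | _)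
      · exact contDiffOn_zc_div_nsq _ _
      · exact contDiffOn_zc_div_nsq _ _
      · exact contDiffOn_zc_div_nsq _ _
      · exact contDiffOn_const
    · rw [Fintype.sum_option, Fintype.sum_option, Fintype.sum_sum_type, Fintype.sum_prod_type]
      simp only [zero_mul, Finset.sum_const_zero, add_zero, opT, opX, ite_mul, one_mul,
        Finset.sum_ite_eq', Finset.mem_univ, if_true, wd_inl, zc_inl, zc_inr]
      have h := nsq_mul_dz j f z
      have h3 : ∑ k, z k * dz k f z = 1 / 2 * (opN f z + opR f z) := by
        simp only [opN, opR, ← Finset.sum_add_distrib]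
        rw [Finset.mul_sum]
        exact Finset.sum_congr rfl fun k _ => by ring
      rw [h3] at h
      have h4 : ∑ k, z k / nsq z * opL k j f z = (∑ k, z k * opL k j f z) / nsq z := by
        rw [Finset.sum_div]
        exact Finset.sum_congr rfl fun k _ => by ring
      rw [h4]
      have := hz2 z hz
      field_simp
      linear_combination 2 * h
  | inr j =>
    refine ⟨fun T z => match T with
      | none => (1 / 2) * (zc (Sum.inl j) z / nsq z)
      | some none => (-(1 / 2)) * (zc (Sum.inl j) z / nsq z)
      | some (some (Sum.inr (k, j'))) => (if j' = j then 1 else 0) * (zc (Sum.inr k) z / nsq z)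
      | some (some (Sum.inl _)) => 0, ?_, fun f z hz => ?_⟩
    · rintro (_ | _ | _ | ⟨k, j'⟩)
      · exact contDiffOn_zc_div_nsq _ _
      · exact contDiffOn_zc_div_nsq _ _
      · exact contDiffOn_const
      · exact contDiffOn_zc_div_nsq _ _
    · rw [Fintype.sum_option, Fintype.sum_option, Fintype.sum_sum_type, Fintype.sum_prod_type,
        Fintype.sum_prod_type]
      simp only [zero_mul, Finset.sum_const_zero, zero_add, opT, opX, ite_mul, one_mul,
        Finset.sum_ite_eq', Finset.mem_univ, if_true, wd_inr, zc_inl, zc_inr]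
      have h := nsq_mul_dzbar j f z
      have h3 : ∑ k, conj (z k) * dzbar k f z = 1 / 2 * (opN f z - opR f z) := by
        simp only [opN, opR, ← Finset.sum_sub_distrib]
        rw [Finset.mul_sum]
        exact Finset.sum_congr rfl fun k _ => by ring
      rw [h3] at h
      have h4 : ∑ k, conj (z k) / nsq z * opLbar k j f z =
          (∑ k, conj (z k) * opLbar k j f z) / nsq z := by
        rw [Finset.sum_div]
        exact Finset.sum_congr rfl fun k _ => by ring
      rw [h4]
      have := hz2 z hz
      field_simp
      linear_combination 2 * h

/-- The coefficient may blow up at the origin, but the shell `1/2 ≤ ‖z‖ ≤ 1` is compact and avoids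
it. -/
lemma exists_norm_iteratedFDeriv_mul_le {c : Cn n → ℂ} (hc : ContDiffOn ℝ ∞ c {0}ᶜ) (k : ℕ) :
    ∃ C : ℝ, 0 ≤ C ∧ ∀ g : Cn n → ℂ, ContDiffOn ℝ ∞ g (unitBall n) → ∀ z ∈ unitBall n,
      1 / 2 ≤ ‖z‖ → ‖iteratedFDeriv ℝ k (fun z => c z * g z) z‖ ≤ C * jet k g z := by
  have hD : ∀ i : ℕ, ∃ D : ℝ, ∀ z ∈ unitBall n, 1 / 2 ≤ ‖z‖ → ‖iteratedFDeriv ℝ i c z‖ ≤ D := by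
    intro i
    have hK : IsCompact (Metric.closedBall (0 : Cn n) 1 ∩ {z | 1 / 2 ≤ ‖z‖}) :=
      (isCompact_closedBall _ _).inter_right (isClosed_le continuous_const continuous_norm)
    have hc2 : ContinuousOn (iteratedFDeriv ℝ i c) {0}ᶜ :=
      (hc.continuousOn_iteratedFDerivWithin (m := i) (by exact_mod_cast le_top)
        isOpen_compl_singleton.uniqueDiffOn).congr fun z hz =>
          (iteratedFDerivWithin_of_isOpen i isOpen_compl_singleton hz).symm
    obtain ⟨D, hD⟩ := hK.exists_bound_of_continuousOn (hc2.mono (by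
      rintro z ⟨-, hz⟩ rfl
      simp only [Set.mem_ofPred_eq, norm_zero] at hz
      norm_num at hz))
    exact ⟨D, fun z hz hz2 => hD z ⟨Metric.ball_subset_closedBall hz, hz2⟩⟩
  choose D hD using hD
  refine ⟨∑ i ∈ Finset.range (k + 1), (k.choose i : ℝ) * |D i|, by positivity,
    fun g hg z hz hz2 => ?_⟩
  have hz0 : z ≠ 0 := by rintro rfl; rw [norm_zero] at hz2; norm_num at hz2
  have hopen : IsOpen ({0}ᶜ ∩ unitBall n) := isOpen_compl_singleton.inter Metric.isOpen_ball
  have hmem : z ∈ {0}ᶜ ∩ unitBall n := ⟨hz0, hz⟩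
  rw [← iteratedFDerivWithin_of_isOpen k hopen hmem]
  refine (norm_iteratedFDerivWithin_mul_le (N := (∞ : WithTop ℕ∞)) (hc.mono Set.inter_subset_left)
    (hg.mono Set.inter_subset_right) hopen.uniqueDiffOn hmem (by exact_mod_cast le_top)).trans ?_
  rw [Finset.sum_mul]
  refine Finset.sum_le_sum fun i hi => ?_
  rw [iteratedFDerivWithin_of_isOpen _ hopen hmem, iteratedFDerivWithin_of_isOpen _ hopen hmem]
  have h1 := norm_iteratedFDeriv_le_jet (show k - i ≤ k by omega) g z
  have h2 := (hD i z hz hz2).trans (le_abs_self _)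
  gcongr

/-- Induction on the order: one Wirtinger derivative is exchanged for `N` and the `X` with
coefficients bounded on the shell, and the resulting operator is absorbed by `ntsum_opT_le`. -/
lemma exists_jet_le_ntsum (k : ℕ) : ∃ C : ℝ, 0 ≤ C ∧ ∀ f : Cn n → ℂ,
    ContDiffOn ℝ ∞ f (unitBall n) → ∀ z ∈ unitBall n, 1 / 2 ≤ ‖z‖ →
      jet k f z ≤ C * ntsum k f z := by
  induction k with
  | zero =>
    refine ⟨1, zero_le_one, fun f _ z _ _ => ?_⟩
    rw [one_mul, jet, zero_add, Finset.sum_range_one, norm_iteratedFDeriv_zero]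
    exact norm_le_ntsum (m := 0) (k := 0) (r := 0) le_rfl Fin.elim0 f z
  | succ k ih =>
    obtain ⟨C, hC0, hC⟩ := ih
    obtain ⟨B, hB0, hB⟩ := norm_iteratedFDeriv_succ_le (n := n) k
    choose c hc hce using exists_wd_eq_sum_opT (n := n)
    choose D hD0 hD using fun i T => exists_norm_iteratedFDeriv_mul_le (hc i T) k
    refine ⟨C + B * ∑ i, ∑ T, D i T * (C * ntcard n k), ?_, fun f hf z hz hz2 => ?_⟩
    · have := ntcard_nonneg n k
      refine add_nonneg hC0 (mul_nonneg hB0 (Finset.sum_nonneg fun i _ => Finset.sum_nonneg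
        fun T _ => mul_nonneg (hD0 i T) (by positivity)))
    have hz0 : z ≠ 0 := by rintro rfl; rw [norm_zero] at hz2; norm_num at hz2
    rw [jet, Finset.sum_range_succ, add_mul]
    refine add_le_add ((hC f hf z hz hz2).trans ?_) ((hB f hf z hz).trans ?_)
    · exact mul_le_mul_of_nonneg_left (ntsum_mono (by omega) f z) hC0
    · rw [mul_assoc, Finset.sum_mul]
      refine mul_le_mul_of_nonneg_left (Finset.sum_le_sum fun i _ => ?_) hB0
      have hev : wd i f =ᶠ[𝓝 z] fun z => ∑ T, c i T z * opT T f z := by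
        filter_upwards [isOpen_compl_singleton.mem_nhds hz0] with w hw using hce i f w hw
      rw [(hev.iteratedFDeriv (𝕜 := ℝ) k).eq_of_nhds]
      have hsm : ∀ T, ContDiffAt ℝ k (fun z => c i T z * opT T f z) z := fun T =>
        ((((hc i T).contDiffAt (isOpen_compl_singleton.mem_nhds hz0))).mul
          (((firstOrder_opT T).contDiffOn hf).contDiffAt (Metric.isOpen_ball.mem_nhds hz))).of_le
          (by exact_mod_cast le_top)
      rw [iteratedFDeriv_fun_sum_apply fun T _ => hsm T, Finset.sum_mul]
      refine (norm_sum_le _ _).trans (Finset.sum_le_sum fun T _ => ?_)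
      refine (hD i T _ ((firstOrder_opT T).contDiffOn hf) z hz hz2).trans ?_
      rw [mul_assoc, mul_assoc]
      refine mul_le_mul_of_nonneg_left ?_ (hD0 i T)
      exact (hC _ ((firstOrder_opT T).contDiffOn hf) z hz hz2).trans
        (mul_le_mul_of_nonneg_left (ntsum_opT_le k T hf hz) hC0)

lemma exists_jet_wds_le (w : List (Fin n ⊕ Fin n)) : ∀ k : ℕ, ∃ C : ℝ, 0 ≤ C ∧ ∀ f : Cn n → ℂ,
    ContDiffOn ℝ ∞ f (unitBall n) → ∀ z ∈ unitBall n,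
      jet k (wds w f) z ≤ C * jet (k + w.length) f z := by
  induction w with
  | nil => exact fun k => ⟨1, zero_le_one, fun f _ z _ => by simp [wds]⟩
  | cons i w ih =>
    intro k
    obtain ⟨C₁, h₁, hC₁⟩ := (firstOrder_wd i).exists_jet_le k
    obtain ⟨C₂, h₂, hC₂⟩ := ih (k + 1)
    refine ⟨C₁ * C₂, by positivity, fun f hf z hz => ?_⟩
    refine (hC₁ _ (contDiffOn_wds _ hf) z hz).trans ?_
    have := hC₂ f hf z hz
    rw [mul_assoc, List.length_cons, show k + (w.length + 1) = k + 1 + w.length by omega]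
    gcongr

/-! ### Bounds near the origin -/

lemma gfun_mono (hn : 1 ≤ n) (p q : ℕ) {t t' : ℝ} (h0 : 0 < t) (h : t ≤ t') (h1 : t' < 1) :
    gfun n p q t ≤ gfun n p q t' := by
  rw [gfun_eq h0.le, gfun_eq (h0.le.trans h)]
  have := (nonnegSeries_S hn p q).mono h0.le h h1
  have := (nonnegSeries_S hn p q).eval_nonneg h0.le (h.trans_lt h1)
  gcongr

/-- Since `gfun` is increasing, the part of the integral over `(t₁, 1)` already dominates its value
at `t₁`, with a constant independent of `p` and `q`. -/
lemma exists_mul_gfun_sq_le_coeff (hn : 1 ≤ n) (s : ℝ) {t₁ : ℝ} (ht₁ : t₁ ∈ Set.Ioo (0 : ℝ) 1) :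
    ∃ κ : ℝ≥0∞, κ ≠ 0 ∧ ∀ p q : ℕ, κ * ENNReal.ofReal (gfun n p q t₁ ^ 2) ≤ coeff n p q 0 s := by
  refine ⟨∫⁻ t in Set.Ioo t₁ 1, ENNReal.ofReal (t ^ (n - 1) * (1 - t) ^ s), ?_, fun p q => ?_⟩
  · have hpos : ∀ t ∈ Set.Ioo t₁ 1, 0 < t ^ (n - 1) * (1 - t) ^ s := fun t ht =>
      mul_pos (pow_pos (ht₁.1.trans ht.1) _) (Real.rpow_pos_of_pos (by linarith [ht.2]) _)
    refine (setLIntegral_pos_iff (by fun_prop)).2 ?_ |>.ne'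
    have hsub : Set.Ioo t₁ 1 ⊆ Function.support
        (fun t : ℝ => ENNReal.ofReal (t ^ (n - 1) * (1 - t) ^ s)) ∩ Set.Ioo t₁ 1 := fun t ht =>
      ⟨by simpa using hpos t ht, ht⟩
    refine lt_of_lt_of_le ?_ (measure_mono hsub)
    rw [Real.volume_Ioo]
    simpa using ht₁.2
  · rw [← lintegral_mul_const' _ _ ENNReal.ofReal_ne_top, coeff]
    refine (setLIntegral_mono' measurableSet_Ioo fun t ht => ?_).trans
      (lintegral_mono_set (Set.Ioo_subset_Ioo_left ht₁.1.le))
    have h0 : 0 < t := ht₁.1.trans ht.1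
    have h1 : 0 ≤ t ^ (n - 1) * (1 - t) ^ s :=
      mul_nonneg (pow_nonneg h0.le _) (Real.rpow_nonneg (by linarith [ht.2]) _)
    rw [← ENNReal.ofReal_mul h1]
    refine ENNReal.ofReal_le_ofReal (mul_le_mul_of_nonneg_left ?_ h1)
    exact pow_le_pow_left₀ (gfun_pos hn p q ht₁).le (gfun_mono hn p q ht₁.1 ht.1.le ht.2) 2

/-- Keeps a single term of the Parseval sum for `‖f‖_s²`. -/
lemma exists_gfun_mul_sqrt_le (hn : 2 ≤ n) {s : ℝ} (hs : -1 < s) {t₁ : ℝ}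
    (ht₁ : t₁ ∈ Set.Ioo (0 : ℝ) 1) : ∃ K : ℝ, 0 ≤ K ∧ ∀ (f : Cn n → ℂ) (F : ℕ → ℕ → Cn n → ℂ),
      ContinuousOn f (unitBall n) → IsCoeff f F → sqNorm s f ≠ ⊤ → ∀ p q : ℕ,
        gfun n p q t₁ * √(nrm2 (F p q)) ≤ K * √(sqNorm s f).toReal := by
  have hn1 : 1 ≤ n := by omega
  obtain ⟨κ, hκ, hle⟩ := exists_mul_gfun_sq_le_coeff hn1 s ht₁
  have hP0 := polarConst_ne_zero hn1 hs
  let A : ℝ≥0∞ := polarConst n s * κ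
  have hA : A ≠ 0 := mul_ne_zero hP0 hκ
  refine ⟨√(A⁻¹).toReal, Real.sqrt_nonneg _, fun f F hf h hfin p q => ?_⟩
  have h1 : A * ENNReal.ofReal (gfun n p q t₁ ^ 2 * nrm2 (F p q)) ≤ sqNorm s f := by
    have e := h.sqNorm_eq hn hs hf 0 (r := 0) Fin.elim0
    rw [Function.iterate_zero, id, iterX_zero] at e
    simp only [iterX_zero] at e
    rw [e, mul_assoc]
    refine mul_le_mul_right ?_ _
    refine le_trans ?_ (ENNReal.le_tsum ((p, q) : ℕ × ℕ))
    rw [ENNReal.ofReal_mul (sq_nonneg _), ← mul_assoc]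
    exact mul_le_mul_left (hle p q) _
  have h2 : ENNReal.ofReal (gfun n p q t₁ ^ 2 * nrm2 (F p q)) ≤ A⁻¹ * sqNorm s f := by
    -- The constant `κ` is only known to be nonzero. Were it infinite, finiteness of the norm would
    -- force the left side to vanish.
    by_cases hAt : A = ⊤
    · rw [hAt] at h1
      have : ENNReal.ofReal (gfun n p q t₁ ^ 2 * nrm2 (F p q)) = 0 := by
        by_contra hne
        rw [ENNReal.top_mul hne] at h1
        exact hfin (top_le_iff.1 h1)
      rw [this]; exact zero_le
    · calc _ = A⁻¹ * (A * ENNReal.ofReal (gfun n p q t₁ ^ 2 * nrm2 (F p q))) := by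
            rw [← mul_assoc, ENNReal.inv_mul_cancel hA hAt, one_mul]
        _ ≤ _ := mul_le_mul_right h1 _
  have hAi : A⁻¹ ≠ ⊤ := ENNReal.inv_ne_top.2 hA
  have h3 := ENNReal.toReal_mono (ENNReal.mul_ne_top hAi hfin) h2
  have hg := (gfun_pos hn1 p q ht₁).le
  rw [ENNReal.toReal_ofReal (mul_nonneg (sq_nonneg _) (nrm2_nonneg _)), ENNReal.toReal_mul] at h3
  rw [← Real.sqrt_mul ENNReal.toReal_nonneg, ← Real.sqrt_sq hg, ← Real.sqrt_mul (sq_nonneg _)]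
  exact Real.sqrt_le_sqrt h3

lemma SmoothSeries.wds {u : ℕ × ℕ → Cn n → ℂ} (h : SmoothSeries u) (w : List (Fin n ⊕ Fin n)) :
    SmoothSeries (fun a => wds w (u a)) ∧
      Set.EqOn (wds w fun y => ∑' a, u a y) (fun y => ∑' a, MHarm.wds w (u a) y) (unitBall n) := by
  induction w with
  | nil => exact ⟨h, fun _ _ => rfl⟩
  | cons i w ih =>
    simp only [wds_cons]
    obtain ⟨h1, h2⟩ := ih
    exact ⟨(firstOrder_wd i).smoothSeries h1,
      ((firstOrder_wd i).eqOn h2).trans ((firstOrder_wd i).tsum h1)⟩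

lemma eqOn_wds (w : List (Fin n ⊕ Fin n)) {f g : Cn n → ℂ}
    (h : Set.EqOn f g (unitBall n)) : Set.EqOn (wds w f) (wds w g) (unitBall n) := by
  induction w with
  | nil => exact h
  | cons i w ih => exact (firstOrder_wd i).eqOn ih

/-- Interior regularity: `N` and the `X` degenerate at the origin and cannot control derivatives
there. Instead the series is differentiated termwise, and geometric decay of the derivatives is
summed against the uniform bound of `exists_gfun_mul_sqrt_le`. -/
lemma exists_norm_wds_le_sqrt_sqNorm (hn : 2 ≤ n) {s : ℝ} (hs : -1 < s)
    (w : List (Fin n ⊕ Fin n)) : ∃ K : ℝ, 0 ≤ K ∧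
      ∀ (f : Cn n → ℂ) (F : ℕ → ℕ → Cn n → ℂ), ContinuousOn f (unitBall n) → IsCoeff f F →
        sqNorm s f ≠ ⊤ → ∀ z, ‖z‖ ≤ 1 / 2 → ‖wds w f z‖ ≤ K * √(sqNorm s f).toReal := by
  have hn1 : 1 ≤ n := by omega
  choose t ht θ hθ C hC0 hC using fun i : ℕ =>
    norm_iteratedFDeriv_solid_le hn i (ρ := 1 / 2) (by norm_num) (by norm_num)
  choose K hK0 hK using fun i => exists_gfun_mul_sqrt_le hn hs (ht i)
  obtain ⟨D, hD0, hD⟩ := exists_jet_wds_le w 0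
  have hsum : ∀ i, Summable fun a : ℕ × ℕ => θ i ^ (a.1 + a.2) := fun i =>
    summable_pow_add (hθ i).1.le (hθ i).2
  let R : ℝ := D * ∑ i ∈ Finset.range (0 + w.length + 1), C i * K i * ∑' a : ℕ × ℕ, θ i ^ (a.1 + a.2)
  refine ⟨R, ?_, fun f F hf h hfin z hz => ?_⟩
  · refine mul_nonneg hD0 (Finset.sum_nonneg fun i _ => mul_nonneg (mul_nonneg (hC0 i) (hK0 i))
      (tsum_nonneg fun a => pow_nonneg (hθ i).1.le _))
  have hzb : z ∈ unitBall n := by simp; linarith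
  have hSS := (h.admissible hn1 hf).smoothSeries hn
  obtain ⟨-, e2⟩ := hSS.wds w
  rw [((eqOn_wds w (h.eqOn_solidSum hn hf)).trans e2) hzb]
  set X := √(sqNorm s f).toReal
  refine tsum_of_norm_bounded (g := fun a : ℕ × ℕ => D * ∑ i ∈ Finset.range (0 + w.length + 1),
    C i * K i * θ i ^ (a.1 + a.2) * X) ?_ fun a => ?_
  · simp only [R]
    rw [mul_assoc, Finset.sum_mul]
    exact (hasSum_sum fun i _ => ((hsum i).hasSum.mul_left (C i * K i)).mul_right X).mul_left D
  · refine (norm_le_jet 0 _ z).trans ((hD _ (hSS.1 a) z hzb).trans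
      (mul_le_mul_of_nonneg_left (Finset.sum_le_sum fun i _ => ?_) hD0))
    refine (hC i a.1 a.2 _ (h.1 a.1 a.2) z hz).trans ?_
    have h1 := hK i f F hf h hfin a.1 a.2
    have h2 := pow_nonneg (hθ i).1.le (a.1 + a.2)
    calc _ ≤ C i * θ i ^ (a.1 + a.2) * (K i * X) :=
          mul_le_mul_of_nonneg_left h1 (mul_nonneg (hC0 i) h2)
      _ = _ := by ring

lemma mu_closedBall_ne_top (s : ℝ) : mu n s (Metric.closedBall 0 (1 / 2)) ≠ ⊤ := by
  rw [mu, withDensity_apply _ Metric.isClosed_closedBall.measurableSet,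
    Measure.restrict_restrict Metric.isClosed_closedBall.measurableSet,
    Set.inter_eq_left.2 (Metric.closedBall_subset_ball (by norm_num))]
  have hc : ContinuousOn (fun z : Cn n => (ascPochhammer ℝ n).eval (s + 1) / Real.pi ^ n *
      (1 - ‖z‖ ^ 2) ^ s) (Metric.closedBall 0 (1 / 2)) := by
    refine continuousOn_const.mul fun z hz => ?_
    refine ((by fun_prop : Continuous fun z : Cn n => 1 - ‖z‖ ^ 2).continuousAt.rpow_const
      (Or.inl ?_)).continuousWithinAt
    have h1 : ‖z‖ ≤ 1 / 2 := by simpa using hz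
    have : 0 < 1 - ‖z‖ ^ 2 := by nlinarith [norm_nonneg z]
    exact this.ne'
  obtain ⟨D, hD⟩ := (isCompact_closedBall (0 : Cn n) (1 / 2)).exists_bound_of_continuousOn hc
  refine ne_top_of_le_ne_top ?_ (setLIntegral_mono' (g := fun _ => ENNReal.ofReal D)
    Metric.isClosed_closedBall.measurableSet fun z hz =>
      ENNReal.ofReal_le_ofReal ((le_abs_self _).trans (hD z hz)))
  rw [setLIntegral_const]
  exact ENNReal.mul_ne_top ENNReal.ofReal_ne_top (isCompact_closedBall _ _).measure_lt_top.ne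

/-- The index set of `normalTangentialSum`. -/
def ntIdx (n m : ℕ) : Finset (Σ x : Σ _ : ℕ, ℕ, Fin (x.1 - x.2) → XIndex n) :=
  ((Finset.range (m + 1)).sigma fun l => Finset.range (l + 1)).sigma fun _ => Finset.univ

lemma sum_ntIdx {M : Type*} [AddCommMonoid M] (m : ℕ)
    (g : (l k : ℕ) → (Fin (l - k) → XIndex n) → M) :
    ∑ x ∈ ntIdx n m, g x.1.1 x.1.2 x.2 = ∑ l ∈ Finset.range (m + 1), ∑ k ∈ Finset.range (l + 1),
      ∑ J : Fin (l - k) → XIndex n, g l k J := by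
  rw [ntIdx, Finset.sum_sigma, Finset.sum_sigma]

lemma sqNorm_le_normalTangentialSum (m : ℕ) (s : ℝ) (f : Cn n → ℂ) :
    sqNorm s f ≤ normalTangentialSum m s f := by
  refine le_trans ?_ (Finset.single_le_sum (f := fun l => ∑ k ∈ Finset.range (l + 1),
    ∑ J : Fin (l - k) → XIndex n, sqNorm s (opN^[k] (iterX J f))) (fun _ _ => zero_le)
    (Finset.mem_range.2 (Nat.succ_pos m)))
  simp [iterX]

/-- The ball is cut at `‖z‖ = 1/2`: outside, the operators of (a) recover the derivative pointwise;
inside, the interior estimate bounds it by `‖f‖_s`, which is itself a term of (a). -/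
lemma exists_sqNorm_wds_le (hn : 2 ≤ n) {s : ℝ} (hs : -1 < s) (m : ℕ)
    (w : List (Fin n ⊕ Fin n)) (hw : w.length ≤ m) : ∃ C : ℝ≥0∞, C ≠ ⊤ ∧
      ∀ (f : Cn n → ℂ) (F : ℕ → ℕ → Cn n → ℂ), ContinuousOn f (unitBall n) → IsCoeff f F →
        sqNorm s (wds w f) ≤ C * normalTangentialSum m s f := by
  obtain ⟨K, hK0, hK⟩ := exists_norm_wds_le_sqrt_sqNorm hn hs w
  obtain ⟨D, hD0, hD⟩ := exists_jet_wds_le w 0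
  obtain ⟨E, hE0, hE⟩ := exists_jet_le_ntsum (n := n) (0 + w.length)
  -- The summand one keeps `A` nonzero, so that `(A + B) * ⊤ = ⊤` when the norm of `f` is infinite.
  let A : ℝ≥0∞ := ENNReal.ofReal ((D * E) ^ 2 * (ntIdx n m).card) + 1
  let B : ℝ≥0∞ := ENNReal.ofReal (K ^ 2) * mu n s (Metric.closedBall 0 (1 / 2))
  refine ⟨A + B, ENNReal.add_ne_top.2 ⟨by simp [A], ENNReal.mul_ne_top ENNReal.ofReal_ne_top
    (mu_closedBall_ne_top s)⟩, fun f F hf h => ?_⟩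
  by_cases hfin : sqNorm s f = ⊤
  · have h1 : normalTangentialSum m s f = ⊤ :=
      top_le_iff.1 (hfin ▸ sqNorm_le_normalTangentialSum m s f)
    rw [h1, ENNReal.mul_top (by simp [A])]
    exact le_top
  have hfs := h.contDiffOn hn hf
  have hpt : ∀ z ∈ unitBall n, ‖wds w f z‖ₑ ^ 2 ≤
      A * ∑ x ∈ ntIdx n m, ‖opN^[x.1.2] (iterX x.2 f) z‖ₑ ^ 2 +
        (Metric.closedBall (0 : Cn n) (1 / 2)).indicator
          (fun _ => ENNReal.ofReal (K ^ 2) * sqNorm s f) z := by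
    intro z hz
    by_cases hz2 : ‖z‖ ≤ 1 / 2
    · refine le_add_left ?_
      rw [Set.indicator_of_mem (by simpa using hz2), enorm_sq_eq, ← ENNReal.ofReal_toReal hfin,
        ← ENNReal.ofReal_mul (sq_nonneg _)]
      refine ENNReal.ofReal_le_ofReal ?_
      have := pow_le_pow_left₀ (norm_nonneg _) (hK f F hf h hfin z hz2) 2
      rwa [mul_pow, Real.sq_sqrt ENNReal.toReal_nonneg] at this
    · refine le_add_right ?_
      have h1 : ‖wds w f z‖ ≤ D * E * ∑ x ∈ ntIdx n m, ‖opN^[x.1.2] (iterX x.2 f) z‖ := by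
        rw [sum_ntIdx m fun l k J => ‖opN^[k] (iterX J f) z‖]
        change _ ≤ _ * ntsum m f z
        calc ‖wds w f z‖ ≤ jet 0 (wds w f) z := norm_le_jet 0 _ z
          _ ≤ D * jet (0 + w.length) f z := hD f hfs z hz
          _ ≤ D * (E * ntsum (0 + w.length) f z) := by
              gcongr; exact hE f hfs z hz (not_le.1 hz2).le
          _ ≤ D * (E * ntsum m f z) := by gcongr; exact ntsum_mono (by omega) f z
          _ = _ := by ring
      exact (enorm_sq_le_of_norm_le _ (by positivity) h1).trans
        (mul_le_mul_left (le_self_add) _)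
  have hmeas : ∀ x ∈ ntIdx n m, AEMeasurable (fun z => ‖opN^[x.1.2] (iterX x.2 f) z‖ₑ ^ 2)
      (mu n s) := fun x _ => aemeasurable_enorm_sq
    (contDiffOn_opN_iterate _ (contDiffOn_iterX _ hfs)).continuousOn
  calc sqNorm s (wds w f) ≤ ∫⁻ z, (A * ∑ x ∈ ntIdx n m, ‖opN^[x.1.2] (iterX x.2 f) z‖ₑ ^ 2 +
        (Metric.closedBall (0 : Cn n) (1 / 2)).indicator
          (fun _ => ENNReal.ofReal (K ^ 2) * sqNorm s f) z) ∂(mu n s) := by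
        refine lintegral_mono_ae ?_
        filter_upwards [ae_mu_mem_ball s] with z hz using hpt z hz
    _ = A * normalTangentialSum m s f + B * sqNorm s f := by
        rw [lintegral_add_right _ (measurable_const.indicator
          Metric.isClosed_closedBall.measurableSet), lintegral_const_mul' _ _ (by simp [A]),
          lintegral_finsetSum' _ hmeas, lintegral_indicator_const
          Metric.isClosed_closedBall.measurableSet]
        congr 1
        · rw [normalTangentialSum]
          congr 1
          exact sum_ntIdx m fun l k J => sqNorm s (opN^[k] (iterX J f))
        · simp only [B]; ring
    _ ≤ (A + B) * normalTangentialSum m s f := by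
        rw [add_mul A B]
        exact add_le_add le_rfl (mul_le_mul_right (sqNorm_le_normalTangentialSum m s f) _)

lemma exists_classicalSqNorm_le (hn : 2 ≤ n) {s : ℝ} (hs : -1 < s) (m : ℕ) :
    ∃ C : ℝ≥0∞, C ≠ ⊤ ∧ ∀ (f : Cn n → ℂ) (F : ℕ → ℕ → Cn n → ℂ), ContinuousOn f (unitBall n) →
      IsCoeff f F → classicalSqNorm m s f ≤ C * normalTangentialSum m s f := by
  have key : ∀ γ : Fin n ⊕ Fin n → ℕ, ∃ C : ℝ≥0∞, C ≠ ⊤ ∧ (∑ i, γ i ≤ m →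
      ∀ (f : Cn n → ℂ) (F : ℕ → ℕ → Cn n → ℂ), ContinuousOn f (unitBall n) → IsCoeff f F →
        sqNorm s (mixedDeriv γ f) ≤ C * normalTangentialSum m s f) := by
    intro γ
    by_cases h : ∑ i, γ i ≤ m
    · obtain ⟨C, hC, h2⟩ := exists_sqNorm_wds_le hn hs m (gword γ) (by rwa [length_gword])
      exact ⟨C, hC, fun _ f F hf hF => by rw [mixedDeriv_eq_wds]; exact h2 f F hf hF⟩
    · exact ⟨0, ENNReal.zero_ne_top, fun h1 => absurd h1 h⟩
  choose C hC hle using key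
  refine ⟨∑ l ∈ Finset.range (m + 1),
    ∑ γ ∈ Finset.piAntidiag (Finset.univ : Finset (Fin n ⊕ Fin n)) l, C γ, ?_,
    fun f F hf hF => ?_⟩
  · exact ENNReal.sum_ne_top.2 fun l _ => ENNReal.sum_ne_top.2 fun γ _ => hC γ
  · rw [classicalSqNorm, Finset.sum_mul]
    refine Finset.sum_le_sum fun l hl => ?_
    rw [Finset.sum_mul]
    refine Finset.sum_le_sum fun γ hγ => hle γ ?_ f F hf hF
    rw [mem_piAntidiag_univ.1 hγ]
    have := Finset.mem_range.1 hl
    omega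

/-! ### Weak derivatives of smooth functions -/

/-- Smooth functions with compact support in the ball. -/
structure IsTest (φ : Cn n → ℂ) : Prop where
  contDiff : ContDiff ℝ ∞ φ
  hasCompactSupport : HasCompactSupport φ
  tsupport_subset : tsupport φ ⊆ unitBall n

lemma tsupport_wd_subset (i : Fin n ⊕ Fin n) (φ : Cn n → ℂ) :
    tsupport (MHarm.wd i φ) ⊆ tsupport φ := by
  have : MHarm.wd i φ = fun z => wl i (fderiv ℝ φ z) := funext fun z => wd_eq i φ z
  rw [this]
  exact (tsupport_comp_subset (g := wl i) (map_zero _) _).trans (tsupport_fderiv_subset ℝ)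

lemma IsTest.wd {φ : Cn n → ℂ} (h : IsTest φ) (i : Fin n ⊕ Fin n) : IsTest (MHarm.wd i φ) where
  contDiff := contDiff_wd h.contDiff i
  hasCompactSupport := h.hasCompactSupport.mono' (subset_closure.trans (tsupport_wd_subset i φ))
  tsupport_subset := (tsupport_wd_subset i φ).trans h.tsupport_subset

lemma IsTest.wds {φ : Cn n → ℂ} (h : IsTest φ) (w : List (Fin n ⊕ Fin n)) :
    IsTest (MHarm.wds w φ) := by
  induction w with
  | nil => exact h
  | cons i w ih => exact ih.wd i

lemma LocallyIntegrableOn.integrable_mul_isTest {u φ : Cn n → ℂ}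
    (hu : LocallyIntegrableOn u (unitBall n)) (h : Continuous φ) (hc : HasCompactSupport φ)
    (hs : tsupport φ ⊆ unitBall n) : Integrable (fun z => u z * φ z) := by
  have h1 : IntegrableOn u (tsupport φ) := hu.integrableOn_compact_subset hs hc
  have h2 : IntegrableOn (fun z => u z * φ z) (tsupport φ) :=
    h1.mul_continuousOn h.continuousOn hc
  refine (integrableOn_iff_integrable_of_support_subset fun z hz => ?_).1 h2
  exact subset_tsupport φ fun h0 => hz (by simp [h0])

lemma ContDiffOn.locallyIntegrableOn {u : Cn n → ℂ} (hu : ContDiffOn ℝ ∞ u (unitBall n)) :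
    LocallyIntegrableOn u (unitBall n) :=
  hu.continuousOn.locallyIntegrableOn Metric.isOpen_ball.measurableSet

lemma integral_mul_fderiv_isTest {u φ : Cn n → ℂ} (hu : ContDiffOn ℝ ∞ u (unitBall n))
    (h : IsTest φ) (v : Cn n) :
    ∫ z, u z * fderiv ℝ φ z v = - ∫ z, fderiv ℝ u z v * φ z := by
  have hφ' : ContDiff ℝ ∞ fun z => fderiv ℝ φ z v :=
    (h.contDiff.fderiv_right (m := (∞ : WithTop ℕ∞)) le_rfl).clm_apply contDiff_const
  have hu' : ContDiffOn ℝ ∞ (fun z => fderiv ℝ u z v) (unitBall n) :=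
    (hu.fderiv_of_isOpen (m := (∞ : WithTop ℕ∞)) Metric.isOpen_ball le_rfl).clm_apply contDiffOn_const
  have hsub := tsupport_fderiv_apply_subset (𝕜 := ℝ) (f := φ) v
  refine integral_mul_fderiv_eq_neg_fderiv_mul_of_integrable ?_ ?_ ?_ ?_ ?_
  · exact LocallyIntegrableOn.integrable_mul_isTest (ContDiffOn.locallyIntegrableOn hu')
      h.contDiff.continuous h.hasCompactSupport h.tsupport_subset
  · exact LocallyIntegrableOn.integrable_mul_isTest (ContDiffOn.locallyIntegrableOn hu)
      hφ'.continuous (h.hasCompactSupport.mono' (subset_closure.trans hsub))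
      (hsub.trans h.tsupport_subset)
  · exact LocallyIntegrableOn.integrable_mul_isTest (ContDiffOn.locallyIntegrableOn hu)
      h.contDiff.continuous h.hasCompactSupport h.tsupport_subset
  · exact fun z hz => (hu.contDiffAt (Metric.isOpen_ball.mem_nhds
      (h.tsupport_subset hz))).differentiableAt (by simp)
  · exact fun z _ => h.contDiff.contDiffAt.differentiableAt (by simp)

lemma integral_mul_wd {u φ : Cn n → ℂ} (hu : ContDiffOn ℝ ∞ u (unitBall n))
    (h : IsTest φ) (i : Fin n ⊕ Fin n) :
    ∫ z, u z * wd i φ z = - ∫ z, wd i u z * φ z := by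
  have hφ' : ∀ v, Integrable fun z => u z * fderiv ℝ φ z v := fun v => by
    have hφ' : ContDiff ℝ ∞ fun z => fderiv ℝ φ z v :=
      (h.contDiff.fderiv_right (m := (∞ : WithTop ℕ∞)) le_rfl).clm_apply contDiff_const
    have hsub := tsupport_fderiv_apply_subset (𝕜 := ℝ) (f := φ) v
    exact LocallyIntegrableOn.integrable_mul_isTest (ContDiffOn.locallyIntegrableOn hu)
      hφ'.continuous (h.hasCompactSupport.mono' (subset_closure.trans hsub))
      (hsub.trans h.tsupport_subset)
  have hu' : ∀ v, Integrable fun z => fderiv ℝ u z v * φ z := fun v => by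
    have hu' : ContDiffOn ℝ ∞ (fun z => fderiv ℝ u z v) (unitBall n) :=
      (hu.fderiv_of_isOpen (m := (∞ : WithTop ℕ∞)) Metric.isOpen_ball le_rfl).clm_apply
        contDiffOn_const
    exact LocallyIntegrableOn.integrable_mul_isTest (ContDiffOn.locallyIntegrableOn hu')
      h.contDiff.continuous h.hasCompactSupport h.tsupport_subset
  set a : Cn n := EuclideanSpace.single (widx i) (1 : ℂ)
  set b : Cn n := EuclideanSpace.single (widx i) Complex.I
  have e1 : ∀ z, u z * wd i φ z =
      (1 / 2) * (u z * fderiv ℝ φ z a) + (wsign i / 2) * (u z * fderiv ℝ φ z b) := fun z => by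
    rw [wd_eq, wl_apply]; ring
  have e2 : ∀ z, wd i u z * φ z =
      (1 / 2) * (fderiv ℝ u z a * φ z) + (wsign i / 2) * (fderiv ℝ u z b * φ z) := fun z => by
    rw [wd_eq, wl_apply]; ring
  simp only [e1, e2]
  rw [integral_add ((hφ' a).const_mul _) ((hφ' b).const_mul _),
    integral_add ((hu' a).const_mul _) ((hu' b).const_mul _), integral_const_mul,
    integral_const_mul, integral_const_mul, integral_const_mul,
    integral_mul_fderiv_isTest hu h, integral_mul_fderiv_isTest hu h]
  ring

/-- Moving the letters off `φ` one at a time reverses the word; this is harmless for smooth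
functions, whose derivatives commute. -/
lemma integral_mul_wds {u φ : Cn n → ℂ} (hu : ContDiffOn ℝ ∞ u (unitBall n))
    (h : IsTest φ) (w : List (Fin n ⊕ Fin n)) :
    ∫ z, u z * wds w φ z = (-1) ^ w.length * ∫ z, wds w.reverse u z * φ z := by
  induction w generalizing u with
  | nil => simp [wds]
  | cons i w ih =>
    have h1 : wds (i :: w).reverse u = wds w.reverse (wd i u) := by
      rw [List.reverse_cons, wds_append]; rfl
    rw [wds_cons, integral_mul_wd hu (h.wds w), ih ((firstOrder_wd i).contDiffOn hu), h1,
      List.length_cons, pow_succ]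
    ring

lemma setIntegral_mul_isTest (u : Cn n → ℂ) {φ : Cn n → ℂ} (h : tsupport φ ⊆ unitBall n) :
    ∫ z in unitBall n, u z * φ z = ∫ z, u z * φ z :=
  setIntegral_eq_integral_of_forall_compl_eq_zero fun z hz => by
    rw [image_eq_zero_of_notMem_tsupport fun h1 => hz (h h1), mul_zero]

lemma isWeakDeriv_mixedDeriv {f : Cn n → ℂ} (hf : ContDiffOn ℝ ∞ f (unitBall n))
    (γ : Fin n ⊕ Fin n → ℕ) : IsWeakDeriv γ f (mixedDeriv γ f) := by
  refine ⟨ContDiffOn.locallyIntegrableOn hf,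
    ContDiffOn.locallyIntegrableOn (contDiffOn_mixedDeriv γ hf), fun φ h1 h2 h3 => ?_⟩
  have hφ : IsTest φ := ⟨h1, h2, h3⟩
  rw [mixedDeriv_eq_wds γ φ, setIntegral_mul_isTest f (hφ.wds _).tsupport_subset,
    integral_mul_wds hf hφ, length_gword, ← setIntegral_mul_isTest _ h3]
  congr 1
  refine setIntegral_congr_fun Metric.isOpen_ball.measurableSet fun z hz => ?_
  rw [mixedDeriv_eq_wds]
  exact congrArg (· * φ z) (wds_perm (List.reverse_perm _) hf hz)

/-- The fundamental lemma of the calculus of variations; real-valued test functions suffice. -/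
lemma IsWeakDeriv.ae_eq {γ : Fin n ⊕ Fin n → ℕ} {f g g' : Cn n → ℂ} (h : IsWeakDeriv γ f g)
    (h' : IsWeakDeriv γ f g') : ∀ᵐ z, z ∈ unitBall n → g z = g' z := by
  have key := Metric.isOpen_ball.ae_eq_zero_of_integral_contDiff_smul_eq_zero
    (h.2.1.sub h'.2.1) (μ := volume) fun ψ h1 h2 h3 => ?_
  · filter_upwards [key] with z hz hz2 using sub_eq_zero.1 (hz hz2)
  · have hc : ContDiff ℝ ∞ fun z => (ψ z : ℂ) := Complex.ofRealCLM.contDiff.comp h1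
    have hsub : tsupport (fun z => (ψ z : ℂ)) ⊆ tsupport ψ :=
      tsupport_comp_subset (g := fun x : ℝ => (x : ℂ)) Complex.ofReal_zero ψ
    have hcs : HasCompactSupport fun z => (ψ z : ℂ) := h2.mono' (subset_closure.trans hsub)
    have hss := hsub.trans h3
    have e : ∀ z, ψ z • (g - g') z = g z * (ψ z : ℂ) - g' z * (ψ z : ℂ) := fun z => by
      rw [Complex.real_smul, Pi.sub_apply]; ring
    simp only [e]
    rw [integral_sub
      (LocallyIntegrableOn.integrable_mul_isTest h.2.1 hc.continuous hcs hss)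
      (LocallyIntegrableOn.integrable_mul_isTest h'.2.1 hc.continuous hcs hss), sub_eq_zero,
      ← setIntegral_mul_isTest g hss, ← setIntegral_mul_isTest g' hss]
    have h4 := h.2.2 _ hc hcs hss
    rw [h'.2.2 _ hc hcs hss] at h4
    exact (mul_left_cancel₀ (pow_ne_zero _ (neg_ne_zero.2 one_ne_zero)) h4).symm

lemma IsWeakDeriv.ae_eq_mu {γ : Fin n ⊕ Fin n → ℕ} {f g g' : Cn n → ℂ} (h : IsWeakDeriv γ f g)
    (h' : IsWeakDeriv γ f g') (s : ℝ) : g =ᵐ[mu n s] g' :=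
  (mu_absolutelyContinuous s).ae_le
    ((ae_restrict_iff' Metric.isOpen_ball.measurableSet).2 (h.ae_eq h'))

lemma IsWeakDeriv.sqNorm_eq {γ : Fin n ⊕ Fin n → ℕ} {f g g' : Cn n → ℂ} (h : IsWeakDeriv γ f g)
    (h' : IsWeakDeriv γ f g') (s : ℝ) : sqNorm s g = sqNorm s g' :=
  lintegral_congr_ae ((h.ae_eq_mu h' s).mono fun z hz => by simp only [hz])

/-- All weak derivatives of a given order have the same norm, so the infimum is attained at the
classical one. -/
lemma sobolevSqNorm_eq (m : ℕ) (s : ℝ) {f : Cn n → ℂ} (hf : ContDiffOn ℝ ∞ f (unitBall n)) :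
    sobolevSqNorm m s f = classicalSqNorm m s f := by
  refine Finset.sum_congr rfl fun l _ => Finset.sum_congr rfl fun γ _ => ?_
  have h := isWeakDeriv_mixedDeriv hf γ
  exact le_antisymm (iInf₂_le _ h) (le_iInf₂ fun g hg => (hg.sqNorm_eq h s).ge)

lemma sqNorm_lt_top_iff {s : ℝ} {g : Cn n → ℂ} : eLpNorm g 2 (mu n s) < ⊤ ↔ sqNorm s g < ⊤ := by
  rw [eLpNorm_lt_top_iff_lintegral_rpow_enorm_lt_top two_ne_zero ENNReal.ofNat_ne_top, sqNorm]
  simp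

lemma memSobolev_iff (m : ℕ) (s : ℝ) {f : Cn n → ℂ} (hf : ContDiffOn ℝ ∞ f (unitBall n)) :
    MemSobolev m s f ↔ sobolevSqNorm m s f < ⊤ := by
  rw [sobolevSqNorm_eq m s hf, classicalSqNorm]
  simp only [ENNReal.sum_lt_top, Finset.mem_range, mem_piAntidiag_univ]
  constructor
  · rintro h l hl γ rfl
    obtain ⟨g, hg, hg2⟩ := h γ (by omega)
    rw [← hg.sqNorm_eq (isWeakDeriv_mixedDeriv hf γ)]
    exact sqNorm_lt_top_iff.1 hg2.2
  · intro h γ hγ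
    have hc := (contDiffOn_mixedDeriv γ hf).continuousOn
    exact ⟨_, isWeakDeriv_mixedDeriv hf γ,
      (hc.aestronglyMeasurable Metric.isOpen_ball.measurableSet).mono_ac
        (mu_absolutelyContinuous s), sqNorm_lt_top_iff.2 (h _ (by omega) γ rfl)⟩

end MHarm

end

/-! ### The equivalences and a common constant -/

theorem proposition5p1 (n m : ℕ) (hn : 2 ≤ n) (hm : m ≤ n) (s : ℝ) (hs : -1 < s) :
    ∃ C : ℝ≥0, 0 < C ∧ ∀ f : MHarm.Cn n → ℂ, MHarm.IsMHarmonic f →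
      (∃! F : ℕ → ℕ → MHarm.Cn n → ℂ, MHarm.IsPeterWeyl f F) ∧
      ∀ F : ℕ → ℕ → MHarm.Cn n → ℂ, MHarm.IsPeterWeyl f F →
        List.TFAE [
          MHarm.normalTangentialSum m s f < ⊤,
          MHarm.coeffSum m s F < ⊤,
          MHarm.MemSobolev m s f] ∧
        MHarm.normalTangentialSum m s f ≤ C * MHarm.sobolevSqNorm m s f ∧
        MHarm.sobolevSqNorm m s f ≤ C * MHarm.normalTangentialSum m s f ∧
        MHarm.coeffSum m s F ≤ C * MHarm.sobolevSqNorm m s f ∧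
        MHarm.sobolevSqNorm m s f ≤ C * MHarm.coeffSum m s F := by
  obtain ⟨A, hA, h1⟩ := MHarm.exists_normalTangentialSum_le (n := n) m s
  obtain ⟨B, hB, h2⟩ := MHarm.exists_classicalSqNorm_le hn hs m
  set P := MHarm.polarConst n s
  have hP0 : P ≠ 0 := MHarm.polarConst_ne_zero (by omega) hs
  have hP : P ≠ ⊤ := MHarm.polarConst_ne_top s
  set Q : ℝ≥0∞ := P * (2 * n) ^ m
  have hQ : Q ≠ ⊤ := ENNReal.mul_ne_top hP
    (ENNReal.pow_ne_top (ENNReal.mul_ne_top ENNReal.ofNat_ne_top (ENNReal.natCast_ne_top n)))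
  have hP' : P⁻¹ ≠ ⊤ := ENNReal.inv_ne_top.2 hP0
  -- One constant for all four comparisons: the last four summands are the individual constants, and
  -- the leading one ensures positivity.
  set C : ℝ≥0∞ := 1 + A + B + P⁻¹ * A + B * Q with hCdef
  have hC : C ≠ ⊤ := ENNReal.add_ne_top.2 ⟨ENNReal.add_ne_top.2 ⟨ENNReal.add_ne_top.2
    ⟨ENNReal.add_ne_top.2 ⟨ENNReal.one_ne_top, hA⟩, hB⟩, ENNReal.mul_ne_top hP' hA⟩,
    ENNReal.mul_ne_top hB hQ⟩
  have hC1 : 1 ≤ C := by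
    simp only [hCdef, add_assoc]
    exact le_self_add
  refine ⟨C.toNNReal, ENNReal.toNNReal_pos (zero_lt_one.trans_le hC1).ne' hC, fun f hf => ?_⟩
  rw [ENNReal.coe_toNNReal hC]
  have hfc := hf.1.continuousOn
  refine ⟨hf.existsUnique_isPeterWeyl hn, fun F hF => ?_⟩
  have hF' := (MHarm.isPeterWeyl_iff hn hfc F).1 hF
  have hfs := hF'.contDiffOn hn hfc
  have a1 := h1 f hfs
  have a2 := h2 f F hfc hF'
  have a3 := hF'.coeffSum_le hn hs hfc m
  have a4 := hF'.normalTangentialSum_le hn hs hfc m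
  rw [← MHarm.sobolevSqNorm_eq m s hfs] at a1 a2
  have a3' : MHarm.coeffSum m s F ≤ P⁻¹ * MHarm.normalTangentialSum m s f := by
    have := mul_le_mul_right a3 P⁻¹
    rwa [← mul_assoc, ENNReal.inv_mul_cancel hP0 hP, one_mul] at this
  have a5 : MHarm.coeffSum m s F ≤ P⁻¹ * A * MHarm.sobolevSqNorm m s f :=
    a3'.trans (by rw [mul_assoc]; exact mul_le_mul_right a1 _)
  have a6 : MHarm.sobolevSqNorm m s f ≤ B * Q * MHarm.coeffSum m s F :=
    a2.trans (by rw [mul_assoc]; exact mul_le_mul_right a4 _)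
  refine ⟨?_, a1.trans (mul_le_mul_left ?_ _), a2.trans (mul_le_mul_left ?_ _),
    a5.trans (mul_le_mul_left ?_ _), a6.trans (mul_le_mul_left ?_ _)⟩
  · rw [MHarm.memSobolev_iff m s hfs]
    tfae_have 1 → 2 := fun h => a3'.trans_lt (ENNReal.mul_lt_top hP'.lt_top h)
    tfae_have 2 → 3 := fun h => a6.trans_lt (ENNReal.mul_lt_top (ENNReal.mul_lt_top hB.lt_top
      hQ.lt_top) h)
    tfae_have 3 → 1 := fun h => a1.trans_lt (ENNReal.mul_lt_top hA.lt_top h)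
    tfae_finish
  · exact (le_add_self.trans le_self_add).trans (le_self_add.trans le_self_add)
  · exact le_add_self.trans (le_self_add.trans le_self_add)
  · exact le_add_self.trans le_self_add
  · exact le_add_self
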